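/- Let $\hat{\mathbb C}=\mathbb C\cup\{\infty\}$ carry the spherical distance $d$, and let $\mathrm{Rat}$ be the space of non-constant rational maps $\hat{\mathbb C}\to\hat{\mathbb C}$ with the metric $\kappa(f,g)=\sup_{z}d(f(z),g(z))$. Let $\tau$ be a Borel probability measure on $\mathrm{Rat}$ with compact support $\Gamma_\tau$. Write $G_\tau=\{h_1\circ\cdots\circ h_n : n\ge 1,\ h_j\in\Gamma_\tau\}$, $X_\tau=\Gamma_\tau^{\mathbb N}$, $\tilde\tau=\bigotimes_{n\ge1}\tau$, and $\gamma_{n,1}=\gamma_n\circ\cdots\circ\gamma_1$ for $\gamma=(\gamma_1,\gamma_2,\dots)\in\mathrm{Rat}^{\mathbb N}$. Let $F(G_\tau)$ be the set of points having a neighbourhood on which $G_\tau$ is equicontinuous, $J(G_\tau)=\hat{\mathbb C}\setminus F(G_\tau)$, and $J_{\ker}(G_\tau)=\bigcap_{g\in G_\tau}g^{-1}(J(G_\tau))$. Let $F_\gamma$ be the set of points having a neighbourhood on which $\{\gamma_{n,1}\}_{n\ge1}$ is equicontinuous, and $J_\gamma=\hat{\mathbb C}\setminus F_\gamma$. Let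 $\mathrm{Min}$ be the set of minimal elements, with respect to inclusion, among the non-empty compact sets $L\subset J_{\ker}(G_\tau)$ with $g(L)\subset L$ for all $g\in G_\tau$. For a finite $L\in\mathrm{Min}$ let $\omega_L$ be the canonical $\tau$-ergodic measure on $L$, that is, the unique stationary probability measure of the irreducible Markov chain on $L$ with transition probabilities $p(x,A)=\tau(\{g: g(x)\in A\})$, and put $$\chi(\tau,L)=\int\!\!\int \log\|Dg_z\|_s\,d\tau(g)\,d\omega_L(z)\in[-\infty,\infty),$$ where $\|Dg_z\|_s$ is the norm of the differential of $g$ at $z$ for the spherical metric and $\log 0=-\infty$. Finally let $J^0_{pt}(\tau)$ be the set of points $y\in\hat{\mathbb C}$ at which the sequence of maps $z\mapsto (M_\tau^*)^n\delta_z$, $n\in\mathbb N$, into the space of Borel probability measures on $\hat{\mathbb C}$ with the (compact metrizable) weak topology is not equicontinuous, where $M_\tau^*$ is the dual of the operator $M_\tau\varphi(z)=\int\varphi(g(z))\,d\tau(g)$ on $C(\hat{\mathbb C})$. Suppose that (i) $J_{\ker}(G_\tau)$ is finite; (ii) $\chi(\tau,L)\ne0$ for each $L\in\mathrm{Min}$;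 (iii) for each $L\in\mathrm{Min}$ with $\chi(\tau,L)>0$, each $g\in\Gamma_\tau$ and each $x\in L$, $Dg_x\neq0$. Let $H_+=\{L\in\mathrm{Min}:\chi(\tau,L)>0\}$ and let $\Omega$ be the set of points $y\in\hat{\mathbb C}$ with $$\tilde\tau\Big(\Big\{\gamma\in X_\tau:\ \exists n\ge1,\ \gamma_{n,1}(y)\in\bigcup_{L\in H_+}L\Big\}\Big)=0.$$ Then: (a) $\hat{\mathbb C}\setminus\Omega$ is countable; (b) for each $z\in\Omega$, $\tilde\tau(\{\gamma\in X_\tau: z\in J_\gamma\})=0$; (c) for $\tilde\tau$-almost every $\gamma\in\mathrm{Rat}^{\mathbb N}$, $\mathrm{Leb}_2(J_\gamma)=0$, where $\mathrm{Leb}_2$ is the area measure on $\hat{\mathbb C}$; (d) $J^0_{pt}(\tau)\subset\hat{\mathbb C}\setminus\Omega$, and $J^0_{pt}(\tau)$ is countable. -/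

import Mathlib

open MeasureTheory Topology Filter Polynomial

namespace RandomRat

noncomputable section

/-! ### The Riemann sphere with its spherical distance -/

/-- The Riemann sphere `ℂ ∪ {∞}` (with the topology of the one-point compactification). -/
def CHat : Type := OnePoint ℂ

instance : TopologicalSpace CHat := inferInstanceAs (TopologicalSpace (OnePoint ℂ))
instance : CompactSpace CHat := inferInstanceAs (CompactSpace (OnePoint ℂ))
instance : T2Space CHat := inferInstanceAs (T2Space (OnePoint ℂ))

/-- The inclusion of the complex plane in the sphere. -/
def ofC (z : ℂ) : CHat := (z : OnePoint ℂ)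

/-- The point at infinity. -/
def infty : CHat := (OnePoint.infty : OnePoint ℂ)

instance : Inhabited CHat := ⟨infty⟩

/-- Functions on the sphere by cases: the value at `∞`, and the values on the plane. -/
def CHat.cases {α : Type*} (a : α) (f : ℂ → α) (z : CHat) : α := OnePoint.elim z a f

@[simp] theorem CHat.cases_ofC {α : Type*} (a : α) (f : ℂ → α) (z : ℂ) :
    CHat.cases a f (ofC z) = f z := rfl

@[simp] theorem CHat.cases_infty {α : Type*} (a : α) (f : ℂ → α) :
    CHat.cases a f infty = a := rfl

theorem CHat.eq_infty_or (z : CHat) : z = infty ∨ ∃ w : ℂ, z = ofC w := by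
  induction z using OnePoint.rec with
  | infty => exact Or.inl rfl
  | coe w => exact Or.inr ⟨w, rfl⟩

/-- Inverse stereographic projection onto the unit sphere of `ℝ³`; `∞` is the north pole. -/
def stereo : CHat → EuclideanSpace ℝ (Fin 3) :=
  CHat.cases !₂[0, 0, 1] fun z =>
    !₂[2 * z.re / (1 + ‖z‖ ^ 2), 2 * z.im / (1 + ‖z‖ ^ 2), (‖z‖ ^ 2 - 1) / (1 + ‖z‖ ^ 2)]

theorem norm_stereo (z : CHat) : ‖stereo z‖ = 1 := by
  rcases z.eq_infty_or with rfl | ⟨w, rfl⟩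
  · simp [stereo, EuclideanSpace.norm_eq, Fin.sum_univ_three]
  · have h : (1 + ‖w‖ ^ 2) ≠ 0 := by positivity
    have h2 : ‖w‖ ^ 2 = w.re ^ 2 + w.im ^ 2 := by
      rw [← Complex.normSq_eq_norm_sq, Complex.normSq_apply]; ring
    simp only [stereo, CHat.cases_ofC, EuclideanSpace.norm_eq, Fin.sum_univ_three, Real.norm_eq_abs,
      sq_abs, Matrix.cons_val]
    rw [Real.sqrt_eq_one]
    field_simp
    rw [h2]
    ring

theorem stereo_injective : Function.Injective stereo := by
  intro z w hzw
  have key : ∀ u : ℂ, (‖u‖ ^ 2 - 1) / (1 + ‖u‖ ^ 2) = 1 - 2 / (1 + ‖u‖ ^ 2) := by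
    intro u
    have h : (1 + ‖u‖ ^ 2) ≠ 0 := by positivity
    field_simp
    ring
  have pos : ∀ u : ℂ, 0 < 2 / (1 + ‖u‖ ^ 2) := fun u => by positivity
  rcases z.eq_infty_or with rfl | ⟨z, rfl⟩ <;> rcases w.eq_infty_or with rfl | ⟨w, rfl⟩
  · rfl
  · have := congrArg (fun v => v 2) hzw
    simp only [stereo, CHat.cases_ofC, CHat.cases_infty, Matrix.cons_val, key] at this
    linarith [pos w]
  · have := congrArg (fun v => v 2) hzw
    simp only [stereo, CHat.cases_ofC, CHat.cases_infty, Matrix.cons_val, key] at this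
    linarith [pos z]
  · have h0 := congrArg (fun v => v 0) hzw
    have h1 := congrArg (fun v => v 1) hzw
    have h2 := congrArg (fun v => v 2) hzw
    simp only [stereo, CHat.cases_ofC, PiLp.toLp_apply, Matrix.cons_val, key] at h0 h1 h2
    have hz : (1 + ‖z‖ ^ 2) ≠ 0 := by positivity
    have hw : (1 + ‖w‖ ^ 2) ≠ 0 := by positivity
    have h3 : 1 + ‖z‖ ^ 2 = 1 + ‖w‖ ^ 2 := by
      have : 2 / (1 + ‖z‖ ^ 2) = 2 / (1 + ‖w‖ ^ 2) := by linarith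
      field_simp at this
      linarith
    rw [h3] at h0 h1
    field_simp at h0 h1
    rw [Complex.ext h0 h1]

theorem continuous_stereo : Continuous stereo := by
  have hfin : Continuous fun z : ℂ => stereo (ofC z) := by
    simp only [stereo, CHat.cases_ofC]
    refine (PiLp.continuous_toLp 2 _).comp (continuous_pi fun i => ?_)
    have h : ∀ z : ℂ, (1 + ‖z‖ ^ 2) ≠ 0 := fun z => by positivity
    fin_cases i
    · exact Continuous.div (by fun_prop) (by fun_prop) h
    · exact Continuous.div (by fun_prop) (by fun_prop) h
    · exact Continuous.div (by fun_prop) (by fun_prop) h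
  refine (OnePoint.continuous_iff (X := ℂ) stereo).2 ⟨?_, hfin⟩
  rw [coclosedCompact_eq_cocompact]
  have hn : Tendsto (fun z : ℂ => 2 / ‖z‖) (cocompact ℂ) (𝓝 0) :=
    tendsto_const_nhds.div_atTop (tendsto_norm_cocompact_atTop)
  have hn2 : Tendsto (fun z : ℂ => 2 / (1 + ‖z‖ ^ 2)) (cocompact ℂ) (𝓝 0) := by
    refine tendsto_const_nhds.div_atTop (tendsto_atTop_add_const_left _ _ ?_)
    exact (tendsto_pow_atTop (by norm_num)).comp (tendsto_norm_cocompact_atTop)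
  have hb : ∀ (z : ℂ) (t : ℝ), |t| ≤ ‖z‖ → |2 * t / (1 + ‖z‖ ^ 2)| ≤ 2 / ‖z‖ := by
    intro z t ht
    rcases eq_or_ne z 0 with rfl | hz
    · have : t = 0 := by simpa using ht
      simp [this]
    · have hz' : 0 < ‖z‖ := norm_pos_iff.2 hz
      rw [abs_div, abs_mul, abs_two, abs_of_pos (by positivity : 0 < 1 + ‖z‖ ^ 2),
        div_le_div_iff₀ (by positivity) hz']
      nlinarith [mul_le_mul_of_nonneg_right ht hz'.le]
  refine ((PiLp.continuous_toLp 2 _).tendsto _).comp (tendsto_pi_nhds.2 fun i => ?_)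
  fin_cases i
  · exact squeeze_zero_norm (f := fun z : ℂ => 2 * z.re / (1 + ‖z‖ ^ 2))
      (fun z => hb z _ (Complex.abs_re_le_norm z)) hn
  · exact squeeze_zero_norm (f := fun z : ℂ => 2 * z.im / (1 + ‖z‖ ^ 2))
      (fun z => hb z _ (Complex.abs_im_le_norm z)) hn
  · have : (fun z : ℂ => (‖z‖ ^ 2 - 1) / (1 + ‖z‖ ^ 2)) = fun z : ℂ => 1 - 2 / (1 + ‖z‖ ^ 2) := by
      funext z
      have h : (1 + ‖z‖ ^ 2) ≠ 0 := by positivity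
      field_simp
      ring
    have h1 := (tendsto_const_nhds (x := (1 : ℝ))).sub hn2
    rw [sub_zero, ← this] at h1
    exact h1

/-- The spherical (great circle) distance. -/
def sphDist (z w : CHat) : ℝ := InnerProductGeometry.angle (stereo z) (stereo w)

/-- The metric space given by the spherical distance, before its topology is identified. -/
abbrev sphMetricAux : MetricSpace CHat where
  dist := sphDist
  dist_self z := InnerProductGeometry.angle_self (by
    intro h
    have := norm_stereo z
    rw [h] at this
    simp at this)
  dist_comm z w := InnerProductGeometry.angle_comm _ _
  dist_triangle x y z := InnerProductGeometry.angle_le_angle_add_angle _ _ _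
  eq_of_dist_eq_zero := by
    intro z w h
    apply stereo_injective
    obtain ⟨h0, r, hr, h1⟩ := InnerProductGeometry.angle_eq_zero_iff.1 h
    have h2 := congrArg norm h1
    rw [norm_smul, norm_stereo, norm_stereo, Real.norm_eq_abs, abs_of_pos hr, mul_one] at h2
    rw [h1, ← h2, one_smul]

theorem eq_induced_of_tendsto {α β : Type*} [t : TopologicalSpace α] [CompactSpace α]
    [MetricSpace β] (e : α ≃ β) (h : ∀ x, Tendsto (fun y => dist (e y) (e x)) (𝓝 x) (𝓝 0)) :
    t = TopologicalSpace.induced e inferInstance := by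
  have hc : Continuous e :=
    continuous_iff_continuousAt.2 fun x => tendsto_iff_dist_tendsto_zero.2 (h x)
  exact (hc.homeoOfEquivCompactToT2).isInducing.eq_induced

theorem sphTopology_eq : (inferInstanceAs (TopologicalSpace CHat)) =
    sphMetricAux.toPseudoMetricSpace.toUniformSpace.toTopologicalSpace := by
  have hne : ∀ z, stereo z ≠ 0 := fun z h => by
    have := norm_stereo z
    rw [h] at this
    simp at this
  have h1 : ∀ x : CHat, Tendsto (fun y : CHat => sphDist y x) (𝓝 x) (𝓝 0) := by
    intro x
    have h1 : ContinuousAt (fun y : CHat => InnerProductGeometry.angle (stereo y) (stereo x)) x :=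
      ContinuousAt.comp (x := x)
        (f := fun y : CHat => (stereo y, stereo x))
        (InnerProductGeometry.continuousAt_angle (x := (stereo x, stereo x)) (hne x) (hne x))
        (continuous_stereo.prodMk continuous_const).continuousAt
    have h2 := h1.tendsto
    rw [InnerProductGeometry.angle_self (hne x)] at h2
    exact h2
  exact (@eq_induced_of_tendsto CHat CHat _ _ sphMetricAux (Equiv.refl CHat) h1).trans
    (@induced_id _ (_))

/-- The sphere is a metric space with the spherical distance. -/
instance : MetricSpace CHat := sphMetricAux.replaceTopology sphTopology_eq

instance : MeasurableSpace CHat := borel CHat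
instance : BorelSpace CHat := ⟨rfl⟩

/-- The area measure `Leb₂` of the sphere: the spherical metric is `2 |dz| / (1 + |z|²)`. -/
def Leb₂ : Measure CHat :=
  Measure.map ofC (volume.withDensity fun z : ℂ => ENNReal.ofReal (4 / (1 + ‖z‖ ^ 2) ^ 2))

/-! ### Rational maps -/

/-- The point `a / b` of the sphere, `∞` if `b = 0` (used only for `(a, b) ≠ (0, 0)`). -/
def quot (a b : ℂ) : CHat := open Classical in if b = 0 then infty else ofC (a / b)

/-- The map `z ↦ p(z) / q(z)` of the sphere; its value at `∞` is the quotient of the coefficients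
of degree `max (deg p) (deg q)`. -/
def ratEval (p q : ℂ[X]) : CHat → CHat :=
  CHat.cases
    (quot (p.coeff (max p.natDegree q.natDegree)) (q.coeff (max p.natDegree q.natDegree)))
    fun z => quot (p.eval z) (q.eval z)

/-- `f` is given by a fraction of two polynomials in lowest terms. -/
def IsRational (f : CHat → CHat) : Prop := ∃ p q : ℂ[X], IsCoprime p q ∧ f = ratEval p q

/-- The space of non-constant rational maps. As a subspace of `C(CHat, CHat)` it carries the metric
`κ(f, g) = sup_z d(f z, g z)`. -/
def Rat : Type := {f : C(CHat, CHat) // IsRational f ∧ ¬ ∃ c, ∀ z, f z = c}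

instance : MetricSpace Rat :=
  inferInstanceAs (MetricSpace {f : C(CHat, CHat) // IsRational f ∧ ¬ ∃ c, ∀ z, f z = c})

instance : CoeFun Rat fun _ => CHat → CHat := ⟨fun g => g.1⟩

instance : MeasurableSpace Rat := borel Rat
instance : BorelSpace Rat := ⟨rfl⟩

/-- The standard chart of the sphere near `a`: the identity if `a` is finite, `w ↦ 1 / w` (with
`∞ ↦ 0`) if `a = ∞`. Both are isometric coordinates for `2 |dz| / (1 + |z|²)`. The value at the
one point outside the domain of the chart is irrelevant. -/
def chart (a : CHat) : CHat → ℂ :=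
  CHat.cases (CHat.cases 0 fun w => w⁻¹) (fun _ => CHat.cases 0 fun w => w) a

/-- The inverse of `chart a`. -/
def chartInv (a : CHat) : ℂ → CHat :=
  CHat.cases (fun u => quot 1 u) (fun _ u => ofC u) a

/-- The complex differential `D f_z`, as a complex number in the standard charts at `z`, `f z`. -/
def D (f : CHat → CHat) (z : CHat) : ℂ :=
  deriv (fun u => chart (f z) (f (chartInv z u))) (chart z z)

/-- The norm `‖D f_z‖_s` of the differential for the spherical metric. -/
def sphNorm (f : CHat → CHat) (z : CHat) : ℝ :=
  ‖D f z‖ * (1 + ‖chart z z‖ ^ 2) / (1 + ‖chart (f z) (f z)‖ ^ 2)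

/-! ### Rational semigroups -/

/-- The semigroup `{h₁ ∘ ⋯ ∘ hₙ | n ≥ 1, hⱼ ∈ Γ}` generated by `Γ`. -/
inductive Gen (Γ : Set Rat) : Set (CHat → CHat)
  | of (g : Rat) (hg : g ∈ Γ) : Gen Γ g
  | comp (g : Rat) (h : CHat → CHat) (hg : g ∈ Γ) (hh : Gen Γ h) : Gen Γ (g ∘ h)

/-- The Fatou set of a set of self-maps of the sphere. -/
def Fatou (G : Set (CHat → CHat)) : Set CHat :=
  {z | ∃ U ∈ 𝓝 z, EquicontinuousOn (fun g : G => (g : CHat → CHat)) U}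

/-- The Julia set. -/
def Julia (G : Set (CHat → CHat)) : Set CHat := (Fatou G)ᶜ

/-- The kernel Julia set. -/
def Jker (G : Set (CHat → CHat)) : Set CHat := ⋂ g ∈ G, g ⁻¹' Julia G

/-- The minimal sets for `(G, Y)`: the minimal elements among the non-empty compact subsets `L` of
`Y` with `G(L) ⊆ L`. -/
def Min (G : Set (CHat → CHat)) (Y : Set CHat) : Set (Set CHat) :=
  {K | Minimal (fun L => IsCompact L ∧ L.Nonempty ∧ L ⊆ Y ∧ ∀ g ∈ G, g '' L ⊆ L) K}

/-! ### Random sequences -/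

/-- `comps γ n = γₙ ∘ ⋯ ∘ γ₁`, where the sequence `(γ₁, γ₂, …)` is indexed as `γ 0, γ 1, …`. -/
def comps (γ : ℕ → Rat) : ℕ → CHat → CHat
  | 0 => id
  | n + 1 => γ n ∘ comps γ n

/-- The Fatou set of a sequence of maps. -/
def FatouSeq (γ : ℕ → Rat) : Set CHat :=
  {z | ∃ U ∈ 𝓝 z, EquicontinuousOn (fun n : ℕ => comps γ (n + 1)) U}

/-- The Julia set `J_γ` of a sequence of maps. -/
def JuliaSeq (γ : ℕ → Rat) : Set CHat := (FatouSeq γ)ᶜ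

/-- The support `Γ_τ`. -/
def supp (τ : ProbabilityMeasure Rat) : Set Rat := (τ : Measure Rat).support

/-- The semigroup `G_τ` generated by the support of `τ`. -/
def G (τ : ProbabilityMeasure Rat) : Set (CHat → CHat) := Gen (supp τ)

/-- The sequences of elements of the support of `τ`. -/
def X (τ : ProbabilityMeasure Rat) : Set (ℕ → Rat) := {γ | ∀ n, γ n ∈ supp τ}

/-- The product measure `⊗ₙ τ` on `Rat^ℕ`. -/
def prodMeas (τ : ProbabilityMeasure Rat) : Measure (ℕ → Rat) :=
  Measure.infinitePi fun _ : ℕ => (τ : Measure Rat)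

/-! ### The transition operator and the pointwise Julia set -/

theorem Rat.continuous_eval (z : CHat) : Continuous fun g : Rat => g z :=
  (ContinuousEvalConst.continuous_eval_const (F := C(CHat, CHat)) z).comp continuous_subtype_val

theorem integrable_eval (τ : ProbabilityMeasure Rat) (φ : C(CHat, ℂ)) (z : CHat) :
    Integrable (fun g : Rat => φ (g z)) (τ : Measure Rat) :=
  Integrable.of_bound
    ((φ.continuous.comp (Rat.continuous_eval z)).measurable.aestronglyMeasurable) ‖φ‖
    (Eventually.of_forall fun g => φ.norm_coe_le_norm (g z))

/-- The transition operator `(M_τ φ)(z) = ∫ φ(g z) dτ(g)` on `C(CHat)`. -/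
def transOp (τ : ProbabilityMeasure Rat) : C(CHat, ℂ) →L[ℂ] C(CHat, ℂ) :=
  LinearMap.mkContinuous
    { toFun := fun φ =>
        { toFun := fun z => ∫ g : Rat, φ (g z) ∂(τ : Measure Rat)
          continuous_toFun := continuous_of_dominated (bound := fun _ => ‖φ‖)
            (fun z => (integrable_eval τ φ z).aestronglyMeasurable)
            (fun z => Eventually.of_forall fun g => φ.norm_coe_le_norm (g z))
            (integrable_const _)
            (Eventually.of_forall fun g => φ.continuous.comp g.1.continuous) }
      map_add' := fun φ ψ => by
        ext z
        exact integral_add (integrable_eval τ φ z) (integrable_eval τ ψ z)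
      map_smul' := fun c φ => by
        ext z
        exact integral_const_mul c _ } 1 (by
    intro φ
    rw [one_mul]
    refine (ContinuousMap.norm_le _ (norm_nonneg _)).2 fun z => ?_
    have h := norm_integral_le_of_norm_le_const (μ := (τ : Measure Rat))
      (Eventually.of_forall fun g : Rat => φ.norm_coe_le_norm (g z))
    simpa using h)

/-- The dual operator `M_τ^*` on the dual of `C(CHat)`. -/
def dualOp (τ : ProbabilityMeasure Rat) (μ : C(CHat, ℂ) →L[ℂ] ℂ) : C(CHat, ℂ) →L[ℂ] ℂ :=
  μ.comp (transOp τ)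

/-- The Dirac measure at `z` as an element of the dual of `C(CHat)`. -/
def Φ (z : CHat) : C(CHat, ℂ) →L[ℂ] ℂ := ContinuousMap.evalCLM ℂ z

/-- The distance `d₀(μ, ν) = ∑_{j ≥ 1} 2^{-j} |μ(φⱼ) - ν(φⱼ)| / (1 + |μ(φⱼ) - ν(φⱼ)|)`, which for a
dense sequence `φ` in `C(CHat)` metrizes the weak topology of the probability measures. -/
def d₀ (φ : ℕ → C(CHat, ℂ)) (μ ν : C(CHat, ℂ) →L[ℂ] ℂ) : ℝ :=
  ∑' j : ℕ, (1 / 2 : ℝ) ^ (j + 1) * (‖μ (φ j) - ν (φ j)‖ / (1 + ‖μ (φ j) - ν (φ j)‖))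

/-- The pointwise Fatou set `F_pt^0(τ)`: the points at which the maps `z ↦ (M_τ^*)^n (δ_z)` into the
probability measures are equicontinuous. (The condition does not depend on the dense sequence.) -/
def Fpt0 (τ : ProbabilityMeasure Rat) : Set CHat :=
  {y | ∀ φ : ℕ → C(CHat, ℂ), DenseRange φ → ∀ ε > 0, ∃ δ > 0, ∀ z, dist z y < δ →
    ∀ n : ℕ, d₀ φ ((dualOp τ)^[n] (Φ z)) ((dualOp τ)^[n] (Φ y)) < ε}

/-- The pointwise Julia set `J_pt^0(τ)`. -/
def Jpt0 (τ : ProbabilityMeasure Rat) : Set CHat := (Fpt0 τ)ᶜ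

/-! ### Invariant measures and Lyapunov exponents -/

/-- `ρ` is `τ`-invariant: `M_τ^* ρ = ρ`. -/
def IsInvariant (τ : ProbabilityMeasure Rat) (ρ : ProbabilityMeasure CHat) : Prop :=
  ∀ φ : C(CHat, ℂ), ∫ z, transOp τ φ z ∂(ρ : Measure CHat) = ∫ z, φ z ∂(ρ : Measure CHat)

/-- `ρ` is `τ`-ergodic: it is invariant, and a Borel set `A` of positive measure with
`M_τ 1_A = 1_A` almost everywhere has full measure. -/
def IsErgodic (τ : ProbabilityMeasure Rat) (ρ : ProbabilityMeasure CHat) : Prop :=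
  IsInvariant τ ρ ∧ ∀ A : Set CHat, MeasurableSet A → 0 < (ρ : Measure CHat) A →
    (∀ᵐ z ∂(ρ : Measure CHat), (τ : Measure Rat) {g | g z ∈ A} = A.indicator 1 z) →
    (ρ : Measure CHat) A = 1

/-- The canonical `τ`-ergodic measure on a finite minimal set `L`: the (unique) `τ`-ergodic
probability measure that is carried by `L`, i.e. the stationary distribution of the irreducible
Markov chain that `τ` induces on `L`. -/
def canonicalMeas (τ : ProbabilityMeasure Rat) (L : Set CHat) : ProbabilityMeasure CHat :=
  haveI : Nonempty (ProbabilityMeasure CHat) := ⟨⟨Measure.dirac infty, inferInstance⟩⟩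
  Classical.epsilon fun ω => IsErgodic τ ω ∧ (ω : Measure CHat) L = 1

/-- The integral of an extended real function, the integral of the positive part minus that of the
negative part. -/
def eintegral {α : Type*} [MeasurableSpace α] (μ : Measure α) (f : α → EReal) : EReal :=
  ((∫⁻ x, (f x).toENNReal ∂μ : ENNReal) : EReal) - ((∫⁻ x, (-f x).toENNReal ∂μ : ENNReal) : EReal)

/-- The Lyapunov exponent `χ(τ, ρ) = ∫ log ‖D(γ₁)_y‖_s d(⊗τ ⊗ ρ)(γ, y)`, in `[-∞, ∞]`, with
`log 0 = -∞`. -/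
def lyapMeas (τ : ProbabilityMeasure Rat) (ρ : ProbabilityMeasure CHat) : EReal :=
  eintegral ((prodMeas τ).prod (ρ : Measure CHat)) fun x =>
    ENNReal.log (ENNReal.ofReal (sphNorm (x.1 0) x.2))

/-- The Lyapunov exponent `χ(τ, L)` of a finite minimal set `L`. -/
def χ (τ : ProbabilityMeasure Rat) (L : Set CHat) : EReal := lyapMeas τ (canonicalMeas τ L)

/-- The set `H₊` of the minimal sets in the kernel Julia set with positive Lyapunov exponent. -/
def Hplus (τ : ProbabilityMeasure Rat) : Set (Set CHat) :=
  {L | L ∈ Min (G τ) (Jker (G τ)) ∧ 0 < χ τ L}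

/-- The set `Ω` of the points that almost surely never hit a minimal set in `H₊`. -/
def Omega (τ : ProbabilityMeasure Rat) : Set CHat :=
  {y | prodMeas τ {γ | γ ∈ X τ ∧ ∃ n : ℕ, 1 ≤ n ∧ comps γ n y ∈ ⋃ L ∈ Hplus τ, L} = 0}

end

end RandomRat

namespace RandomRat
noncomputable section

/-! ### Charts and the spherical distance -/

/-! The heart of the matter is that, almost surely, a point of `J_γ` has an orbit which lands
exactly on some `L ∈ H₊` (`prodMeas_JuliaSeq_avoiding_Hplus`). A point outside the kernel Julia set
can be sent into the Fatou set of the semigroup. By compactness this happens with probability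
bounded below on each set at positive distance from the kernel. So almost surely an orbit either
enters the Fatou set, which puts its starting point in `F_γ`, or converges to the finite kernel
(`ae_hits_Fatou`). In the second case it is asymptotic to an orbit inside the kernel
(`exists_shadowing`), and that orbit is absorbed by some minimal `L` (`ae_hits_Min`).

If `χ(τ, L) > 0`, the maps expand on average along `L`, so an orbit asymptotic to one in `L` must
land on `L` (`ae_not_tendsto_of_repulsion`). If `χ(τ, L) < 0`, points close to `L` lie in `J_γ` with
probability at most `ε` (`exists_prodMeas_JuliaSeq_le`). The bad event is inherited by the orbit
and, up to a null set, forces a visit to the points with this property. Hence it has probability at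
most `ε` from every starting point (`prodMeas_le_of_hits`), and `ε` is arbitrary.

The sign of the exponent acts through sums along the chain on `L`. Solving the Poisson equation
changes the summand by a bounded coboundary so that its conditional mean is the same negative number
at every state. Exponential moments then decay geometrically, and the sums tend to `-∞`
(`ae_tendsto_atBot`). No ergodic theorem is needed. Passing from derivatives to distances uses a
first-order expansion that is uniform on compact families of maps (`exists_sphNorm_expansion`).

The exceptional set is countable because fibres of rational maps are finite: infinitely many points
cannot each hit a given point at a given time with probability bounded below. The area statement
follows by Fubini, and equicontinuity of the averaged dynamics by dominated convergence. -/

instance : SecondCountableTopology Rat :=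
  inferInstanceAs (SecondCountableTopology
    {f : C(CHat, CHat) // IsRational f ∧ ¬ ∃ c, ∀ z, f z = c})

theorem dist_eq_angle (x y : CHat) :
    dist x y = InnerProductGeometry.angle (stereo x) (stereo y) := rfl

theorem ofC_injective : Function.Injective ofC := fun _ _ h => OnePoint.coe_injective h

theorem ofC_ne_infty (z : ℂ) : ofC z ≠ infty := OnePoint.coe_ne_infty z

/-- The only point outside the domain of `chart b`. -/
def far (b : CHat) : CHat := CHat.cases (ofC 0) (fun _ => infty) b

theorem far_ne (b : CHat) : b ≠ far b := by
  rcases b.eq_infty_or with rfl | ⟨w, rfl⟩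
  · exact (ofC_ne_infty 0).symm
  · exact ofC_ne_infty w

theorem quot_of_ne {a b : ℂ} (hb : b ≠ 0) : quot a b = ofC (a / b) := by simp [quot, hb]

theorem quot_zero (a : ℂ) : quot a 0 = infty := by simp [quot]

theorem chartInv_chart (b : CHat) {y : CHat} (h : y ≠ far b) : chartInv b (chart b y) = y := by
  rcases b.eq_infty_or with rfl | ⟨w, rfl⟩ <;> rcases y.eq_infty_or with rfl | ⟨v, rfl⟩
  · simp [chart, chartInv, quot_zero]
  · have hv : v ≠ 0 := fun hv => h (by rw [hv]; rfl)
    simp [chart, chartInv, quot_of_ne (inv_ne_zero hv)]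
  · exact absurd rfl h
  · rfl

theorem chartInv_chart_self (b : CHat) : chartInv b (chart b b) = b :=
  chartInv_chart b (far_ne b)

theorem chart_quot_ofC (c a b : ℂ) : chart (ofC c) (quot a b) = a / b := by
  by_cases hb : b = 0
  · simp [hb, quot_zero, chart]
  · simp [quot_of_ne hb, chart]

theorem chart_quot_infty (a b : ℂ) : chart infty (quot a b) = b / a := by
  by_cases hb : b = 0
  · simp [hb, quot_zero, chart]
  · simp [quot_of_ne hb, chart]

theorem continuousAt_chart (b : CHat) : ContinuousAt (chart b) b := by
  rcases b.eq_infty_or with rfl | ⟨w, rfl⟩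
  · refine OnePoint.continuousAt_infty'.2 ?_
    rw [coclosedCompact_eq_cocompact, ← Metric.cobounded_eq_cocompact]
    exact Filter.tendsto_inv₀_cobounded
  · exact OnePoint.continuousAt_coe.2 continuousAt_id

/-- This is the chordal distance formula in the chart at `x`; the half-angle identity below turns it
into the great circle distance. -/
theorem inner_stereo_chartInv (x : CHat) (u : ℂ) :
    inner ℝ (stereo (chartInv x u)) (stereo x) =
      1 - 2 * (‖u - chart x x‖ ^ 2 / ((1 + ‖u‖ ^ 2) * (1 + ‖chart x x‖ ^ 2))) := by
  have key : ∀ v : ℂ, ‖v‖ ^ 2 = v.re ^ 2 + v.im ^ 2 := fun v => by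
    rw [← Complex.normSq_eq_norm_sq, Complex.normSq_apply]; ring
  rcases x.eq_infty_or with rfl | ⟨w, rfl⟩
  · by_cases hu : u = 0
    · subst hu
      simp only [chartInv, chart, CHat.cases_infty, quot_zero, sub_zero, norm_zero]
      rw [real_inner_self_eq_norm_sq, norm_stereo]
      norm_num
    · simp only [chartInv, chart, CHat.cases_infty, quot_of_ne hu, stereo, CHat.cases_ofC,
        PiLp.inner_apply, Fin.sum_univ_three, Matrix.cons_val]
      have h1 : ‖u‖ ≠ 0 := norm_ne_zero_iff.2 hu
      have h2 : (1 + ‖u‖ ^ 2) ≠ 0 := by positivity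
      simp
      field_simp
      ring
  · simp only [chartInv, chart, CHat.cases_ofC, stereo,
        PiLp.inner_apply, Fin.sum_univ_three, Matrix.cons_val, RCLike.inner_apply,
        conj_trivial]
    have h1 : (1 + ‖u‖ ^ 2) ≠ 0 := by positivity
    have h2 : (1 + ‖w‖ ^ 2) ≠ 0 := by positivity
    field_simp
    rw [key, key, key, Complex.sub_re, Complex.sub_im]
    ring

theorem sin_half_dist_chartInv (x : CHat) (u : ℂ) :
    Real.sin (dist (chartInv x u) x / 2) =
      ‖u - chart x x‖ / (√(1 + ‖u‖ ^ 2) * √(1 + ‖chart x x‖ ^ 2)) := by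
  have h0 : 0 ≤ dist (chartInv x u) x / 2 := by positivity
  have h1 : dist (chartInv x u) x / 2 ≤ Real.pi / 2 := by
    have := InnerProductGeometry.angle_le_pi (stereo (chartInv x u)) (stereo x)
    rw [dist_eq_angle]
    linarith
  have h2 : 0 ≤ Real.sin (dist (chartInv x u) x / 2) :=
    Real.sin_nonneg_of_nonneg_of_le_pi h0 (by linarith [Real.pi_pos])
  have h3 : Real.cos (dist (chartInv x u) x) = inner ℝ (stereo (chartInv x u)) (stereo x) := by
    rw [dist_eq_angle, InnerProductGeometry.cos_angle, norm_stereo, norm_stereo]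
    simp
  rw [inner_stereo_chartInv] at h3
  have h4 : Real.cos (dist (chartInv x u) x) =
      1 - 2 * Real.sin (dist (chartInv x u) x / 2) ^ 2 := by
    have := Real.cos_two_mul (dist (chartInv x u) x / 2)
    rw [mul_div_cancel₀ _ two_ne_zero] at this
    rw [this, Real.cos_sq']
    ring
  rw [← abs_of_nonneg h2, ← Real.sqrt_sq_eq_abs, ← Real.sqrt_mul (by positivity)]
  rw [← Real.sqrt_sq (norm_nonneg (u - chart x x)), ← Real.sqrt_div (by positivity)]
  congr 1
  linarith

theorem dist_chartInv_eq (x : CHat) (u : ℂ) :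
    dist (chartInv x u) x =
      2 * Real.arcsin (‖u - chart x x‖ / (√(1 + ‖u‖ ^ 2) * √(1 + ‖chart x x‖ ^ 2))) := by
  have h0 : 0 ≤ dist (chartInv x u) x / 2 := by positivity
  have h1 : dist (chartInv x u) x / 2 ≤ Real.pi / 2 := by
    have := InnerProductGeometry.angle_le_pi (stereo (chartInv x u)) (stereo x)
    rw [dist_eq_angle]
    linarith
  rw [← sin_half_dist_chartInv, Real.arcsin_sin (by linarith) h1]
  ring

/-- The density of the spherical metric at `x` with respect to the chart at `x`. -/
def dens (x : CHat) : ℝ := 2 / (1 + ‖chart x x‖ ^ 2)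

theorem dens_pos (x : CHat) : 0 < dens x := by unfold dens; positivity

theorem sphNorm_eq (f : CHat → CHat) (x : CHat) :
    sphNorm f x = ‖D f x‖ * dens (f x) / dens x := by
  have h1 : (1 + ‖chart x x‖ ^ 2) ≠ 0 := by positivity
  have h2 : (1 + ‖chart (f x) (f x)‖ ^ 2) ≠ 0 := by positivity
  unfold sphNorm dens
  field_simp

/-- The distance is `2 arcsin (κ u * ‖u - u₀‖)` with `κ` continuous and `2 κ u₀ = dens x`. The error
splits into the one of `arcsin s ≈ s` and the one of `κ u ≈ κ u₀`. -/
theorem dist_chartInv_isLittleO (x : CHat) :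
    (fun u => dist (chartInv x u) x - dens x * ‖u - chart x x‖) =o[𝓝 (chart x x)]
      fun u => ‖u - chart x x‖ := by
  set u₀ := chart x x with hu₀
  set κ : ℂ → ℝ := fun u => 1 / (√(1 + ‖u‖ ^ 2) * √(1 + ‖u₀‖ ^ 2)) with hκ
  have hκc : Continuous κ := by
    refine Continuous.div continuous_const (by fun_prop) fun u => ?_
    have h1 : 0 < √(1 + ‖u‖ ^ 2) := Real.sqrt_pos.2 (by positivity)
    have h2 : 0 < √(1 + ‖u₀‖ ^ 2) := Real.sqrt_pos.2 (by positivity)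
    positivity
  have hκ0 : 2 * κ u₀ = dens x := by
    simp only [hκ]
    rw [Real.mul_self_sqrt (by positivity)]
    unfold dens
    ring
  have hn : Tendsto (fun u : ℂ => ‖u - u₀‖) (𝓝 u₀) (𝓝 0) := by
    have : Continuous fun u : ℂ => ‖u - u₀‖ := by fun_prop
    simpa using this.tendsto u₀
  have hσ : Tendsto (fun u => κ u * ‖u - u₀‖) (𝓝 u₀) (𝓝 0) := by
    simpa using (hκc.tendsto u₀).mul hn
  have hO : (fun u => κ u * ‖u - u₀‖) =O[𝓝 u₀] fun u => ‖u - u₀‖ := by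
    simpa using ((hκc.tendsto u₀).isBigO_one ℝ).mul
      (Asymptotics.isBigO_refl (fun u : ℂ => ‖u - u₀‖) (𝓝 u₀))
  have harc : (fun s : ℝ => Real.arcsin s - s) =o[𝓝 0] fun s => s := by
    have h := (Real.hasDerivAt_arcsin (x := 0) (by norm_num) (by norm_num)).isLittleO
    simpa using h
  have h1 := (harc.comp_tendsto hσ).trans_isBigO hO
  have h2 : (fun u => (2 * κ u - dens x) * ‖u - u₀‖) =o[𝓝 u₀] fun u => ‖u - u₀‖ := by
    have : (fun u => 2 * κ u - dens x) =o[𝓝 u₀] fun _ => (1 : ℝ) := by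
      rw [Asymptotics.isLittleO_one_iff]
      have h3 := ((hκc.tendsto u₀).const_mul 2).sub_const (dens x)
      rwa [hκ0, sub_self] at h3
    simpa using this.mul_isBigO (Asymptotics.isBigO_refl (fun u : ℂ => ‖u - u₀‖) (𝓝 u₀))
  refine ((h1.const_mul_left 2).add h2).congr_left fun u => ?_
  have h4 : ‖u - u₀‖ / (√(1 + ‖u‖ ^ 2) * √(1 + ‖u₀‖ ^ 2)) = κ u * ‖u - u₀‖ := by
    simp only [hκ]; ring
  simp only [Function.comp]
  rw [dist_chartInv_eq, ← hu₀, h4]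
  ring

theorem exists_dist_chartInv (x : CHat) {η : ℝ} (hη : 0 < η) : ∃ r > 0, ∀ u, ‖u - chart x x‖ < r →
    |dist (chartInv x u) x - dens x * ‖u - chart x x‖| ≤ η * ‖u - chart x x‖ := by
  have h := (dist_chartInv_isLittleO x).def hη
  obtain ⟨r, hr, h⟩ := Metric.eventually_nhds_iff.1 h
  refine ⟨r, hr, fun u hu => ?_⟩
  simpa using h (by rwa [dist_eq_norm])

theorem exists_near_chart (b : CHat) {r : ℝ} (hr : 0 < r) : ∃ ε > 0, ∀ y, dist y b < ε →
    y ≠ far b ∧ ‖chart b y - chart b b‖ < r := by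
  have h1 : ∀ᶠ y in 𝓝 b, y ≠ far b := isOpen_ne.mem_nhds (far_ne b)
  have h2 : ∀ᶠ y in 𝓝 b, dist (chart b y) (chart b b) < r :=
    (continuousAt_chart b).eventually (Metric.ball_mem_nhds _ hr)
  obtain ⟨ε, hε, h⟩ := Metric.eventually_nhds_iff.1 (h1.and h2)
  refine ⟨ε, hε, fun y hy => ?_⟩
  have := h hy
  rwa [dist_eq_norm] at this

theorem tendsto_chartInv (x : CHat) : Tendsto (chartInv x) (𝓝 (chart x x)) (𝓝 x) := by
  obtain ⟨r, hr, h⟩ := exists_dist_chartInv x one_pos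
  rw [tendsto_iff_dist_tendsto_zero]
  have hn : Tendsto (fun u : ℂ => (dens x + 1) * ‖u - chart x x‖) (𝓝 (chart x x)) (𝓝 0) := by
    have : Continuous fun u : ℂ => (dens x + 1) * ‖u - chart x x‖ := by fun_prop
    simpa using this.tendsto (chart x x)
  refine squeeze_zero' (Eventually.of_forall fun u => dist_nonneg) ?_ hn
  filter_upwards [Metric.ball_mem_nhds (chart x x) hr] with u hu
  have := h u (by rwa [Metric.mem_ball, dist_eq_norm] at hu)
  have := (abs_le.1 this).2
  linarith

/-! ### Rational maps in charts -/

theorem exists_ratEval (g : Rat) : ∃ p q : ℂ[X], IsCoprime p q ∧ (g : CHat → CHat) = ratEval p q :=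
  g.2.1

theorem IsCoprime.eval_ne {p q : ℂ[X]} (h : IsCoprime p q) (u : ℂ) : p.eval u ≠ 0 ∨ q.eval u ≠ 0 := by
  obtain ⟨a, b, hab⟩ := h
  by_contra! hc
  have := congrArg (Polynomial.eval u) hab
  simp [hc.1, hc.2] at this

theorem quot_mul {c : ℂ} (hc : c ≠ 0) (a b : ℂ) : quot (a * c) (b * c) = quot a b := by
  by_cases hb : b = 0
  · simp [hb, quot_zero]
  · rw [quot_of_ne hb, quot_of_ne (mul_ne_zero hb hc), mul_div_mul_right _ _ hc]

/-- At `∞`, numerator and denominator are multiplied by `u ^ d`, where `d` is the larger degree. The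
reflected polynomials take at `0` the coefficients of degree `d`, which is how `ratEval` is defined
at `∞`. -/
theorem exists_polynomial_chartInv (g : Rat) (x : CHat) : ∃ P Q : ℂ[X],
    (∀ u, P.eval u ≠ 0 ∨ Q.eval u ≠ 0) ∧ ∀ u, g (chartInv x u) = quot (P.eval u) (Q.eval u) := by
  obtain ⟨p, q, hpq, hg⟩ := exists_ratEval g
  rw [hg]
  rcases x.eq_infty_or with rfl | ⟨w, rfl⟩
  · set d := max p.natDegree q.natDegree with hd
    have hev : ∀ (f : ℂ[X]), f.natDegree ≤ d → ∀ u : ℂ, u ≠ 0 →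
        (Polynomial.reflect d f).eval u = f.eval u⁻¹ * u ^ d := by
      intro f hf u hu
      have : Invertible u⁻¹ := invertibleOfNonzero (inv_ne_zero hu)
      have h := Polynomial.eval₂_reflect_mul_pow (RingHom.id ℂ) u⁻¹ d f hf
      simp only [invOf_eq_inv, inv_inv] at h
      have h' : (Polynomial.reflect d f).eval u * u⁻¹ ^ d = f.eval u⁻¹ := h
      rw [← h', mul_assoc, ← mul_pow, inv_mul_cancel₀ hu, one_pow, mul_one]
    have hz : ∀ f : ℂ[X], (Polynomial.reflect d f).eval 0 = f.coeff d := by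
      intro f
      rw [← Polynomial.coeff_zero_eq_eval_zero, Polynomial.coeff_reflect]
      simp [Polynomial.revAt_le]
    have hp := le_max_left p.natDegree q.natDegree
    have hq := le_max_right p.natDegree q.natDegree
    refine ⟨Polynomial.reflect d p, Polynomial.reflect d q, fun u => ?_, fun u => ?_⟩
    · by_cases hu : u = 0
      · subst hu
        rw [hz, hz]
        by_contra! hc
        -- One of the two coefficients of degree `d` is a leading coefficient. Its vanishing kills
        -- that polynomial, which forces `d = 0`, and then the other one as well.
        have key : p = 0 ∧ q = 0 := by
          rcases max_cases p.natDegree q.natDegree with h | h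
          · have h1 : p.leadingCoeff = 0 := by
              rw [Polynomial.leadingCoeff, ← h.1]; exact hc.1
            have hp0 := Polynomial.leadingCoeff_eq_zero.1 h1
            refine ⟨hp0, ?_⟩
            have hd0 : d = 0 := by rw [hd, h.1, hp0]; simp
            have hq0 : q.natDegree = 0 := by omega
            rw [Polynomial.eq_C_of_natDegree_eq_zero hq0, ← hd0, hc.2, Polynomial.C_0]
          · have h1 : q.leadingCoeff = 0 := by
              rw [Polynomial.leadingCoeff, ← h.1]; exact hc.2
            have hq0 := Polynomial.leadingCoeff_eq_zero.1 h1
            have := h.2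
            rw [hq0] at this
            simp at this
        rcases IsCoprime.eval_ne hpq 0 with h | h
        · exact h (by simp [key.1])
        · exact h (by simp [key.2])
      · rw [hev p hp u hu, hev q hq u hu]
        have := pow_ne_zero d hu
        exact (IsCoprime.eval_ne hpq u⁻¹).imp (fun h => mul_ne_zero h this)
          fun h => mul_ne_zero h this
    · by_cases hu : u = 0
      · subst hu
        rw [hz, hz]
        simp [chartInv, quot_zero, ratEval, hd]
      · rw [hev p hp u hu, hev q hq u hu, quot_mul (pow_ne_zero d hu)]
        simp [chartInv, quot_of_ne hu, ratEval]
  · exact ⟨p, q, IsCoprime.eval_ne hpq, fun u => rfl⟩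

/-- The expression of `g` in the charts at `x` and `b`. -/
def chartMap (g : CHat → CHat) (x b : CHat) (u : ℂ) : ℂ := chart b (g (chartInv x u))

/-- In charts the map is a quotient of polynomials, and the denominator vanishes only where the
value is the point missed by the target chart. -/
theorem differentiableAt_chartMap (g : Rat) (x b : CHat) {u : ℂ} (h : g (chartInv x u) ≠ far b) :
    DifferentiableAt ℂ (chartMap g x b) u := by
  obtain ⟨P, Q, hPQ, hg⟩ := exists_polynomial_chartInv g x
  have hP := P.differentiable u
  have hQ := Q.differentiable u
  rw [hg] at h
  rcases b.eq_infty_or with rfl | ⟨w, rfl⟩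
  · have h1 : chartMap g x infty = fun u => Q.eval u / P.eval u := by
      funext u
      rw [chartMap, hg, chart_quot_infty]
    rw [h1]
    refine hQ.div hP fun h0 => h ?_
    have hq : Q.eval u ≠ 0 := (hPQ u).resolve_left (not_not.2 h0)
    rw [h0, quot_of_ne hq, zero_div]
    rfl
  · have h1 : chartMap g x (ofC w) = fun u => P.eval u / Q.eval u := by
      funext u
      rw [chartMap, hg, chart_quot_ofC]
    rw [h1]
    refine hP.div hQ fun h0 => h ?_
    rw [h0, quot_zero]
    rfl

/-- The finite points of a fibre are roots of one polynomial. Were it zero, the map would be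
constant on the dense plane, hence everywhere. -/
theorem Rat.finite_fiber (g : Rat) (a : CHat) : {y | g y = a}.Finite := by
  obtain ⟨p, q, hpq, hg⟩ := exists_ratEval g
  have hconst : ¬ ∀ u, g (ofC u) = a := by
    intro h
    refine g.2.2 ⟨a, fun z => ?_⟩
    have hcl : IsClosed {y | g y = a} := isClosed_eq g.1.continuous continuous_const
    have hd : Dense (Set.range ofC) := OnePoint.denseRange_coe (X := ℂ)
    have : Set.range ofC ⊆ {y | g y = a} := by rintro _ ⟨u, rfl⟩; exact h u
    have h2 := hcl.closure_subset_iff.2 this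
    rw [hd.closure_eq] at h2
    exact h2 (Set.mem_univ z)
  have hpoly : ∃ P : ℂ[X], ∀ u, g (ofC u) = a ↔ P.eval u = 0 := by
    rw [hg]
    rcases a.eq_infty_or with rfl | ⟨c, rfl⟩
    · refine ⟨q, fun u => ⟨fun h => ?_, fun h => ?_⟩⟩
      · by_contra hq
        simp only [ratEval, CHat.cases_ofC, quot_of_ne hq] at h
        exact ofC_ne_infty _ h
      · simp [ratEval, h, quot_zero]
    · refine ⟨p - Polynomial.C c * q, fun u => ⟨fun h => ?_, fun h => ?_⟩⟩
      · by_cases hq : q.eval u = 0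
        · simp only [ratEval, CHat.cases_ofC, hq, quot_zero] at h
          exact absurd h.symm (ofC_ne_infty _)
        · simp only [ratEval, CHat.cases_ofC, quot_of_ne hq] at h
          have := ofC_injective h
          field_simp at this
          simp [this]
          ring
      · have h' : p.eval u = c * q.eval u := by simpa [sub_eq_zero] using h
        have hq : q.eval u ≠ 0 := fun hq =>
          (IsCoprime.eval_ne hpq u).elim (fun h1 => h1 (by rw [h', hq, mul_zero])) fun h1 => h1 hq
        simp only [ratEval, CHat.cases_ofC, quot_of_ne hq, h']
        rw [mul_div_cancel_right₀ _ hq]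
  obtain ⟨P, hP⟩ := hpoly
  have hP0 : P ≠ 0 := fun h0 => hconst fun u => (hP u).2 (by simp [h0])
  refine (((P.roots.toFinset.finite_toSet).image ofC).union (Set.finite_singleton infty)).subset ?_
  intro y hy
  rcases y.eq_infty_or with rfl | ⟨u, rfl⟩
  · exact Or.inr rfl
  · refine Or.inl ⟨u, ?_, rfl⟩
    simpa [hP0] using (hP u).1 hy

/-! ### First order expansion, uniformly on compact sets of rational maps -/

theorem Rat.continuous_uncurry : Continuous fun p : Rat × CHat => p.1 p.2 := by
  have h : Continuous fun p : C(CHat, CHat) × CHat => p.1 p.2 := ContinuousEval.continuous_eval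
  exact h.comp ((continuous_subtype_val (p := fun f : C(CHat, CHat) =>
    IsRational f ∧ ¬ ∃ c, ∀ z, f z = c)).prodMap continuous_id)

theorem Rat.continuous (g : Rat) : Continuous (g : CHat → CHat) := g.1.continuous

theorem exists_uniform_dist {S : Set Rat} (hS : IsCompact S) (x : CHat) {ε : ℝ} (hε : 0 < ε) :
    ∃ δ > 0, ∀ g ∈ S, ∀ y, dist y x < δ → dist (g y) (g x) < ε := by
  have ho : IsOpen {p : Rat × CHat | dist (p.1 p.2) (p.1 x) < ε} :=
    isOpen_lt (Rat.continuous_uncurry.dist ((Rat.continuous_eval x).comp continuous_fst))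
      continuous_const
  have hsub : S ×ˢ {x} ⊆ {p : Rat × CHat | dist (p.1 p.2) (p.1 x) < ε} := by
    rintro ⟨g, y⟩ ⟨-, hy⟩
    obtain rfl : y = x := hy
    rw [Set.mem_ofPred_eq, dist_self]
    exact hε
  obtain ⟨u, v, -, hv, hSu, hxv, huv⟩ := generalized_tube_lemma hS isCompact_singleton ho hsub
  obtain ⟨δ, hδ, hb⟩ := Metric.isOpen_iff.1 hv x (hxv (Set.mem_singleton x))
  refine ⟨δ, hδ, fun g hg y hy => ?_⟩
  have h := huv (Set.mk_mem_prod (hSu hg) (hb hy))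
  rwa [Set.mem_ofPred_eq] at h

/-- The Schwarz lemma is used twice: it bounds the difference quotient `dslope F c` by `1 / r`, and
then, applied to that quotient, bounds its variation. The constants depend only on `r`, so the
estimate is uniform over a family of maps. -/
theorem norm_sub_sub_deriv_le {F : ℂ → ℂ} {c u : ℂ} {r : ℝ} (hr : 0 < r)
    (hd : DifferentiableOn ℂ F (Metric.ball c r))
    (hm : Set.MapsTo F (Metric.ball c r) (Metric.closedBall (F c) 1)) (hu : u ∈ Metric.ball c r) :
    ‖F u - F c - deriv F c * (u - c)‖ ≤ 2 / r ^ 2 * ‖u - c‖ ^ 2 := by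
  have hc : c ∈ Metric.ball c r := Metric.mem_ball_self hr
  have h1 : ∀ v ∈ Metric.ball c r, ‖dslope F c v‖ ≤ 1 / r := fun v hv =>
    Complex.norm_dslope_le_div_of_mapsTo_ball hd hm hv
  have h2 : DifferentiableOn ℂ (dslope F c) (Metric.ball c r) :=
    (Complex.differentiableOn_dslope (Metric.ball_mem_nhds c hr)).2 hd
  have h3 : Set.MapsTo (dslope F c) (Metric.ball c r)
      (Metric.closedBall (dslope F c c) (2 / r)) := by
    intro v hv
    rw [Metric.mem_closedBall, dist_eq_norm]
    calc _ ≤ ‖dslope F c v‖ + ‖dslope F c c‖ := norm_sub_le _ _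
      _ ≤ 1 / r + 1 / r := add_le_add (h1 v hv) (h1 c hc)
      _ = 2 / r := by ring
  have h4 := Complex.dist_le_div_mul_dist_of_mapsTo_ball h2 h3 hu
  rw [dist_eq_norm, dist_eq_norm, dslope_same] at h4
  have h5 : F u - F c - deriv F c * (u - c) = (u - c) * (dslope F c u - deriv F c) := by
    have := sub_smul_dslope F c u
    rw [smul_eq_mul] at this
    linear_combination -this
  rw [h5, norm_mul]
  calc _ ≤ ‖u - c‖ * (2 / r / r * ‖u - c‖) := by gcongr
    _ = _ := by field_simp

theorem norm_deriv_le {F : ℂ → ℂ} {c : ℂ} {r : ℝ} (hr : 0 < r)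
    (hd : DifferentiableOn ℂ F (Metric.ball c r))
    (hm : Set.MapsTo F (Metric.ball c r) (Metric.closedBall (F c) 1)) :
    ‖deriv F c‖ ≤ 1 / r := by
  have := Complex.norm_dslope_le_div_of_mapsTo_ball hd hm (Metric.mem_ball_self hr)
  rwa [dslope_same] at this

/-- The common value `b` lets a single target chart serve the whole family, and compactness makes
the radius uniform. -/
theorem exists_uniform_chart {S : Set Rat} (hS : IsCompact S) {x b : CHat}
    (hb : ∀ g ∈ S, g x = b) : ∃ r > 0, ∀ g ∈ S,
      DifferentiableOn ℂ (chartMap g x b) (Metric.ball (chart x x) r) ∧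
      (∀ u ∈ Metric.ball (chart x x) r, g (chartInv x u) ≠ far b) ∧
      Set.MapsTo (chartMap g x b) (Metric.ball (chart x x) r)
        (Metric.closedBall (chartMap g x b (chart x x)) 1) := by
  obtain ⟨ε, hε, h1⟩ := exists_near_chart b one_pos
  obtain ⟨δ, hδ, h2⟩ := exists_uniform_dist hS x hε
  obtain ⟨r, hr, h3⟩ := Metric.mem_nhds_iff.1 ((tendsto_chartInv x) (Metric.ball_mem_nhds x hδ))
  have key : ∀ g ∈ S, ∀ u ∈ Metric.ball (chart x x) r, g (chartInv x u) ≠ far b ∧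
      ‖chart b (g (chartInv x u)) - chart b b‖ < 1 := fun g hg u hu =>
    h1 _ (by simpa only [hb g hg] using h2 g hg _ (h3 hu))
  refine ⟨r, hr, fun g hg => ⟨fun u hu =>
    (differentiableAt_chartMap g x b (key g hg u hu).1).differentiableWithinAt,
    fun u hu => (key g hg u hu).1, fun u hu => ?_⟩⟩
  rw [Metric.mem_closedBall, dist_eq_norm]
  have := (key g hg u hu).2.le
  rwa [chartMap, chartMap, chartInv_chart_self, hb g hg]

theorem D_eq (g : Rat) {x b : CHat} (hb : g x = b) : D g x = deriv (chartMap g x b) (chart x x) := by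
  subst hb; rfl

theorem exists_sphNorm_expansion {S : Set Rat} (hS : IsCompact S) {x b : CHat}
    (hb : ∀ g ∈ S, g x = b) {η : ℝ} (hη : 0 < η) : ∃ δ > 0, ∀ g ∈ S, ∀ y, dist y x < δ →
      |dist (g y) (g x) - sphNorm g x * dist y x| ≤ η * dist y x := by
  obtain ⟨r, hr, hR⟩ := exists_uniform_chart hS hb
  set u₀ := chart x x with hu₀
  have hcx := dens_pos x
  have hcb := dens_pos b
  set C : ℝ := 2 / r ^ 2 with hC
  have hCpos : 0 < C := by positivity
  set s : ℝ := 1 / r * dens b / dens x with hs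
  have hspos : 0 < s := by positivity
  -- The three errors below add up to `(1 / r + s + 1) * (η₁ * t)`, which this choice makes equal to
  -- `η * (dens x / 2 * t) ≤ η * dist y x`.
  set η₁ : ℝ := η * (dens x / 2) / (1 / r + s + 1) with hη₁
  have hη₁pos : 0 < η₁ := by positivity
  obtain ⟨rb, hrb, hTb⟩ := exists_dist_chartInv b hη₁pos
  obtain ⟨rx, hrx, hTx⟩ := exists_dist_chartInv x (η := min η₁ (dens x / 2)) (by positivity)
  -- The bounds `r` and `rx` validate the chart estimates at `x`. Since `F` is `1 / r`-Lipschitz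
  -- about `u₀`, `rb * r` keeps the image within `rb`. The last bound makes the quadratic Taylor
  -- error at most `η₁ * t`.
  set ρ : ℝ := min (min r rx) (min (rb * r) (η₁ / (dens b * C))) with hρ
  have hρpos : 0 < ρ := by positivity
  obtain ⟨δ, hδ, hnear⟩ := exists_near_chart x hρpos
  refine ⟨δ, hδ, fun g hg y hy => ?_⟩
  obtain ⟨hfar, hu⟩ := hnear y hy
  obtain ⟨hd, hf, hm⟩ := hR g hg
  set u := chart x y with hu'
  have hy' : chartInv x u = y := chartInv_chart x hfar
  set t := ‖u - u₀‖ with ht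
  have ht0 : 0 ≤ t := norm_nonneg _
  have hur : u ∈ Metric.ball u₀ r := by
    rw [Metric.mem_ball, dist_eq_norm]
    exact hu.trans_le ((min_le_left _ _).trans (min_le_left _ _))
  have htx := hTx u (hu.trans_le ((min_le_left _ _).trans (min_le_right _ _)))
  rw [hy', ← hu₀, ← ht] at htx
  set F := chartMap g x b with hF
  have hF0 : F u₀ = chart b b := by
    rw [hF, chartMap, hu₀, chartInv_chart_self, hb g hg]
  have hexp := norm_sub_sub_deriv_le hr hd hm hur
  have hder := norm_deriv_le hr hd hm
  have hlip := Complex.dist_le_div_mul_dist_of_mapsTo_ball hd hm hur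
  rw [dist_eq_norm, dist_eq_norm, ← ht] at hlip
  have hDg : D g x = deriv F u₀ := D_eq g (hb g hg)
  rw [← hDg] at hexp hder
  set e := ‖F u - F u₀‖ with he
  have h1 : |e - ‖D g x‖ * t| ≤ C * t ^ 2 := by
    have := abs_norm_sub_norm_le (F u - F u₀) (D g x * (u - u₀))
    rw [norm_mul] at this
    exact this.trans hexp
  have htb := hTb (F u) (by
    rw [← hF0, ← he]
    refine hlip.trans_lt ?_
    have : t < rb * r := hu.trans_le ((min_le_right _ _).trans (min_le_left _ _))
    rw [div_mul_eq_mul_div, one_mul, div_lt_iff₀ hr]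
    exact this)
  have hgy : chartInv b (F u) = g y := by
    rw [hF, chartMap, hy']
    exact chartInv_chart b (by simpa only [hy'] using hf u hur)
  rw [hgy, ← hF0, ← he] at htb
  rw [hb g hg]
  have hsph : sphNorm g x = ‖D g x‖ * dens b / dens x := by rw [sphNorm_eq, hb g hg]
  have hsle : sphNorm g x ≤ s := by
    rw [hsph, hs]
    gcongr
  have hs0 : 0 ≤ sphNorm g x := by rw [hsph]; positivity
  have hsx : sphNorm g x * dens x = ‖D g x‖ * dens b := by
    rw [hsph]; field_simp
  have htη : dens b * (C * t ^ 2) ≤ η₁ * t := by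
    have h2 : t < η₁ / (dens b * C) := hu.trans_le ((min_le_right _ _).trans (min_le_right _ _))
    rw [lt_div_iff₀ (by positivity)] at h2
    nlinarith
  have htx1 : |dist y x - dens x * t| ≤ η₁ * t :=
    htx.trans (mul_le_mul_of_nonneg_right (min_le_left _ _) ht0)
  have htx2 : dens x / 2 * t ≤ dist y x := by
    have h2 : |dist y x - dens x * t| ≤ dens x / 2 * t :=
      htx.trans (mul_le_mul_of_nonneg_right (min_le_right _ _) ht0)
    have := (abs_le.1 h2).1
    linarith
  have htot : |dist (g y) b - sphNorm g x * dist y x| ≤ (1 / r + s + 1) * (η₁ * t) := by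
    have e1 : dist (g y) b - sphNorm g x * dist y x =
        (dist (g y) b - dens b * e) + dens b * (e - ‖D g x‖ * t)
          - sphNorm g x * (dist y x - dens x * t) := by
      linear_combination -t * hsx
    have a1 : |dist (g y) b - dens b * e| ≤ 1 / r * (η₁ * t) := by
      refine htb.trans ?_
      calc η₁ * e ≤ η₁ * (1 / r * t) := by gcongr
        _ = _ := by ring
    have a2 : |dens b * (e - ‖D g x‖ * t)| ≤ η₁ * t := by
      rw [abs_mul, abs_of_pos hcb]
      exact (mul_le_mul_of_nonneg_left h1 hcb.le).trans htη
    have a3 : |sphNorm g x * (dist y x - dens x * t)| ≤ s * (η₁ * t) := by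
      rw [abs_mul, abs_of_nonneg hs0]
      exact mul_le_mul hsle htx1 (abs_nonneg _) hspos.le
    rw [e1]
    calc _ ≤ |dist (g y) b - dens b * e| + |dens b * (e - ‖D g x‖ * t)|
          + |sphNorm g x * (dist y x - dens x * t)| :=
          (abs_sub _ _).trans (add_le_add_left (abs_add_le _ _) _)
      _ ≤ _ := by linarith
  refine htot.trans ?_
  have : (1 / r + s + 1) * (η₁ * t) = η * (dens x / 2 * t) := by
    rw [hη₁]; field_simp
  rw [this]
  gcongr

instance : NeBot (𝓝[≠] infty) :=
  OnePoint.nhdsNE_infty_neBot (X := ℂ)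

theorem nhdsNE_neBot (x : CHat) : NeBot (𝓝[≠] x) := by
  rcases x.eq_infty_or with rfl | ⟨w, rfl⟩
  · infer_instance
  · exact OnePoint.nhdsNE_coe_neBot (X := ℂ) w

/-- By the uniform expansion, one difference quotient at a fixed `y ≠ x` approximates `sphNorm g x`
to within `ε / 4` for all `g` in the family, and that quotient is continuous in `g`. -/
theorem continuousOn_sphNorm {S : Set Rat} (hS : IsCompact S) {x b : CHat}
    (hb : ∀ g ∈ S, g x = b) : ContinuousOn (fun g : Rat => sphNorm g x) S := by
  intro g hg
  rw [ContinuousWithinAt, Metric.tendsto_nhds]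
  intro ε hε
  obtain ⟨δ, hδ, h⟩ := exists_sphNorm_expansion hS hb (η := ε / 4) (by positivity)
  have := nhdsNE_neBot x
  obtain ⟨y, hy, hyx⟩ : ∃ y, dist y x < δ ∧ y ≠ x := by
    have h1 : ∀ᶠ y in 𝓝[≠] x, dist y x < δ :=
      nhdsWithin_le_nhds (Metric.ball_mem_nhds x hδ)
    exact (h1.and self_mem_nhdsWithin).exists
  have hpos : 0 < dist y x := dist_pos.2 hyx
  have hc : Continuous fun k : Rat => dist (k y) (k x) :=
    (Rat.continuous_eval y).dist (Rat.continuous_eval x)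
  have h2 : ∀ᶠ k in 𝓝[S] g, dist (dist (k y) (k x)) (dist (g y) (g x)) < ε / 4 * dist y x :=
    nhdsWithin_le_nhds (hc.tendsto g (Metric.ball_mem_nhds _ (by positivity)))
  filter_upwards [h2, self_mem_nhdsWithin] with k hk hkS
  have a1 := abs_le.1 (h g hg y hy)
  have a2 := abs_le.1 (h k hkS y hy)
  rw [Real.dist_eq] at hk
  have a3 := abs_lt.1 hk
  rw [Real.dist_eq, abs_lt]
  constructor <;> nlinarith

/-! ### Sequences of rational maps -/

/-- The sequence `γ` with its first `m` terms removed. -/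
def shift (m : ℕ) (γ : ℕ → Rat) : ℕ → Rat := fun n => γ (m + n)

/-- The sequence `g, γ 0, γ 1, …`. -/
def consSeq (g : Rat) (γ : ℕ → Rat) : ℕ → Rat
  | 0 => g
  | n + 1 => γ n

@[simp] theorem consSeq_zero (g : Rat) (γ : ℕ → Rat) : consSeq g γ 0 = g := rfl

@[simp] theorem consSeq_succ (g : Rat) (γ : ℕ → Rat) (n : ℕ) : consSeq g γ (n + 1) = γ n := rfl

@[simp] theorem comps_zero (γ : ℕ → Rat) (y : CHat) : comps γ 0 y = y := rfl

theorem comps_succ (γ : ℕ → Rat) (n : ℕ) (y : CHat) : comps γ (n + 1) y = γ n (comps γ n y) := rfl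

theorem comps_consSeq (g : Rat) (γ : ℕ → Rat) (n : ℕ) (y : CHat) :
    comps (consSeq g γ) (n + 1) y = comps γ n (g y) := by
  induction n with
  | zero => rfl
  | succ n ih => rw [comps_succ, ih]; rfl

theorem comps_add (γ : ℕ → Rat) (m n : ℕ) (y : CHat) :
    comps γ (m + n) y = comps (shift m γ) n (comps γ m y) := by
  induction n with
  | zero => rfl
  | succ n ih => rw [← add_assoc, comps_succ, ih]; rfl

theorem consSeq_shift (γ : ℕ → Rat) : consSeq (γ 0) (shift 1 γ) = γ := by
  funext n
  cases n with
  | zero => rfl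
  | succ n => simp [shift, add_comm]

theorem comps_congr {γ γ' : ℕ → Rat} {n : ℕ} (h : ∀ k < n, γ k = γ' k) :
    comps γ n = comps γ' n := by
  induction n with
  | zero => rfl
  | succ n ih =>
    funext y
    rw [comps_succ, comps_succ, ih fun k hk => h k (by omega), h n (by omega)]

theorem continuous_comps (n : ℕ) : Continuous fun p : CHat × (ℕ → Rat) => comps p.2 n p.1 := by
  induction n with
  | zero => exact continuous_fst
  | succ n ih =>
    exact Rat.continuous_uncurry.comp (((continuous_apply n).comp continuous_snd).prodMk ih)

theorem continuous_comps_right (γ : ℕ → Rat) (n : ℕ) : Continuous (comps γ n) :=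
  (continuous_comps n).comp (Continuous.prodMk_left γ)

theorem finite_fiber_comps (γ : ℕ → Rat) (n : ℕ) (a : CHat) : {y | comps γ n y = a}.Finite := by
  induction n generalizing a with
  | zero => exact Set.finite_singleton a
  | succ n ih =>
    have : {y | comps γ (n + 1) y = a} = ⋃ b ∈ {b | γ n b = a}, {y | comps γ n y = b} := by
      ext y
      simp [comps_succ]
    rw [this]
    exact ((γ n).finite_fiber a).biUnion fun b _ => ih b

theorem comps_mem_G {τ : ProbabilityMeasure Rat} {γ : ℕ → Rat} (hγ : γ ∈ X τ) (n : ℕ) :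
    comps γ (n + 1) ∈ G τ := by
  induction n with
  | zero => exact Gen.of (γ 0) (hγ 0)
  | succ n ih => exact Gen.comp (γ (n + 1)) _ (hγ _) ih

theorem exists_comps_eq {τ : ProbabilityMeasure Rat} {g : CHat → CHat} (hg : g ∈ G τ) :
    ∃ γ ∈ X τ, ∃ n, g = comps γ (n + 1) := by
  induction hg with
  | of g hg => exact ⟨fun _ => g, fun _ => hg, 0, rfl⟩
  | comp g h hg hh ih =>
    obtain ⟨γ, hγ, n, rfl⟩ := ih
    refine ⟨Function.update γ (n + 1) g, fun k => ?_, n + 1, ?_⟩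
    · by_cases hk : k = n + 1
      · subst hk; simpa using hg
      · simpa [Function.update_of_ne hk] using hγ k
    · funext y
      have hc : comps (Function.update γ (n + 1) g) (n + 1) = comps γ (n + 1) :=
        comps_congr fun k hk => Function.update_of_ne (by omega) _ _
      rw [comps_succ, Function.update_self, hc]
      rfl

theorem shift_mem_X {τ : ProbabilityMeasure Rat} {γ : ℕ → Rat} (hγ : γ ∈ X τ) (m : ℕ) :
    shift m γ ∈ X τ := fun n => hγ (m + n)

theorem G_comp {τ : ProbabilityMeasure Rat} {g h : CHat → CHat} (hg : g ∈ G τ) (hh : h ∈ G τ) :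
    g ∘ h ∈ G τ := by
  induction hg with
  | of g hg => exact Gen.comp g h hg hh
  | comp g k hg hk ih => exact Gen.comp g _ hg ih

theorem mem_Jker_of_mem {τ : ProbabilityMeasure Rat} {g : CHat → CHat} (hg : g ∈ G τ) {x : CHat}
    (hx : x ∈ Jker (G τ)) : g x ∈ Jker (G τ) := by
  simp only [Jker, Set.mem_iInter, Set.mem_preimage] at hx ⊢
  exact fun h hh => hx (h ∘ g) (G_comp hh hg)

theorem comps_mem_of_invariant {τ : ProbabilityMeasure Rat} {L : Set CHat}
    (hL : ∀ g ∈ G τ, g '' L ⊆ L) {γ : ℕ → Rat} (hγ : γ ∈ X τ) {x : CHat} (hx : x ∈ L) (n : ℕ) :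
    comps γ n x ∈ L := by
  cases n with
  | zero => exact hx
  | succ n => exact hL _ (comps_mem_G hγ n) ⟨x, hx, rfl⟩

theorem Jker_invariant (τ : ProbabilityMeasure Rat) :
    ∀ g ∈ G τ, g '' Jker (G τ) ⊆ Jker (G τ) := by
  rintro g hg _ ⟨x, hx, rfl⟩
  exact mem_Jker_of_mem hg hx

/-! ### Fatou sets -/

theorem exists_equicontinuousOn_iff {ι : Type*} {F : ι → CHat → CHat} {z : CHat} :
    (∃ U ∈ 𝓝 z, EquicontinuousOn F U) ↔ ∀ᶠ u in 𝓝 z, EquicontinuousAt F u := by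
  constructor
  · rintro ⟨U, hU, h⟩
    filter_upwards [eventually_mem_nhds_iff.2 hU] with u hu
    have h1 := h u (mem_of_mem_nhds hu)
    intro V hV
    have := h1 V hV
    rwa [nhdsWithin_eq_nhds.2 hu] at this
  · intro h
    exact ⟨_, h, fun u hu => EquicontinuousAt.equicontinuousWithinAt hu _⟩

theorem mem_Fatou_iff {H : Set (CHat → CHat)} {z : CHat} :
    z ∈ Fatou H ↔ ∀ᶠ u in 𝓝 z, EquicontinuousAt (fun g : H => (g : CHat → CHat)) u :=
  exists_equicontinuousOn_iff

theorem isOpen_Fatou (H : Set (CHat → CHat)) : IsOpen (Fatou H) := by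
  rw [isOpen_iff_eventually]
  intro z hz
  filter_upwards [eventually_eventually_nhds.2 (mem_Fatou_iff.1 hz)] with u hu
  exact mem_Fatou_iff.2 hu

/-- Including the identity as index `0` does not affect equicontinuity, and makes the family behave
well under shifts. -/
theorem mem_FatouSeq_iff {γ : ℕ → Rat} {z : CHat} :
    z ∈ FatouSeq γ ↔ ∀ᶠ u in 𝓝 z, EquicontinuousAt (comps γ) u := by
  have key : ∀ u, EquicontinuousAt (fun n : ℕ => comps γ (n + 1)) u ↔
      EquicontinuousAt (comps γ) u := by
    intro u
    constructor
    · intro h V hV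
      filter_upwards [h V hV, (continuous_id.tendsto u) (UniformSpace.ball_mem_nhds u hV)]
        with w hw hw' n
      cases n with
      | zero => exact hw'
      | succ n => exact hw n
    · exact fun h => h.comp _
  rw [FatouSeq, Set.mem_ofPred_eq, exists_equicontinuousOn_iff]
  simp only [key]

theorem Fatou_subset_FatouSeq {τ : ProbabilityMeasure Rat} {γ : ℕ → Rat} (hγ : γ ∈ X τ) :
    Fatou (G τ) ⊆ FatouSeq γ := by
  intro z hz
  refine exists_equicontinuousOn_iff.2 ?_
  filter_upwards [mem_Fatou_iff.1 hz] with u hu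
  exact hu.comp fun n => ⟨comps γ (n + 1), comps_mem_G hγ n⟩

theorem mem_FatouSeq_consSeq {g : Rat} {γ : ℕ → Rat} {y : CHat} (h : g y ∈ FatouSeq γ) :
    y ∈ FatouSeq (consSeq g γ) := by
  rw [mem_FatouSeq_iff] at h ⊢
  filter_upwards [g.continuous.continuousAt.eventually h] with u hu V hV
  filter_upwards [g.continuous.continuousAt.eventually (hu V hV),
    (continuous_id.tendsto u) (UniformSpace.ball_mem_nhds u hV)] with w hw hw' n
  cases n with
  | zero => exact hw'
  | succ n => simpa only [comps_consSeq] using hw n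

theorem mem_FatouSeq_of_comps {γ : ℕ → Rat} {y : CHat} {n : ℕ}
    (h : comps γ n y ∈ FatouSeq (shift n γ)) : y ∈ FatouSeq γ := by
  induction n generalizing y γ with
  | zero =>
    have : shift 0 γ = γ := by funext k; simp [shift]
    rwa [this] at h
  | succ n ih =>
    rw [← consSeq_shift γ]
    apply mem_FatouSeq_consSeq
    apply ih
    rw [← consSeq_shift γ, comps_consSeq] at h
    have e : shift (n + 1) (consSeq (γ 0) (shift 1 γ)) = shift n (shift 1 γ) := by
      rw [consSeq_shift]
      funext k
      simp only [shift]
      congr 1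
      omega
    rwa [e] at h

theorem mem_FatouSeq_of_comps_mem_Fatou {τ : ProbabilityMeasure Rat} {γ : ℕ → Rat} (hγ : γ ∈ X τ)
    {y : CHat} {n : ℕ} (h : comps γ n y ∈ Fatou (G τ)) : y ∈ FatouSeq γ :=
  mem_FatouSeq_of_comps (Fatou_subset_FatouSeq (shift_mem_X hγ n) h)

/-- Only countable quantifiers occur here, which yields joint measurability of `z ∈ JuliaSeq γ`. -/
theorem mem_FatouSeq_iff_denseSeq {γ : ℕ → Rat} {z : CHat} :
    z ∈ FatouSeq γ ↔ ∃ k : ℕ, ∀ m : ℕ, ∃ j : ℕ, ∀ a b : ℕ,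
      dist (TopologicalSpace.denseSeq CHat a) z < 1 / ((k : ℝ) + 1) →
      dist (TopologicalSpace.denseSeq CHat a) (TopologicalSpace.denseSeq CHat b)
        < 1 / ((j : ℝ) + 1) →
      ∀ n, dist (comps γ n (TopologicalSpace.denseSeq CHat a))
        (comps γ n (TopologicalSpace.denseSeq CHat b)) ≤ 1 / ((m : ℝ) + 1) := by
  have hden := TopologicalSpace.denseRange_denseSeq CHat
  rw [mem_FatouSeq_iff]
  constructor
  · intro h
    obtain ⟨r, hr, hb⟩ := Metric.nhds_basis_closedBall.eventually_iff.1 h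
    obtain ⟨k, hk⟩ := exists_nat_one_div_lt hr
    refine ⟨k, fun m => ?_⟩
    have hm : (0 : ℝ) < 1 / ((m : ℝ) + 1) := by positivity
    have hc : ∀ a ∈ Metric.closedBall z r,
        ContinuousAt (UniformFun.ofFun ∘ Function.swap (comps γ)) a := fun a ha =>
      equicontinuousAt_iff_continuousAt.1 (hb ha)
    -- Equicontinuity is continuity into functions on `ℕ` with uniform convergence, so compactness
    -- of the ball gives one modulus for all its points.
    have hu := (isCompact_closedBall z r).uniformContinuousAt_of_continuousAt
      (UniformFun.ofFun ∘ Function.swap (comps γ)) hc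
      ((UniformFun.hasBasis_uniformity ℕ CHat).mem_of_mem (Metric.dist_mem_uniformity hm))
    obtain ⟨δ, hδ, hu⟩ := Metric.mem_uniformity_dist.1 hu
    obtain ⟨j, hj⟩ := exists_nat_one_div_lt hδ
    refine ⟨j, fun a b ha hab n => ?_⟩
    have := hu (hab.trans hj) (Metric.mem_closedBall.2 (ha.trans hk).le)
    exact (this n).le
  · rintro ⟨k, h⟩
    have hk : (0 : ℝ) < 1 / ((k : ℝ) + 1) := by positivity
    filter_upwards [Metric.ball_mem_nhds z hk] with u hu
    rw [Metric.equicontinuousAt_iff]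
    intro ε hε
    obtain ⟨m, hm⟩ := exists_nat_one_div_lt hε
    obtain ⟨j, hj⟩ := h m
    have hjp : (0 : ℝ) < 1 / ((j : ℝ) + 1) := by positivity
    refine ⟨1 / ((j : ℝ) + 1), hjp, fun w hw n => ?_⟩
    set W : Set (CHat × CHat) := {p | dist p.1 z < 1 / ((k : ℝ) + 1) ∧
      dist p.1 p.2 < 1 / ((j : ℝ) + 1)} with hW
    have hWo : IsOpen W :=
      (isOpen_lt (continuous_fst.dist continuous_const) continuous_const).and
        (isOpen_lt (continuous_fst.dist continuous_snd) continuous_const)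
    have hcl : IsClosed {p : CHat × CHat |
        dist (comps γ n p.1) (comps γ n p.2) ≤ 1 / ((m : ℝ) + 1)} :=
      isClosed_le (((continuous_comps_right γ n).comp continuous_fst).dist
        ((continuous_comps_right γ n).comp continuous_snd)) continuous_const
    have hd2 : Dense (Set.range (Prod.map (TopologicalSpace.denseSeq CHat)
      (TopologicalSpace.denseSeq CHat))) := hden.prodMap hden
    -- The weak inequality is a closed condition, so it passes from dense pairs to all pairs in the
    -- open set `W`.
    have hsub := (hd2.open_subset_closure_inter hWo).trans (hcl.closure_subset_iff.2 (by
      rintro _ ⟨⟨h1, h2⟩, ⟨⟨a, b⟩, rfl⟩⟩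
      exact hj a b h1 h2 n))
    have := hsub (show (u, w) ∈ W from ⟨hu, by rwa [dist_comm]⟩)
    exact lt_of_le_of_lt this hm

theorem measurable_comps (n : ℕ) : Measurable fun p : CHat × (ℕ → Rat) => comps p.2 n p.1 :=
  (continuous_comps n).measurable

theorem measurable_comps_left (n : ℕ) (y : CHat) : Measurable fun γ : ℕ → Rat => comps γ n y :=
  (measurable_comps n).comp measurable_prodMk_left

theorem measurableSet_JuliaSeq : MeasurableSet {p : CHat × (ℕ → Rat) | p.1 ∈ JuliaSeq p.2} := by
  have : {p : CHat × (ℕ → Rat) | p.1 ∈ JuliaSeq p.2} =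
      {p : CHat × (ℕ → Rat) | p.1 ∈ FatouSeq p.2}ᶜ := rfl
  rw [this]
  refine MeasurableSet.compl ?_
  simp only [mem_FatouSeq_iff_denseSeq]
  refine measurableSet_setOfPred.2 (Measurable.exists fun k => Measurable.forall fun m =>
    Measurable.exists fun j => Measurable.forall fun a => Measurable.forall fun b =>
    Measurable.imp ?_ (measurable_const.imp (Measurable.forall fun n => ?_)))
  · exact measurableSet_setOfPred.1 (measurableSet_lt
      ((continuous_const.dist continuous_fst).measurable) measurable_const)
  · have h : ∀ u, Continuous fun p : CHat × (ℕ → Rat) => comps p.2 n u := fun u =>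
      (continuous_comps n).comp (continuous_const.prodMk continuous_snd)
    exact measurableSet_setOfPred.1 (measurableSet_le ((h _).dist (h _)).measurable measurable_const)

/-! ### The random walk -/

instance (τ : ProbabilityMeasure Rat) : IsProbabilityMeasure (prodMeas τ) := by
  unfold prodMeas; infer_instance

theorem measurable_consSeq : Measurable fun p : Rat × (ℕ → Rat) => consSeq p.1 p.2 := by
  refine measurable_pi_iff.2 fun n => ?_
  cases n with
  | zero => exact measurable_fst
  | succ n => exact (measurable_pi_apply n).comp measurable_snd

/-- This is the Markov property in product form: conditioning on the first map leaves an independent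
copy of the sequence. -/
theorem prodMeas_eq_map_consSeq (τ : ProbabilityMeasure Rat) :
    ((τ : Measure Rat).prod (prodMeas τ)).map (fun p => consSeq p.1 p.2) = prodMeas τ := by
  classical
  refine Measure.eq_infinitePi _ fun s t ht => ?_
  obtain ⟨N, hN⟩ : ∃ N, s ⊆ Finset.range (N + 1) :=
    ⟨s.sup id, fun i hi => by
      have : i ≤ s.sup id := Finset.le_sup (f := id) hi
      simpa using Nat.lt_succ_of_le this⟩
  -- Padding with `univ` makes the index set an initial segment, from which coordinate `0` can be
  -- split off.
  set t' : ℕ → Set Rat := fun i => if i ∈ s then t i else Set.univ with ht'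
  have hmt' : ∀ i, MeasurableSet (t' i) := fun i => by
    simp only [ht']; split_ifs
    · exact ht i
    · exact MeasurableSet.univ
  have h1 : ∏ i ∈ s, (τ : Measure Rat) (t i) =
      ∏ i ∈ Finset.range (N + 1), (τ : Measure Rat) (t' i) := by
    rw [← Finset.prod_subset hN]
    · exact Finset.prod_congr rfl fun i hi => by simp [ht', hi]
    · intro i _ hi
      simp [ht', hi]
  have h2 : (fun p : Rat × (ℕ → Rat) => consSeq p.1 p.2) ⁻¹' ((s : Set ℕ).pi t) =
      t' 0 ×ˢ ((Finset.range N : Set ℕ).pi fun i => t' (i + 1)) := by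
    ext ⟨g, γ⟩
    simp only [Set.mem_preimage, Set.mem_pi, Set.mem_prod, Finset.mem_coe, Finset.mem_range, ht']
    constructor
    · intro h
      refine ⟨?_, fun i _ => ?_⟩
      · split_ifs with h0
        · exact h 0 h0
        · trivial
      · split_ifs with h0
        · exact h (i + 1) h0
        · trivial
    · rintro ⟨h0, h1⟩ i hi
      cases i with
      | zero => simpa [hi] using h0
      | succ i =>
        have := h1 i (by have := Finset.mem_range.1 (hN hi); omega)
        simpa [hi] using this
  rw [Measure.map_apply measurable_consSeq
    (MeasurableSet.pi s.countable_toSet fun i _ => ht i), h2, Measure.prod_prod, h1,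
    Finset.prod_range_succ', mul_comm, prodMeas,
    Measure.infinitePi_pi _ fun i _ => hmt' (i + 1)]

theorem lintegral_prodMeas (τ : ProbabilityMeasure Rat) {F : (ℕ → Rat) → ENNReal}
    (hF : Measurable F) : ∫⁻ γ, F γ ∂(prodMeas τ) =
      ∫⁻ g, ∫⁻ γ, F (consSeq g γ) ∂(prodMeas τ) ∂(τ : Measure Rat) := by
  conv_lhs => rw [← prodMeas_eq_map_consSeq]
  rw [lintegral_map hF measurable_consSeq,
    lintegral_prod (fun p : Rat × (ℕ → Rat) => F (consSeq p.1 p.2))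
      (hF.comp measurable_consSeq).aemeasurable]

theorem prodMeas_apply (τ : ProbabilityMeasure Rat) {A : Set (ℕ → Rat)} (hA : MeasurableSet A) :
    prodMeas τ A = ∫⁻ g, prodMeas τ {γ | consSeq g γ ∈ A} ∂(τ : Measure Rat) := by
  conv_lhs => rw [← prodMeas_eq_map_consSeq]
  rw [Measure.map_apply measurable_consSeq hA,
    Measure.prod_apply (measurable_consSeq hA)]
  rfl

theorem map_shift_prodMeas (τ : ProbabilityMeasure Rat) (m : ℕ) :
    (prodMeas τ).map (shift m) = prodMeas τ :=
  Measure.map_infinitePi_infinitePi_of_inj (P := fun _ : ℕ => (τ : Measure Rat))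
    (f := fun n => m + n) fun _ _ h => by simpa using h

theorem measurable_shift (m : ℕ) : Measurable (shift m) :=
  measurable_pi_iff.2 fun n => measurable_pi_apply (m + n)

theorem ae_shift {τ : ProbabilityMeasure Rat} {p : (ℕ → Rat) → Prop}
    (h : ∀ᵐ γ ∂(prodMeas τ), p γ) : ∀ᵐ γ ∂(prodMeas τ), ∀ m, p (shift m γ) := by
  rw [ae_all_iff]
  intro m
  rw [← map_shift_prodMeas τ m] at h
  exact ae_of_ae_map (measurable_shift m).aemeasurable h

theorem ae_mem_supp (τ : ProbabilityMeasure Rat) : ∀ᵐ g ∂(τ : Measure Rat), g ∈ supp τ :=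
  Measure.support_mem_ae

theorem ae_mem_X (τ : ProbabilityMeasure Rat) : ∀ᵐ γ ∂(prodMeas τ), γ ∈ X τ := by
  have : ∀ n : ℕ, ∀ᵐ γ ∂(prodMeas τ), γ n ∈ supp τ := by
    intro n
    have h := ae_mem_supp τ
    have h1 := Measure.infinitePi_map_eval (fun _ : ℕ => (τ : Measure Rat)) n
    rw [← h1] at h
    exact ae_of_ae_map (measurable_pi_apply n).aemeasurable h
  filter_upwards [ae_all_iff.2 this] with γ hγ n using hγ n

theorem isClosed_supp (τ : ProbabilityMeasure Rat) : IsClosed (supp τ) := Measure.isClosed_support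

theorem measurableSet_X (τ : ProbabilityMeasure Rat) : MeasurableSet (X τ) := by
  have : X τ = ⋂ n : ℕ, (fun γ : ℕ → Rat => γ n) ⁻¹' supp τ := by
    ext γ; simp [RandomRat.X]
  rw [this]
  exact .iInter fun n => measurable_pi_apply n (isClosed_supp τ).measurableSet

theorem prodMeas_nhds_pos {τ : ProbabilityMeasure Rat} {γ : ℕ → Rat} (hγ : γ ∈ X τ)
    {V : Set (ℕ → Rat)} (hV : V ∈ 𝓝 γ) : 0 < prodMeas τ V := by
  rw [nhds_pi, Filter.mem_pi'] at hV
  obtain ⟨I, t, ht, hsub⟩ := hV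
  have hle : prodMeas τ ((I : Set ℕ).pi fun i => interior (t i)) ≤ prodMeas τ V :=
    measure_mono ((Set.pi_mono fun i _ => interior_subset).trans hsub)
  refine lt_of_lt_of_le ?_ hle
  rw [prodMeas, Measure.infinitePi_pi _ fun i _ => isOpen_interior.measurableSet,
    pos_iff_ne_zero, Finset.prod_ne_zero_iff]
  intro i _
  exact ((Measure.mem_support_iff_forall _).1 (hγ i) _ (interior_mem_nhds.2 (ht i))).ne'

/-- Reaching an open set along a finite word is an open condition on the word and the starting point
jointly. Neighbourhoods of words in the support have positive mass, so the bound is locally uniform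
in the starting point. -/
theorem exists_nhds_prodMeas_comps {τ : ProbabilityMeasure Rat} {g : CHat → CHat} (hg : g ∈ G τ)
    {y : CHat} {O : Set CHat} (hO : IsOpen O) (hy : g y ∈ O) :
    ∃ W ∈ 𝓝 y, ∃ p > 0, ∃ n, ∀ y' ∈ W, p ≤ prodMeas τ {γ | comps γ n y' ∈ O} := by
  obtain ⟨γ, hγ, n, rfl⟩ := exists_comps_eq hg
  have h1 : {q : CHat × (ℕ → Rat) | comps q.2 (n + 1) q.1 ∈ O} ∈ 𝓝 (y, γ) :=
    (hO.preimage (continuous_comps (n + 1))).mem_nhds hy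
  rw [mem_nhds_prod_iff] at h1
  obtain ⟨W, hW, V, hV, hWV⟩ := h1
  refine ⟨W, hW, prodMeas τ V, prodMeas_nhds_pos hγ hV, n + 1, fun y' hy' => ?_⟩
  exact measure_mono fun γ' hγ' => hWV (Set.mk_mem_prod hy' hγ')

theorem measurableSet_section {Q : Set (CHat × (ℕ → Rat))} (hQ : MeasurableSet Q) (y : CHat) :
    MeasurableSet {γ | (y, γ) ∈ Q} := measurable_prodMk_left hQ

/-- An event that only depends on the future and forces a visit to `K` has, from any starting
point, at most the maximal probability that it has from the points of `K`. -/
theorem prodMeas_le_of_hits {τ : ProbabilityMeasure Rat} {Q : Set (CHat × (ℕ → Rat))}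
    (hQm : MeasurableSet Q) (hQ : ∀ y g γ, (y, consSeq g γ) ∈ Q → (g y, γ) ∈ Q)
    {K : Set CHat} (hK : MeasurableSet K) {c : ENNReal}
    (hc : ∀ y ∈ K, prodMeas τ {γ | (y, γ) ∈ Q} ≤ c)
    (hit : ∀ y, ∀ᵐ γ ∂(prodMeas τ), (y, γ) ∈ Q → ∃ n, comps γ n y ∈ K) (y : CHat) :
    prodMeas τ {γ | (y, γ) ∈ Q} ≤ c := by
  have hm : ∀ n y, MeasurableSet {γ : ℕ → Rat | (y, γ) ∈ Q ∧ ∃ k ≤ n, comps γ k y ∈ K} := by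
    intro n y
    have : {γ : ℕ → Rat | (y, γ) ∈ Q ∧ ∃ k ≤ n, comps γ k y ∈ K} =
        {γ | (y, γ) ∈ Q} ∩ ⋃ k ∈ Set.Iic n, (fun γ => comps γ k y) ⁻¹' K := by ext; simp
    rw [this]
    exact (measurableSet_section hQm y).inter
      (.biUnion (Set.to_countable _) fun k _ => measurable_comps_left k y hK)
  -- Induction on the deadline `n` for the visit, conditioning on the first step, takes the place of
  -- a stopping time argument.
  have key : ∀ n y, prodMeas τ {γ | (y, γ) ∈ Q ∧ ∃ k ≤ n, comps γ k y ∈ K} ≤ c := by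
    intro n
    induction n with
    | zero =>
      intro y
      by_cases hy : y ∈ K
      · exact (measure_mono fun γ h => h.1).trans (hc y hy)
      · have : {γ : ℕ → Rat | (y, γ) ∈ Q ∧ ∃ k ≤ 0, comps γ k y ∈ K} = ∅ := by
          ext γ
          simp [hy]
        rw [this, measure_empty]
        exact bot_le
    | succ n ih =>
      intro y
      by_cases hy : y ∈ K
      · exact (measure_mono fun γ h => h.1).trans (hc y hy)
      · rw [prodMeas_apply τ (hm _ y)]
        calc _ ≤ ∫⁻ g : Rat, c ∂(τ : Measure Rat) := by
              refine lintegral_mono fun g => (measure_mono ?_).trans (ih (g y))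
              rintro γ ⟨h1, k, hk, h2⟩
              refine ⟨hQ y g γ h1, ?_⟩
              cases k with
              | zero => exact absurd h2 hy
              | succ k => exact ⟨k, by omega, by rwa [comps_consSeq] at h2⟩
          _ = c := by simp
  have hmono : Monotone fun n => {γ : ℕ → Rat | (y, γ) ∈ Q ∧ ∃ k ≤ n, comps γ k y ∈ K} := by
    rintro a b hab γ ⟨h1, k, hk, h2⟩
    exact ⟨h1, k, hk.trans hab, h2⟩
  calc prodMeas τ {γ | (y, γ) ∈ Q}
      ≤ prodMeas τ (⋃ n, {γ : ℕ → Rat | (y, γ) ∈ Q ∧ ∃ k ≤ n, comps γ k y ∈ K}) := by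
        refine measure_mono_ae ?_
        filter_upwards [hit y] with γ hγ hQγ
        obtain ⟨n, hn⟩ := hγ hQγ
        exact Set.mem_iUnion.2 ⟨n, hQγ, n, le_rfl, hn⟩
    _ ≤ c := by
        rw [hmono.measure_iUnion]
        exact iSup_le fun n => key n y

/-- The event survives to time `n`, when the walk must be in `B`; from wherever it is then, the
remaining probability is at most `c`. -/
theorem prodMeas_le_mul {τ : ProbabilityMeasure Rat} {Q : Set (CHat × (ℕ → Rat))}
    (hQm : MeasurableSet Q) (hQ : ∀ y g γ, (y, consSeq g γ) ∈ Q → (g y, γ) ∈ Q)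
    {B : Set CHat} (hB : MeasurableSet B) (hQB : ∀ y γ, (y, γ) ∈ Q → y ∈ B) {c : ENNReal}
    (hc : ∀ y, prodMeas τ {γ | (y, γ) ∈ Q} ≤ c) (n : ℕ) (y : CHat) :
    prodMeas τ {γ | (y, γ) ∈ Q} ≤ prodMeas τ {γ | comps γ n y ∈ B} * c := by
  induction n generalizing y with
  | zero =>
    by_cases hy : y ∈ B
    · simpa [hy] using hc y
    · have : {γ : ℕ → Rat | (y, γ) ∈ Q} = ∅ :=
        Set.eq_empty_of_forall_notMem fun γ h => hy (hQB y γ h)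
      simp [this]
  | succ n ih =>
    have hm : MeasurableSet {γ : ℕ → Rat | comps γ (n + 1) y ∈ B} :=
      measurable_comps_left (n + 1) y hB
    have h1 : Measurable fun g : Rat => prodMeas τ {γ | comps γ n (g y) ∈ B} := by
      have h2 : MeasurableSet {p : Rat × (ℕ → Rat) | comps p.2 n (p.1 y) ∈ B} := by
        have h3 : Measurable fun p : Rat × (ℕ → Rat) => comps p.2 n (p.1 y) :=
          (measurable_comps n).comp
            (((Rat.continuous_eval y).measurable.comp measurable_fst).prodMk measurable_snd)
        exact h3 hB
      exact measurable_measure_prodMk_left h2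
    rw [prodMeas_apply τ (measurableSet_section hQm y), prodMeas_apply τ hm,
      ← lintegral_mul_const _ (by simpa only [Set.mem_ofPred_eq, comps_consSeq] using h1)]
    refine lintegral_mono fun g => ?_
    simp only [Set.mem_ofPred_eq, comps_consSeq]
    exact (measure_mono fun γ h => hQ y g γ h).trans (ih (g y))

/-- If the walk hits `A` with probability at least `p > 0` from each point of `K`, then almost
surely it cannot visit `K` infinitely often without hitting `A`. -/
theorem ae_hits_of_frequently {τ : ProbabilityMeasure Rat} {A K : Set CHat} (hA : MeasurableSet A)
    (hK : MeasurableSet K) {p : ENNReal} (hp : 0 < p)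
    (h : ∀ y ∈ K, ∃ n, p ≤ prodMeas τ {γ | comps γ n y ∈ A}) (y : CHat) :
    ∀ᵐ γ ∂(prodMeas τ), (∃ᶠ n in atTop, comps γ n y ∈ K) → ∃ n, comps γ n y ∈ A := by
  set Q : Set (CHat × (ℕ → Rat)) :=
    {q | (∀ n, comps q.2 n q.1 ∉ A) ∧ ∀ N, ∃ n, N ≤ n ∧ comps q.2 n q.1 ∈ K} with hQdef
  have hQm : MeasurableSet Q := by
    have e : Q = (⋂ n, ((fun q : CHat × (ℕ → Rat) => comps q.2 n q.1) ⁻¹' A)ᶜ) ∩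
        ⋂ N : ℕ, ⋃ n ∈ Set.Ici N, (fun q : CHat × (ℕ → Rat) => comps q.2 n q.1) ⁻¹' K := by
      ext q; simp [hQdef]
    rw [e]
    refine (MeasurableSet.iInter fun n => (measurable_comps n hA).compl).inter
      (.iInter fun N => .biUnion (Set.to_countable _) fun n _ => measurable_comps n hK)
  have hQ : ∀ y g γ, (y, consSeq g γ) ∈ Q → (g y, γ) ∈ Q := by
    rintro y g γ ⟨h1, h2⟩
    refine ⟨fun n => ?_, fun N => ?_⟩
    · have := h1 (n + 1)
      rwa [comps_consSeq] at this
    · obtain ⟨n, hn, h3⟩ := h2 (N + 1)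
      obtain ⟨n, rfl⟩ : ∃ m, n = m + 1 := ⟨n - 1, by omega⟩
      exact ⟨n, by omega, by rwa [comps_consSeq] at h3⟩
  -- From points of `K` the probability of `Q` is at most `(1 - p) * S`. As `Q` forces a visit to
  -- `K`, the same bound holds from everywhere, so `S ≤ (1 - p) * S` and `S = 0`.
  set S : ENNReal := ⨆ y, prodMeas τ {γ | (y, γ) ∈ Q} with hS
  have hS1 : S ≤ 1 := iSup_le fun y => prob_le_one
  have hSle : ∀ y, prodMeas τ {γ | (y, γ) ∈ Q} ≤ S := fun y =>
    le_iSup (fun y => prodMeas τ {γ | (y, γ) ∈ Q}) y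
  have hKle : ∀ y ∈ K, prodMeas τ {γ | (y, γ) ∈ Q} ≤ (1 - p) * S := by
    intro y hy
    obtain ⟨n, hn⟩ := h y hy
    refine (prodMeas_le_mul hQm hQ hA.compl (fun y γ hq => hq.1 0) hSle n y).trans ?_
    gcongr
    have hm : MeasurableSet {γ : ℕ → Rat | comps γ n y ∈ A} := measurable_comps_left n y hA
    have : {γ : ℕ → Rat | comps γ n y ∈ Aᶜ} = {γ : ℕ → Rat | comps γ n y ∈ A}ᶜ := rfl
    rw [this, prob_compl_eq_one_sub hm]
    exact tsub_le_tsub_left hn 1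
  have hall := prodMeas_le_of_hits hQm hQ hK hKle fun y => Eventually.of_forall fun γ hq => by
    obtain ⟨n, -, hn⟩ := hq.2 0
    exact ⟨n, hn⟩
  have hSS : S ≤ (1 - p) * S := iSup_le hall
  have hS0 : S = 0 := by
    by_contra hne
    have h1 : (1 - p) < 1 := ENNReal.sub_lt_self ENNReal.one_ne_top one_ne_zero hp.ne'
    have h2 : (1 - p) * S < 1 * S :=
      ENNReal.mul_lt_mul_left hne (hS1.trans_lt ENNReal.one_lt_top).ne h1
    rw [one_mul] at h2
    exact absurd hSS (not_le.2 h2)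
  have hy0 : prodMeas τ {γ | (y, γ) ∈ Q} = 0 := le_antisymm ((hSle y).trans hS0.le) bot_le
  have := measure_eq_zero_iff_ae_notMem.1 hy0
  filter_upwards [this] with γ hγ hf
  by_contra! hc
  exact hγ ⟨hc, fun N => by simpa using (frequently_atTop.1 hf) N⟩

/-! ### The Markov chain on a finite minimal set -/

/-- `L` is a minimal element among the non-empty finite sets that are forward invariant under the
support of `τ`. -/
structure IsFinMin (τ : ProbabilityMeasure Rat) (L : Finset CHat) : Prop where
  nonempty : L.Nonempty
  mapsTo : ∀ g ∈ supp τ, ∀ x ∈ L, g x ∈ L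
  minimal : ∀ L' ⊆ L, L'.Nonempty → (∀ g ∈ supp τ, ∀ x ∈ L', g x ∈ L') → L' = L

/-- The transition probabilities. -/
def trans (τ : ProbabilityMeasure Rat) (x y : CHat) : ℝ := (τ : Measure Rat).real {g | g x = y}

theorem measurableSet_eval_eq (x y : CHat) : MeasurableSet {g : Rat | g x = y} :=
  (isClosed_eq (Rat.continuous_eval x) continuous_const).measurableSet

theorem trans_nonneg (τ : ProbabilityMeasure Rat) (x y : CHat) : 0 ≤ trans τ x y :=
  measureReal_nonneg

namespace IsFinMin

variable {τ : ProbabilityMeasure Rat} {L : Finset CHat}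

theorem ae_eval_mem (hL : IsFinMin τ L) {x : CHat} (hx : x ∈ L) :
    ∀ᵐ g ∂(τ : Measure Rat), g x ∈ L := by
  filter_upwards [ae_mem_supp τ] with g hg using hL.mapsTo g hg x hx

/-- Since `g x` almost surely has finitely many values, `h (g x)` is almost surely a simple
function, whatever `h` is. -/
theorem ae_eq_sum_indicator {E : Type*} [NormedAddCommGroup E] [NormedSpace ℝ E]
    (hL : IsFinMin τ L) {x : CHat} (hx : x ∈ L) (h : CHat → E) :
    (fun g : Rat => h (g x)) =ᵐ[(τ : Measure Rat)]
      fun g => ∑ y ∈ L, {g : Rat | g x = y}.indicator (fun _ => h y) g := by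
  classical
  filter_upwards [hL.ae_eval_mem hx] with g hg
  simp only [Set.indicator_apply, Set.mem_ofPred_eq]
  rw [Finset.sum_ite_eq]
  simp [hg]

theorem integrable_eval (hL : IsFinMin τ L) {E : Type*} [NormedAddCommGroup E] [NormedSpace ℝ E]
    {x : CHat} (hx : x ∈ L) (h : CHat → E) :
    Integrable (fun g : Rat => h (g x)) (τ : Measure Rat) := by
  rw [integrable_congr (hL.ae_eq_sum_indicator hx h)]
  exact integrable_finsetSum _ fun y _ =>
    (integrable_const (h y)).indicator (measurableSet_eval_eq x y)

theorem integral_eval (hL : IsFinMin τ L) {E : Type*} [NormedAddCommGroup E] [NormedSpace ℝ E]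
    [CompleteSpace E] {x : CHat} (hx : x ∈ L) (h : CHat → E) :
    ∫ g : Rat, h (g x) ∂(τ : Measure Rat) = ∑ y ∈ L, trans τ x y • h y := by
  rw [integral_congr_ae (hL.ae_eq_sum_indicator hx h), integral_finsetSum _ fun y _ =>
    (integrable_const (h y)).indicator (measurableSet_eval_eq x y)]
  refine Finset.sum_congr rfl fun y _ => ?_
  rw [integral_indicator_const _ (measurableSet_eval_eq x y)]
  rfl

theorem sum_trans (hL : IsFinMin τ L) {x : CHat} (hx : x ∈ L) : ∑ y ∈ L, trans τ x y = 1 := by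
  have := hL.integral_eval hx fun _ => (1 : ℝ)
  simpa using this.symm

/-- Avoiding the finitely many other points of `L` is an open condition near `g`, so it has positive
probability. -/
theorem measure_eval_eq_pos (hL : IsFinMin τ L) {x : CHat} (hx : x ∈ L) {g : Rat}
    (hg : g ∈ supp τ) : 0 < (τ : Measure Rat) {k | k x = g x} := by
  classical
  have hcl : IsClosed ((L.erase (g x) : Finset CHat) : Set CHat) :=
    (L.erase (g x)).finite_toSet.isClosed
  have hV : {k : Rat | k x ∈ ((L.erase (g x) : Finset CHat) : Set CHat)ᶜ} ∈ 𝓝 g :=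
    (hcl.isOpen_compl.preimage (Rat.continuous_eval x)).mem_nhds (by simp)
  refine lt_of_lt_of_le ((Measure.mem_support_iff_forall _).1 hg _ hV) (measure_mono_ae ?_)
  filter_upwards [hL.ae_eval_mem hx] with k hk hkV
  by_contra hne
  exact hkV (Finset.mem_coe.2 (Finset.mem_erase.2 ⟨hne, hk⟩))

theorem trans_pos (hL : IsFinMin τ L) {x : CHat} (hx : x ∈ L) {g : Rat}
    (hg : g ∈ supp τ) : 0 < trans τ x (g x) :=
  ENNReal.toReal_pos (hL.measure_eval_eq_pos hx hg).ne' (measure_ne_top _ _)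

theorem forall_of_invariant (hL : IsFinMin τ L) {p : CHat → Prop} (h0 : ∃ x ∈ L, p x)
    (h : ∀ g ∈ supp τ, ∀ x ∈ L, p x → p (g x)) : ∀ x ∈ L, p x := by
  classical
  have : L.filter p = L := by
    refine hL.minimal _ (Finset.filter_subset _ _) ?_ ?_
    · obtain ⟨x, hx, hp⟩ := h0
      exact ⟨x, Finset.mem_filter.2 ⟨hx, hp⟩⟩
    · intro g hg x hx
      rw [Finset.mem_filter] at hx ⊢
      exact ⟨hL.mapsTo g hg x hx.1, h g hg x hx.1 hx.2⟩
  intro x hx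
  rw [← this] at hx
  exact (Finset.mem_filter.1 hx).2

/-- Maximum principle: at a maximum a weighted average of nonnegative defects vanishes, so the
maximum is also attained at every image, and minimality of `L` spreads it. -/
theorem eq_of_harmonic (hL : IsFinMin τ L) {h : CHat → ℝ}
    (hh : ∀ x ∈ L, ∑ y ∈ L, trans τ x y * h y = h x) : ∃ c, ∀ x ∈ L, h x = c := by
  obtain ⟨x₀, hx₀, hmax⟩ := L.exists_max_image h hL.nonempty
  refine ⟨h x₀, hL.forall_of_invariant ⟨x₀, hx₀, rfl⟩ fun g hg x hx hp => ?_⟩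
  have h1 : ∑ y ∈ L, trans τ x y * (h x₀ - h y) = 0 := by
    simp only [mul_sub, Finset.sum_sub_distrib]
    rw [hh x hx, ← Finset.sum_mul, hL.sum_trans hx, hp]
    ring
  have h2 := (Finset.sum_eq_zero_iff_of_nonneg fun y hy =>
    mul_nonneg (trans_nonneg τ x y) (sub_nonneg.2 (hmax y hy))).1 h1 (g x) (hL.mapsTo g hg x hx)
  rcases mul_eq_zero.1 h2 with h3 | h3
  · exact absurd h3 (hL.trans_pos hx hg).ne'
  · linarith

/-- The transition matrix. -/
def mat (τ : ProbabilityMeasure Rat) (L : Finset CHat) : Matrix L L ℝ :=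
  Matrix.of fun x y => trans τ x y

theorem mat_mulVec (h : L → ℝ) (x : L) :
    (mat τ L).mulVec h x = ∑ y : L, trans τ x y * h y := rfl

/-- Constants are fixed by the transition matrix, so it also has a left fixed vector `v`. The
entrywise bound of `|v|` by its image becomes equality because both have the same sum, and `|v|` is
normalized. -/
theorem exists_stationary (hL : IsFinMin τ L) : ∃ v : CHat → ℝ, (∀ x ∈ L, 0 ≤ v x) ∧
    ∑ x ∈ L, v x = 1 ∧ ∀ y ∈ L, ∑ x ∈ L, v x * trans τ x y = v y := by
  classical
  have hne : Nonempty L := hL.nonempty.coe_sort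
  have h1 : ∃ v : L → ℝ, v ≠ 0 ∧ (1 - mat τ L).mulVec v = 0 := by
    refine ⟨fun _ => 1, fun h => ?_, ?_⟩
    · obtain ⟨x⟩ := hne
      simpa using congrFun h x
    · funext x
      rw [Matrix.sub_mulVec, Matrix.one_mulVec, Pi.sub_apply, mat_mulVec]
      have := hL.sum_trans x.2
      rw [← Finset.sum_coe_sort] at this
      simp only [mul_one, this, sub_self, Pi.zero_apply]
  rw [Matrix.exists_mulVec_eq_zero_iff, ← Matrix.exists_vecMul_eq_zero_iff] at h1
  obtain ⟨v, hv0, hv⟩ := h1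
  have hv' : ∀ y : L, ∑ x : L, v x * trans τ x y = v y := by
    intro y
    have := congrFun hv y
    rw [Matrix.vecMul_sub, Matrix.vecMul_one, Pi.sub_apply, Pi.zero_apply, sub_eq_zero] at this
    exact this.symm
  have hle : ∀ y ∈ Finset.univ, |v y| ≤ ∑ x : L, |v x| * trans τ x y := by
    intro y _
    rw [← hv' y]
    refine (Finset.abs_sum_le_sum_abs _ _).trans (le_of_eq ?_)
    exact Finset.sum_congr rfl fun x _ => by rw [abs_mul, abs_of_nonneg (trans_nonneg τ x y)]
  have hsum : ∑ y : L, |v y| = ∑ y : L, ∑ x : L, |v x| * trans τ x y := by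
    rw [Finset.sum_comm]
    refine Finset.sum_congr rfl fun x _ => ?_
    have := hL.sum_trans x.2
    rw [← Finset.sum_coe_sort] at this
    rw [← Finset.mul_sum, this, mul_one]
  have heq := (Finset.sum_eq_sum_iff_of_le hle).1 hsum
  set s : ℝ := ∑ y : L, |v y| with hs
  have hspos : 0 < s := by
    obtain ⟨x, hx⟩ := Function.ne_iff.1 hv0
    exact Finset.sum_pos' (fun y _ => abs_nonneg _) ⟨x, Finset.mem_univ x, abs_pos.2 hx⟩
  set v' : CHat → ℝ := Function.extend Subtype.val (fun x : L => |v x| / s) 0 with hv'def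
  have hco : ∀ x : L, v' x = |v x| / s := Subtype.val_injective.extend_apply _ _
  refine ⟨v', fun x hx => ?_, ?_, fun y hy => ?_⟩
  · rw [hco ⟨x, hx⟩]; positivity
  · rw [← Finset.sum_coe_sort]
    simp only [hco]
    rw [← Finset.sum_div, ← hs, div_self hspos.ne']
  · rw [hco ⟨y, hy⟩, heq ⟨y, hy⟩ (Finset.mem_univ _), Finset.sum_div, ← Finset.sum_coe_sort]
    simp only [hco]
    exact Finset.sum_congr rfl fun x _ => by ring

/-- Solvability of the Poisson equation of the chain. -/
theorem exists_poisson (hL : IsFinMin τ L) {w : CHat → ℝ} (hw1 : ∑ x ∈ L, w x = 1)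
    (hw : ∀ y ∈ L, ∑ x ∈ L, w x * trans τ x y = w y) (f : CHat → ℝ) :
    ∃ h : CHat → ℝ, ∀ x ∈ L, f x + ∑ y ∈ L, trans τ x y * h y - h x = ∑ y ∈ L, w y * f y := by
  classical
  set T : (L → ℝ) →ₗ[ℝ] (L → ℝ) := (1 - mat τ L).mulVecLin with hT
  have hTx : ∀ (h : L → ℝ) (x : L), T h x = h x - ∑ y : L, trans τ x y * h y := by
    intro h x
    rw [hT, Matrix.mulVecLin_apply, Matrix.sub_mulVec, Matrix.one_mulVec, Pi.sub_apply, mat_mulVec]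
  set W : (L → ℝ) →ₗ[ℝ] ℝ := ∑ x : L, (w x) • LinearMap.proj x with hW
  have hWx : ∀ h : L → ℝ, W h = ∑ x : L, w x * h x := by
    intro h; simp [hW]
  have hW1 : W (fun _ => 1) = 1 := by
    rw [hWx]
    simp only [mul_one]
    rw [Finset.sum_coe_sort, hw1]
  have hW0 : W ≠ 0 := fun h => by rw [h] at hW1; simp at hW1
  have hle : LinearMap.range T ≤ LinearMap.ker W := by
    rintro _ ⟨h, rfl⟩
    rw [LinearMap.mem_ker, hWx]
    simp only [hTx, mul_sub, Finset.sum_sub_distrib, Finset.mul_sum]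
    rw [Finset.sum_comm, sub_eq_zero]
    refine Finset.sum_congr rfl fun y _ => ?_
    have := hw y y.2
    rw [← Finset.sum_coe_sort] at this
    rw [← this, Finset.sum_mul]
    exact Finset.sum_congr rfl fun x _ => by rw [mul_assoc]
  have hker : LinearMap.ker T ≤ Submodule.span ℝ {fun _ => 1} := by
    intro h hh
    rw [LinearMap.mem_ker] at hh
    have hco : ∀ x : L, Function.extend Subtype.val h 0 (x : CHat) = h x :=
      Subtype.val_injective.extend_apply _ _
    obtain ⟨c, hc⟩ := hL.eq_of_harmonic (h := Function.extend Subtype.val h 0) (by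
      intro x hx
      have := congrFun hh ⟨x, hx⟩
      rw [hTx, Pi.zero_apply, sub_eq_zero] at this
      rw [hco ⟨x, hx⟩, ← Finset.sum_coe_sort]
      simp only [hco]
      exact this.symm)
    refine Submodule.mem_span_singleton.2 ⟨c, ?_⟩
    funext x
    have := hc x x.2
    rw [hco] at this
    simp [this]
  have hk1 : Module.finrank ℝ (LinearMap.ker T) ≤ 1 :=
    (Submodule.finrank_mono hker).trans (by
      simpa using finrank_span_le_card (R := ℝ) {fun _ : L => (1 : ℝ)})
  have hrn := LinearMap.finrank_range_add_finrank_ker T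
  have hWn := LinearMap.finrank_range_add_finrank_ker W
  have hWr : 1 ≤ Module.finrank ℝ (LinearMap.range W) := by
    rw [LinearMap.range_eq_top.2 (LinearMap.surjective hW0)]
    simp
  -- Stationarity gives one inclusion. The maximum principle leaves only constants in `ker T`, so
  -- the range has codimension at most one and fills the hyperplane.
  have heq : LinearMap.range T = LinearMap.ker W :=
    Submodule.eq_of_le_of_finrank_le hle (by omega)
  set m : ℝ := ∑ y ∈ L, w y * f y with hm
  have hmem : (fun x : L => f x - m) ∈ LinearMap.range T := by
    rw [heq, LinearMap.mem_ker, hWx]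
    simp only [mul_sub, Finset.sum_sub_distrib, ← Finset.sum_mul]
    rw [Finset.sum_coe_sort L fun x => w x * f x, Finset.sum_coe_sort L w, hw1, ← hm]
    ring
  obtain ⟨h, hh⟩ := hmem
  have hco : ∀ x : L, Function.extend Subtype.val h 0 (x : CHat) = h x :=
    Subtype.val_injective.extend_apply _ _
  refine ⟨Function.extend Subtype.val h 0, fun x hx => ?_⟩
  have := congrFun hh ⟨x, hx⟩
  rw [hTx] at this
  rw [hco ⟨x, hx⟩, ← Finset.sum_coe_sort L fun y => trans τ x y * _]
  simp only [hco]
  linarith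

end IsFinMin

/-! ### The canonical measure and the Lyapunov exponent of a finite minimal set -/

namespace IsFinMin

variable {τ : ProbabilityMeasure Rat} {L : Finset CHat}

theorem transOp_apply (hL : IsFinMin τ L) (φ : C(CHat, ℂ)) {x : CHat} (hx : x ∈ L) :
    transOp τ φ x = ∑ y ∈ L, trans τ x y • φ y :=
  hL.integral_eval hx φ

theorem exists_isErgodic (hL : IsFinMin τ L) :
    ∃ ω : ProbabilityMeasure CHat, IsErgodic τ ω ∧ (ω : Measure CHat) L = 1 := by
  classical
  obtain ⟨v, hv0, hv1, hv⟩ := hL.exists_stationary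
  have hvpos : ∀ x ∈ L, 0 < v x := by
    refine hL.forall_of_invariant ?_ ?_
    · by_contra! hc
      have : ∑ x ∈ L, v x ≤ 0 := Finset.sum_nonpos hc
      linarith
    · intro g hg x hx hp
      rw [← hv (g x) (hL.mapsTo g hg x hx)]
      exact Finset.sum_pos' (fun y hy => mul_nonneg (hv0 y hy) (trans_nonneg τ y _))
        ⟨x, hx, mul_pos hp (hL.trans_pos hx hg)⟩
  set μ : Measure CHat := ∑ x ∈ L, ENNReal.ofReal (v x) • Measure.dirac x with hμ
  have hμa : ∀ A, MeasurableSet A →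
      μ A = ∑ x ∈ L, ENNReal.ofReal (v x) * A.indicator 1 x := by
    intro A hA
    rw [hμ, Measure.finsetSum_apply]
    exact Finset.sum_congr rfl fun x _ => by
      rw [Measure.smul_apply, Measure.dirac_apply' _ hA, smul_eq_mul]
  have hsum : ∑ x ∈ L, ENNReal.ofReal (v x) = 1 := by
    rw [← ENNReal.ofReal_sum_of_nonneg hv0, hv1, ENNReal.ofReal_one]
  have hfull : ∀ A, MeasurableSet A → (∀ x ∈ L, x ∈ A) → μ A = 1 := by
    intro A hA h
    rw [hμa A hA, ← hsum]
    exact Finset.sum_congr rfl fun x hx => by simp [h x hx]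
  have hprob : IsProbabilityMeasure μ := ⟨hfull _ MeasurableSet.univ fun _ _ => Set.mem_univ _⟩
  have hInt : ∀ φ : CHat → ℂ, ∫ z, φ z ∂μ = ∑ x ∈ L, v x • φ x := by
    intro φ
    rw [hμ, integral_finsetSum_measure]
    · refine Finset.sum_congr rfl fun x hx => ?_
      rw [integral_smul_measure, integral_dirac, ENNReal.toReal_ofReal (hv0 x hx)]
    · intro x _
      exact (integrable_dirac (by simp)).smul_measure ENNReal.ofReal_ne_top
  refine ⟨⟨μ, hprob⟩, ⟨fun φ => ?_, fun A hA hApos hAinv => ?_⟩,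
    hfull _ L.finite_toSet.measurableSet fun x hx => hx⟩
  · rw [ProbabilityMeasure.coe_mk, hInt, hInt]
    calc ∑ x ∈ L, v x • transOp τ φ x = ∑ x ∈ L, v x • ∑ y ∈ L, trans τ x y • φ y :=
          Finset.sum_congr rfl fun x hx => by rw [hL.transOp_apply φ hx]
      _ = ∑ y ∈ L, ∑ x ∈ L, (v x * trans τ x y) • φ y := by
          simp only [Finset.smul_sum, smul_smul]
          exact Finset.sum_comm
      _ = _ := Finset.sum_congr rfl fun y hy => by rw [← Finset.sum_smul, hv y hy]
  · rw [ProbabilityMeasure.coe_mk] at hApos hAinv ⊢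
    -- Every point of `L` is an atom, so the almost everywhere identity holds at each of them.
    have hae : ∀ x ∈ L, (τ : Measure Rat) {g | g x ∈ A} = A.indicator 1 x := by
      intro x hx
      by_contra hne
      have h1 : μ {x} ≤ μ {z | ¬ (τ : Measure Rat) {g | g z ∈ A} = A.indicator 1 z} :=
        measure_mono (Set.singleton_subset_iff.2 hne)
      rw [ae_iff.1 hAinv, hμa _ (measurableSet_singleton x)] at h1
      have h2 := (Finset.sum_eq_zero_iff.1 (le_antisymm h1 bot_le)) x hx
      simp [(hvpos x hx).not_ge] at h2
    refine hfull A hA (hL.forall_of_invariant ?_ fun g hg x hx hxA => ?_)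
    · by_contra! hc
      rw [hμa A hA, Finset.sum_eq_zero fun x hx => by simp [hc x hx]] at hApos
      exact lt_irrefl _ hApos
    · have h1 := hae x hx
      rw [Set.indicator_of_mem hxA, Pi.one_apply] at h1
      by_contra hgA
      have hm : MeasurableSet {k : Rat | k x ∈ A} := (Rat.continuous_eval x).measurable hA
      have h2 : (τ : Measure Rat) {k | k x ∈ A}ᶜ = 0 := (prob_compl_eq_zero_iff hm).2 h1
      have h3 : (τ : Measure Rat) {k | k x = g x} ≤ 0 := by
        rw [← h2]
        refine measure_mono fun k hk => ?_
        intro hkA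
        rw [Set.mem_ofPred_eq] at hk hkA
        exact hgA (hk ▸ hkA)
      exact absurd h3 (not_le.2 (hL.measure_eval_eq_pos hx hg))

/-- Existence alone gives the chosen measure its defining property; uniqueness plays no role. -/
theorem canonicalMeas_spec (hL : IsFinMin τ L) :
    IsErgodic τ (canonicalMeas τ L) ∧ (canonicalMeas τ L : Measure CHat) L = 1 := by
  have := Classical.epsilon_spec hL.exists_isErgodic
  exact this

/-- The weights of the canonical measure. -/
def weight (τ : ProbabilityMeasure Rat) (L : Finset CHat) (x : CHat) : ℝ :=
  (canonicalMeas τ L : Measure CHat).real {x}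

theorem ae_mem_canonicalMeas (hL : IsFinMin τ L) :
    ∀ᵐ z ∂(canonicalMeas τ L : Measure CHat), z ∈ (L : Set CHat) :=
  mem_ae_iff.2 ((prob_compl_eq_zero_iff L.finite_toSet.measurableSet).2 hL.canonicalMeas_spec.2)

theorem sum_weight (hL : IsFinMin τ L) : ∑ x ∈ L, weight τ L x = 1 := by
  have h := sum_measure_singleton (μ := (canonicalMeas τ L : Measure CHat)) (s := L)
  rw [hL.canonicalMeas_spec.2] at h
  have h2 := congrArg ENNReal.toReal h
  rw [ENNReal.toReal_sum fun x _ => measure_ne_top _ _] at h2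
  rwa [ENNReal.toReal_one] at h2

theorem integral_canonicalMeas (hL : IsFinMin τ L) (φ : C(CHat, ℂ)) :
    ∫ z, φ z ∂(canonicalMeas τ L : Measure CHat) = ∑ x ∈ L, weight τ L x • φ x := by
  conv_lhs => rw [← Measure.restrict_eq_self_of_ae_mem hL.ae_mem_canonicalMeas]
  exact setIntegral_finset L (Integrable.integrableOn
    (Integrable.of_bound φ.continuous.measurable.aestronglyMeasurable ‖φ‖
      (Eventually.of_forall fun z => φ.norm_coe_le_norm z)))

/-- Invariance is tested on a Urysohn function that restricts to the indicator of `y` on `L`. -/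
theorem weight_stationary (hL : IsFinMin τ L) {y : CHat} (hy : y ∈ L) :
    ∑ x ∈ L, weight τ L x * trans τ x y = weight τ L y := by
  classical
  obtain ⟨f, hf0, hf1, -⟩ := exists_continuous_zero_one_of_isClosed
    (s := ((L.erase y : Finset CHat) : Set CHat)) (t := {y})
    (L.erase y).finite_toSet.isClosed isClosed_singleton (by simp)
  set φ : C(CHat, ℂ) := ⟨fun z => (f z : ℂ), by fun_prop⟩ with hφ
  have hφx : ∀ x ∈ L, φ x = if x = y then 1 else 0 := by
    intro x hx
    split_ifs with h
    · have := hf1 (Set.mem_singleton_iff.2 h)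
      simp [hφ, this]
    · have := hf0 (Finset.mem_coe.2 (Finset.mem_erase.2 ⟨h, hx⟩))
      simp [hφ, this]
  have h1 := hL.canonicalMeas_spec.1.1 φ
  rw [hL.integral_canonicalMeas, hL.integral_canonicalMeas] at h1
  have h2 : ∀ x ∈ L, transOp τ φ x = (trans τ x y : ℂ) := by
    intro x hx
    rw [hL.transOp_apply φ hx, Finset.sum_congr rfl fun z hz => by rw [hφx z hz]]
    simp [hy]
  have h4 : ∑ x ∈ L, weight τ L x • φ x = (weight τ L y : ℂ) := by
    rw [Finset.sum_congr rfl fun x hx => by rw [hφx x hx]]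
    simp [hy]
  rw [h4, Finset.sum_congr rfl fun x hx => by rw [h2 x hx]] at h1
  have h3 : ((∑ x ∈ L, weight τ L x * trans τ x y : ℝ) : ℂ) = (weight τ L y : ℂ) := by
    rw [← h1]
    push_cast
    exact Finset.sum_congr rfl fun x _ => by simp
  exact_mod_cast h3

theorem canonicalMeas_eq_sum (hL : IsFinMin τ L) : (canonicalMeas τ L : Measure CHat) =
    Measure.sum fun x : L => (canonicalMeas τ L : Measure CHat) {(x : CHat)} •
      Measure.dirac (x : CHat) := by
  classical
  set ρ : Measure CHat := (canonicalMeas τ L : Measure CHat) with hρ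
  ext s hs
  have h1 : ρ s = ρ (L.filter (· ∈ s) : Finset CHat) := by
    refine measure_congr ?_
    filter_upwards [hL.ae_mem_canonicalMeas] with z hz
    refine propext ⟨fun h => ?_, fun h => ?_⟩
    · exact Finset.mem_coe.2 (Finset.mem_filter.2 ⟨hz, h⟩)
    · exact (Finset.mem_filter.1 (Finset.mem_coe.1 h)).2
  rw [h1, ← sum_measure_singleton, Measure.sum_apply _ hs, tsum_fintype, Finset.sum_filter,
    ← Finset.sum_coe_sort]
  refine Finset.sum_congr rfl fun x _ => ?_
  rw [Measure.smul_apply, Measure.dirac_apply' _ hs, smul_eq_mul, Set.indicator_apply]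
  simp

theorem lintegral_prod_canonicalMeas (hL : IsFinMin τ L) {H : Rat → CHat → ENNReal}
    (hH : ∀ x ∈ L, AEMeasurable (fun g => H g x) (τ : Measure Rat)) :
    ∫⁻ q, H (q.1 0) q.2 ∂((prodMeas τ).prod (canonicalMeas τ L : Measure CHat)) =
      ∑ x ∈ L, (canonicalMeas τ L : Measure CHat) {x} * ∫⁻ g, H g x ∂(τ : Measure Rat) := by
  conv_lhs => rw [hL.canonicalMeas_eq_sum]
  rw [Measure.prod_sum_right, lintegral_sum_measure, tsum_fintype,
    ← Finset.sum_coe_sort L fun x => (canonicalMeas τ L : Measure CHat) {x} *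
      ∫⁻ g, H g x ∂(τ : Measure Rat)]
  refine Finset.sum_congr rfl fun x _ => ?_
  -- Transport along an embedding requires no measurability of the integrand, and `H` is controlled
  -- only over points of `L`.
  have he : MeasurableEmbedding fun γ : ℕ → Rat => (γ, (x : CHat)) :=
    MeasurableEmbedding.prodMk_right MeasurableEmbedding.id (x : CHat)
  rw [Measure.prod_smul_right, lintegral_smul_measure, Measure.prod_dirac, he.lintegral_map,
    smul_eq_mul]
  congr 1
  have h1 := Measure.infinitePi_map_eval (fun _ : ℕ => (τ : Measure Rat)) 0
  conv_rhs => rw [← h1]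
  rw [lintegral_map' (by rw [h1]; exact hH x x.2) (measurable_pi_apply 0).aemeasurable]
  rfl

/-! ### The truncated logarithm of the spherical derivative -/

/-- The spherical derivative at `x`, on the support of `τ`. -/
def supNorm (τ : ProbabilityMeasure Rat) (g : Rat) (x : CHat) : ℝ :=
  (supp τ).indicator (fun g : Rat => sphNorm g x) g

theorem supNorm_of_mem {g : Rat} (hg : g ∈ supp τ) (x : CHat) : supNorm τ g x = sphNorm g x :=
  Set.indicator_of_mem hg _

theorem isCompact_fiber (hc : IsCompact (supp τ)) (x b : CHat) :
    IsCompact (supp τ ∩ {g : Rat | g x = b}) :=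
  hc.inter_right (isClosed_eq (Rat.continuous_eval x) continuous_const)

theorem continuousOn_sphNorm_fiber (hc : IsCompact (supp τ)) (x b : CHat) :
    ContinuousOn (fun g : Rat => sphNorm g x) (supp τ ∩ {g : Rat | g x = b}) :=
  continuousOn_sphNorm (isCompact_fiber hc x b) fun _ hg => hg.2

/-- The derivative norm is continuous on each closed set of maps in the support with a prescribed
value at `x`, and finitely many of these sets cover the support. -/
theorem measurable_supNorm (hL : IsFinMin τ L) (hc : IsCompact (supp τ)) {x : CHat} (hx : x ∈ L) :
    Measurable fun g => supNorm τ g x := by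
  classical
  have h1 : (fun g => supNorm τ g x) = fun g => ∑ b ∈ L,
      (supp τ ∩ {g : Rat | g x = b}).piecewise (fun g : Rat => sphNorm g x) (fun _ => 0) g := by
    funext g
    by_cases hg : g ∈ supp τ
    · rw [supNorm_of_mem hg, Finset.sum_eq_single_of_mem (g x) (hL.mapsTo g hg x hx)]
      · have hmem : g ∈ supp τ ∩ {k : Rat | k x = g x} := ⟨hg, rfl⟩
        rw [Set.piecewise_eq_of_mem _ _ _ hmem]
      · intro b _ hb
        exact Set.piecewise_eq_of_notMem _ _ _ fun h => hb h.2.symm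
    · rw [supNorm, Set.indicator_of_notMem hg]
      exact (Finset.sum_eq_zero fun b _ =>
        Set.piecewise_eq_of_notMem _ _ _ fun h => hg h.1).symm
  rw [h1]
  exact Finset.measurable_sum _ fun b _ => (continuousOn_sphNorm_fiber hc x b).measurable_piecewise
    continuousOn_const (isCompact_fiber hc x b).isClosed.measurableSet

theorem exists_sphNorm_le (hL : IsFinMin τ L) (hc : IsCompact (supp τ)) :
    ∃ C, 1 ≤ C ∧ ∀ x ∈ L, ∀ g, supNorm τ g x ≤ C := by
  have h1 : ∀ x b, ∃ C, ∀ g ∈ supp τ ∩ {g : Rat | g x = b}, sphNorm g x ≤ C := by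
    intro x b
    obtain ⟨C, hC⟩ := (isCompact_fiber hc x b).bddAbove_image (continuousOn_sphNorm_fiber hc x b)
    exact ⟨C, fun g hg => hC ⟨g, hg, rfl⟩⟩
  choose C hC using h1
  refine ⟨1 + ∑ x ∈ L, ∑ b ∈ L, |C x b|, ?_, fun x hx g => ?_⟩
  · have : 0 ≤ ∑ x ∈ L, ∑ b ∈ L, |C x b| := by positivity
    linarith
  · by_cases hg : g ∈ supp τ
    · rw [supNorm_of_mem hg]
      have hb := hL.mapsTo g hg x hx
      have h2 := hC x (g x) g ⟨hg, rfl⟩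
      have h3 : |C x (g x)| ≤ ∑ b ∈ L, |C x b| :=
        Finset.single_le_sum (f := fun b => |C x b|) (fun b _ => abs_nonneg _) hb
      have h4 : ∑ b ∈ L, |C x b| ≤ ∑ x ∈ L, ∑ b ∈ L, |C x b| :=
        Finset.single_le_sum (f := fun x => ∑ b ∈ L, |C x b|)
          (fun x _ => by positivity) hx
      have := le_abs_self (C x (g x))
      linarith
    · rw [supNorm, Set.indicator_of_notMem hg]
      positivity

/-- `log ‖D g_x‖_s`, truncated from below at `-M`. -/
def logTrunc (τ : ProbabilityMeasure Rat) (M : ℕ) (g : Rat) (x : CHat) : ℝ :=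
  Real.log (max (supNorm τ g x) (Real.exp (-M)))

theorem measurable_logTrunc (hL : IsFinMin τ L) (hc : IsCompact (supp τ)) (M : ℕ) {x : CHat}
    (hx : x ∈ L) : Measurable fun g => logTrunc τ M g x :=
  Real.measurable_log.comp ((hL.measurable_supNorm hc hx).max measurable_const)

theorem exists_logTrunc_le (hL : IsFinMin τ L) (hc : IsCompact (supp τ)) (M : ℕ) :
    ∃ C, ∀ x ∈ L, ∀ g, |logTrunc τ M g x| ≤ C := by
  obtain ⟨C, hC1, hC⟩ := hL.exists_sphNorm_le hc
  refine ⟨max (Real.log C) M, fun x hx g => abs_le.2 ⟨?_, ?_⟩⟩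
  · have h1 : Real.log (Real.exp (-M)) ≤ logTrunc τ M g x :=
      Real.log_le_log (Real.exp_pos _) (le_max_right _ _)
    rw [Real.log_exp] at h1
    have := le_max_right (Real.log C) (M : ℝ)
    linarith
  · have hM : Real.exp (-(M : ℝ)) ≤ 1 := Real.exp_le_one_iff.2 (by simp)
    exact (Real.log_le_log (lt_max_of_lt_right (Real.exp_pos _))
      (max_le (hC x hx g) (hM.trans hC1))).trans (le_max_left _ _)

theorem integrable_logTrunc (hL : IsFinMin τ L) (hc : IsCompact (supp τ)) (M : ℕ) {x : CHat}
    (hx : x ∈ L) : Integrable (fun g => logTrunc τ M g x) (τ : Measure Rat) := by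
  obtain ⟨C, hC⟩ := hL.exists_logTrunc_le hc M
  exact Integrable.of_bound (hL.measurable_logTrunc hc M hx).aestronglyMeasurable C
    (Eventually.of_forall fun g => hC x hx g)

/-- The truncation level `exp (-M)` is at most `1`, so only the negative part of the logarithm is
affected. -/
theorem toENNReal_log_eq (M : ℕ) (g : Rat) (x : CHat) :
    (ENNReal.log (ENNReal.ofReal (supNorm τ g x))).toENNReal =
      ENNReal.ofReal (logTrunc τ M g x) := by
  have hM : Real.exp (-(M : ℝ)) ≤ 1 := Real.exp_le_one_iff.2 (by simp)
  rw [ENNReal.log_ofReal, logTrunc]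
  split_ifs with h
  · rw [max_eq_right (h.trans (Real.exp_pos _).le), Real.log_exp, EReal.toENNReal_bot]
    exact (ENNReal.ofReal_of_nonpos (by simp)).symm
  · rw [EReal.real_coe_toENNReal]
    rcases le_total (Real.exp (-(M : ℝ))) (supNorm τ g x) with h1 | h1
    · rw [max_eq_left h1]
    · rw [max_eq_right h1, ENNReal.ofReal_of_nonpos, ENNReal.ofReal_of_nonpos]
      · rw [Real.log_exp]; simp
      · exact Real.log_nonpos (not_le.1 h).le (h1.trans hM)

theorem ofReal_neg_logTrunc_le (M : ℕ) (g : Rat) (x : CHat) :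
    ENNReal.ofReal (-logTrunc τ M g x) ≤
      (-ENNReal.log (ENNReal.ofReal (supNorm τ g x))).toENNReal := by
  rw [ENNReal.log_ofReal]
  split_ifs with h
  · simp
  · rw [← EReal.coe_neg, EReal.real_coe_toENNReal]
    refine ENNReal.ofReal_le_ofReal (neg_le_neg ?_)
    exact Real.log_le_log (not_le.1 h) (le_max_left _ _)

theorem monotone_ofReal_neg_logTrunc (g : Rat) (x : CHat) :
    Monotone fun M => ENNReal.ofReal (-logTrunc τ M g x) := by
  intro M N hMN
  refine ENNReal.ofReal_le_ofReal (neg_le_neg ?_)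
  refine Real.log_le_log (lt_max_of_lt_right (Real.exp_pos _)) (max_le_max le_rfl ?_)
  refine Real.exp_le_exp.2 (neg_le_neg ?_)
  exact_mod_cast hMN

theorem tendsto_ofReal_neg_logTrunc (g : Rat) (x : CHat) :
    Tendsto (fun M => ENNReal.ofReal (-logTrunc τ M g x)) atTop
      (𝓝 (-ENNReal.log (ENNReal.ofReal (supNorm τ g x))).toENNReal) := by
  rw [ENNReal.log_ofReal]
  split_ifs with h
  · have : ∀ M : ℕ, ENNReal.ofReal (-logTrunc τ M g x) = M := by
      intro M
      rw [logTrunc, max_eq_right (h.trans (Real.exp_pos _).le), Real.log_exp, neg_neg,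
        ENNReal.ofReal_natCast]
    simp only [this, EReal.neg_bot, EReal.toENNReal_top]
    exact ENNReal.tendsto_nat_nhds_top
  · rw [← EReal.coe_neg, EReal.real_coe_toENNReal]
    have hpos := not_le.1 h
    refine tendsto_const_nhds.congr' ?_
    obtain ⟨N, hN⟩ := exists_nat_ge (-Real.log (supNorm τ g x))
    filter_upwards [eventually_ge_atTop N] with M hM
    have h1 : Real.exp (-(M : ℝ)) ≤ supNorm τ g x := by
      rw [← Real.exp_log hpos]
      refine Real.exp_le_exp.2 ?_
      have : (N : ℝ) ≤ M := by exact_mod_cast hM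
      linarith
    rw [logTrunc, max_eq_left h1]

theorem χ_eq (hL : IsFinMin τ L) (hc : IsCompact (supp τ)) : χ τ L =
    ((∑ x ∈ L, (canonicalMeas τ L : Measure CHat) {x} *
      ∫⁻ g, (ENNReal.log (ENNReal.ofReal (supNorm τ g x))).toENNReal ∂(τ : Measure Rat) :
        ENNReal) : EReal) -
    ((∑ x ∈ L, (canonicalMeas τ L : Measure CHat) {x} *
      ∫⁻ g, (-ENNReal.log (ENNReal.ofReal (supNorm τ g x))).toENNReal ∂(τ : Measure Rat) :
        ENNReal) : EReal) := by
  have hlog : ∀ x ∈ L, Measurable fun g => ENNReal.log (ENNReal.ofReal (supNorm τ g x)) :=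
    fun x hx => (hL.measurable_supNorm hc hx).ennreal_ofReal.ennreal_log
  have hae : ∀ x, (fun g : Rat => sphNorm g x) =ᵐ[(τ : Measure Rat)] fun g => supNorm τ g x := by
    intro x
    filter_upwards [ae_mem_supp τ] with g hg
    rw [supNorm_of_mem hg]
  have key : ∀ k : EReal → ENNReal, Measurable k →
      ∫⁻ q : (ℕ → Rat) × CHat, k (ENNReal.log (ENNReal.ofReal (sphNorm (q.1 0) q.2)))
        ∂((prodMeas τ).prod (canonicalMeas τ L : Measure CHat)) =
      ∑ x ∈ L, (canonicalMeas τ L : Measure CHat) {x} *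
        ∫⁻ g, k (ENNReal.log (ENNReal.ofReal (supNorm τ g x))) ∂(τ : Measure Rat) := by
    intro k hk
    rw [hL.lintegral_prod_canonicalMeas
      (H := fun g z => k (ENNReal.log (ENNReal.ofReal (sphNorm g z))))]
    · refine Finset.sum_congr rfl fun x _ => ?_
      congr 1
      refine lintegral_congr_ae ?_
      filter_upwards [hae x] with g hg
      rw [hg]
    · intro x hx
      refine (hk.comp (hlog x hx)).aemeasurable.congr ?_
      filter_upwards [hae x] with g hg
      simp only [Function.comp]
      rw [hg]
  have hneg := key (fun t => (-t).toENNReal) (measurable_ereal_toENNReal.comp measurable_neg)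
  rw [χ, lyapMeas, eintegral, key _ measurable_ereal_toENNReal, hneg]

theorem sum_integral_logTrunc (hL : IsFinMin τ L) (hc : IsCompact (supp τ)) (M : ℕ) :
    (∑ x ∈ L, (canonicalMeas τ L : Measure CHat) {x} *
      ∫⁻ g, ENNReal.ofReal (logTrunc τ M g x) ∂(τ : Measure Rat)) ≠ ⊤ ∧
    (∑ x ∈ L, (canonicalMeas τ L : Measure CHat) {x} *
      ∫⁻ g, ENNReal.ofReal (-logTrunc τ M g x) ∂(τ : Measure Rat)) ≠ ⊤ ∧
    ∑ x ∈ L, weight τ L x * ∫ g, logTrunc τ M g x ∂(τ : Measure Rat) =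
    (∑ x ∈ L, (canonicalMeas τ L : Measure CHat) {x} *
      ∫⁻ g, ENNReal.ofReal (logTrunc τ M g x) ∂(τ : Measure Rat)).toReal -
    (∑ x ∈ L, (canonicalMeas τ L : Measure CHat) {x} *
      ∫⁻ g, ENNReal.ofReal (-logTrunc τ M g x) ∂(τ : Measure Rat)).toReal := by
  have h1 : ∀ x ∈ L, (canonicalMeas τ L : Measure CHat) {x} *
      ∫⁻ g, ENNReal.ofReal (logTrunc τ M g x) ∂(τ : Measure Rat) ≠ ⊤ := fun x hx =>
    ENNReal.mul_ne_top (measure_ne_top _ _) (hL.integrable_logTrunc hc M hx).lintegral_lt_top.ne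
  have h2 : ∀ x ∈ L, (canonicalMeas τ L : Measure CHat) {x} *
      ∫⁻ g, ENNReal.ofReal (-logTrunc τ M g x) ∂(τ : Measure Rat) ≠ ⊤ := fun x hx =>
    ENNReal.mul_ne_top (measure_ne_top _ _)
      (hL.integrable_logTrunc hc M hx).neg.lintegral_lt_top.ne
  refine ⟨ENNReal.sum_ne_top.2 h1, ENNReal.sum_ne_top.2 h2, ?_⟩
  rw [ENNReal.toReal_sum h1, ENNReal.toReal_sum h2, ← Finset.sum_sub_distrib]
  refine Finset.sum_congr rfl fun x hx => ?_
  rw [integral_eq_lintegral_pos_part_sub_lintegral_neg_part (hL.integrable_logTrunc hc M hx),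
    ENNReal.toReal_mul, ENNReal.toReal_mul, mul_sub]
  rfl

/-- Truncating from below keeps the positive part and can only shrink the negative one. -/
theorem sum_integral_pos_of_χ_pos (hL : IsFinMin τ L) (hc : IsCompact (supp τ)) (h : 0 < χ τ L)
    (M : ℕ) : 0 < ∑ x ∈ L, weight τ L x * ∫ g, logTrunc τ M g x ∂(τ : Measure Rat) := by
  obtain ⟨hA, hB, he⟩ := hL.sum_integral_logTrunc hc M
  rw [he, sub_pos]
  rw [hL.χ_eq hc, EReal.sub_pos, EReal.coe_ennreal_lt_coe_ennreal_iff] at h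
  simp only [toENNReal_log_eq M] at h
  refine (ENNReal.toReal_lt_toReal hB hA).2 (lt_of_le_of_lt ?_ h)
  refine Finset.sum_le_sum fun x _ => ?_
  gcongr with g
  exact ofReal_neg_logTrunc_le M g x

/-- By monotone convergence the truncated negative parts increase to the full one, even when that is
infinite, so they eventually exceed the finite positive part. -/
theorem exists_sum_integral_neg_of_χ_neg (hL : IsFinMin τ L) (hc : IsCompact (supp τ))
    (h : χ τ L < 0) :
    ∃ M, ∑ x ∈ L, weight τ L x * ∫ g, logTrunc τ M g x ∂(τ : Measure Rat) < 0 := by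
  have hA0 := (hL.sum_integral_logTrunc hc 0).1
  rw [hL.χ_eq hc] at h
  simp only [toENNReal_log_eq 0] at h
  rw [EReal.sub_neg (Or.inl (by simpa using hA0)) (Or.inl (by simp)),
    EReal.coe_ennreal_lt_coe_ennreal_iff] at h
  have htend : Tendsto (fun M => ∑ x ∈ L, (canonicalMeas τ L : Measure CHat) {x} *
      ∫⁻ g, ENNReal.ofReal (-logTrunc τ M g x) ∂(τ : Measure Rat)) atTop
      (𝓝 (∑ x ∈ L, (canonicalMeas τ L : Measure CHat) {x} *
      ∫⁻ g, (-ENNReal.log (ENNReal.ofReal (supNorm τ g x))).toENNReal ∂(τ : Measure Rat))) := by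
    refine tendsto_finsetSum _ fun x hx => ENNReal.Tendsto.const_mul ?_
      (Or.inr (measure_ne_top _ _))
    exact lintegral_tendsto_of_tendsto_of_monotone
      (fun M => (hL.measurable_logTrunc hc M hx).neg.ennreal_ofReal.aemeasurable)
      (Eventually.of_forall fun g => monotone_ofReal_neg_logTrunc g x)
      (Eventually.of_forall fun g => tendsto_ofReal_neg_logTrunc g x)
  obtain ⟨M, hM⟩ := (htend.eventually (lt_mem_nhds h)).exists
  refine ⟨M, ?_⟩
  obtain ⟨hA, hB, he⟩ := hL.sum_integral_logTrunc hc M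
  rw [he, sub_neg]
  refine (ENNReal.toReal_lt_toReal hA hB).2 ?_
  simpa only [← toENNReal_log_eq] using hM

end IsFinMin

/-! ### Additive functionals of the chain with negative mean -/

namespace IsFinMin

variable {τ : ProbabilityMeasure Rat} {L : Finset CHat}

/-- From `exp t ≤ 1 + t + t ^ 2` for `|t| ≤ 1`, integrated. -/
theorem lintegral_exp_le {μ : Measure Rat} [IsProbabilityMeasure μ] {θ : Rat → ℝ}
    (hθ : Measurable θ) {K m s : ℝ} (hK : ∀ g, |θ g| ≤ K) (hm : ∫ g, θ g ∂μ = m) (hs : 0 ≤ s)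
    (hsK : s * K ≤ 1) :
    ∫⁻ g, ENNReal.ofReal (Real.exp (s * θ g)) ∂μ ≤ ENNReal.ofReal (1 + s * m + (s * K) ^ 2) := by
  have hInt : Integrable θ μ :=
    Integrable.of_bound hθ.aestronglyMeasurable K (Eventually.of_forall hK)
  have hsθ : ∀ g, |s * θ g| ≤ s * K := fun g => by
    rw [abs_mul, abs_of_nonneg hs]
    exact mul_le_mul_of_nonneg_left (hK g) hs
  have hexp : ∀ g, Real.exp (s * θ g) ≤ 1 + s * θ g + (s * K) ^ 2 := fun g => by
    have h1 := Real.abs_exp_sub_one_sub_id_le ((hsθ g).trans hsK)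
    have h2 := (abs_le.1 h1).2
    have h3 : (s * θ g) ^ 2 ≤ (s * K) ^ 2 := sq_le_sq' (abs_le.1 (hsθ g)).1 (abs_le.1 (hsθ g)).2
    linarith
  have hInt1 : Integrable (fun g => 1 + s * θ g) μ := (integrable_const _).add (hInt.const_mul s)
  have hInt2 : Integrable (fun g => 1 + s * θ g + (s * K) ^ 2) μ := hInt1.add (integrable_const _)
  calc _ ≤ ∫⁻ g, ENNReal.ofReal (1 + s * θ g + (s * K) ^ 2) ∂μ :=
        lintegral_mono fun g => ENNReal.ofReal_le_ofReal (hexp g)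
    _ = ENNReal.ofReal (∫ g, (1 + s * θ g + (s * K) ^ 2) ∂μ) :=
        (ofReal_integral_eq_lintegral_ofReal hInt2
          (Eventually.of_forall fun g => (Real.exp_pos _).le.trans (hexp g))).symm
    _ = _ := by
        rw [integral_add hInt1 (integrable_const _),
          integral_add (integrable_const _) (hInt.const_mul s), integral_const_mul, hm]
        simp

/-- With `h` solving the Poisson equation, `θ = ψ + h ∘ g - h` has conditional mean `m < 0` at every
state of `L`. Conditioning on the first step therefore gives exponential moments of its sums at most
`ρ ^ n` with `ρ < 1`. Their summability forces the sums to `-∞`, and the coboundary changes them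
only by a bounded amount. -/
theorem ae_tendsto_atBot (hL : IsFinMin τ L) {ψ : Rat → CHat → ℝ}
    (hψ : ∀ x ∈ L, Measurable fun g => ψ g x) {C : ℝ} (hC : ∀ x ∈ L, ∀ g, |ψ g x| ≤ C)
    (hneg : ∑ x ∈ L, weight τ L x * ∫ g, ψ g x ∂(τ : Measure Rat) < 0) {x : CHat} (hx : x ∈ L) :
    ∀ᵐ γ ∂(prodMeas τ),
      Tendsto (fun n => ∑ k ∈ Finset.range n, ψ (γ k) (comps γ k x)) atTop atBot := by
  classical
  obtain ⟨h, hh⟩ := hL.exists_poisson hL.sum_weight (fun y hy => hL.weight_stationary hy)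
    fun x => ∫ g, ψ g x ∂(τ : Measure Rat)
  set m := ∑ x ∈ L, weight τ L x * ∫ g, ψ g x ∂(τ : Measure Rat) with hmdef
  -- Cutting `h` off outside `L` makes it bounded and Borel; `θ` below is cut off likewise.
  set h' : CHat → ℝ := fun z => ∑ y ∈ L, if z = y then h y else 0 with hh'
  have hh'L : ∀ z ∈ L, h' z = h z := fun z hz => by simp [hh', hz]
  set B : ℝ := ∑ y ∈ L, |h y| with hB
  have hB0 : 0 ≤ B := by positivity
  have hh'B : ∀ z, |h' z| ≤ B := fun z => by
    refine (Finset.abs_sum_le_sum_abs _ _).trans (Finset.sum_le_sum fun y _ => ?_)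
    split_ifs <;> simp
  have hh'm : Measurable h' := Finset.measurable_sum _ fun y _ =>
    Measurable.ite (measurableSet_singleton y) measurable_const measurable_const
  have hC0 : 0 ≤ C := by
    obtain ⟨g, -⟩ := (ae_mem_supp τ).exists
    exact (abs_nonneg _).trans (hC x hx g)
  set θ : Rat → CHat → ℝ := fun g z => ∑ y ∈ L, if z = y then ψ g y + h' (g y) - h' y else 0
    with hθ
  have hθL : ∀ g, ∀ z ∈ L, θ g z = ψ g z + h' (g z) - h' z := fun g z hz => by simp [hθ, hz]
  have hsec : ∀ y ∈ L, Measurable fun g : Rat => ψ g y + h' (g y) - h' y := fun y hy =>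
    ((hψ y hy).add (hh'm.comp (Rat.continuous_eval y).measurable)).sub_const _
  have hθm : Measurable fun q : Rat × CHat => θ q.1 q.2 := by
    refine Finset.measurable_sum _ fun y hy => Measurable.ite ?_
      ((hsec y hy).comp measurable_fst) measurable_const
    exact measurable_snd (measurableSet_singleton y)
  set K : ℝ := C + 2 * B + 1 with hK
  have hKpos : 0 < K := by positivity
  have hθK : ∀ z ∈ L, ∀ g, |θ g z| ≤ K := fun z hz g => by
    rw [hθL g z hz]
    have h1 := abs_le.1 (hC z hz g)
    have h2 := abs_le.1 (hh'B (g z))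
    have h3 := abs_le.1 (hh'B z)
    rw [abs_le]
    constructor <;> linarith
  have hθz : ∀ z ∈ L, Measurable fun g => θ g z := fun z _ =>
    hθm.comp (measurable_id.prodMk measurable_const)
  have hθint : ∀ z ∈ L, ∫ g, θ g z ∂(τ : Measure Rat) = m := by
    intro z hz
    have hi : Integrable (fun g => ψ g z) (τ : Measure Rat) :=
      Integrable.of_bound (hψ z hz).aestronglyMeasurable C (Eventually.of_forall (hC z hz))
    have h1 : ∫ g : Rat, h' (g z) ∂(τ : Measure Rat) = ∑ y ∈ L, trans τ z y * h y := by
      rw [hL.integral_eval hz]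
      exact Finset.sum_congr rfl fun y hy => by rw [hh'L y hy, smul_eq_mul]
    have hi2 : Integrable (fun g : Rat => ψ g z + h' (g z)) (τ : Measure Rat) :=
      hi.add (hL.integrable_eval hz h')
    simp only [hθL _ z hz]
    rw [integral_sub hi2 (integrable_const _),
      integral_add hi (hL.integrable_eval hz h'), h1, hh'L z hz]
    simpa using hh z hz
  -- With `s ≤ -m / (2 * K ^ 2)` the quadratic term is at most half of `-s * m`.
  obtain ⟨s, hs, hsK, hρ⟩ : ∃ s : ℝ, 0 < s ∧ s * K ≤ 1 ∧ 1 + s * m + (s * K) ^ 2 < 1 := by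
    refine ⟨min (1 / K) (-m / (2 * K ^ 2)), lt_min (by positivity) (div_pos (by linarith)
      (by positivity)), ?_, ?_⟩
    · calc _ ≤ 1 / K * K := mul_le_mul_of_nonneg_right (min_le_left _ _) hKpos.le
        _ = 1 := by field_simp
    · set s := min (1 / K) (-m / (2 * K ^ 2)) with hs
      have hs0 : 0 < s := lt_min (by positivity) (div_pos (by linarith) (by positivity))
      have h1 : s * (2 * K ^ 2) ≤ -m := by
        rw [← le_div_iff₀ (by positivity)]
        exact min_le_right _ _
      nlinarith
  set ρ := ENNReal.ofReal (1 + s * m + (s * K) ^ 2) with hρdef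
  have hρ1 : ρ < 1 := by
    rw [hρdef, ← ENNReal.ofReal_one]
    exact (ENNReal.ofReal_lt_ofReal_iff one_pos).2 hρ
  set E : ℕ → CHat → (ℕ → Rat) → ENNReal := fun n z γ =>
    ENNReal.ofReal (Real.exp (s * ∑ k ∈ Finset.range n, θ (γ k) (comps γ k z))) with hE
  have hEm : ∀ n z, Measurable (E n z) := by
    intro n z
    refine ENNReal.measurable_ofReal.comp (Real.measurable_exp.comp (Measurable.const_mul ?_ s))
    exact Finset.measurable_sum _ fun k _ =>
      hθm.comp ((measurable_pi_apply k).prodMk (measurable_comps_left k z))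
  have hEstep : ∀ n z g γ, E (n + 1) z (consSeq g γ) =
      ENNReal.ofReal (Real.exp (s * θ g z)) * E n (g z) γ := by
    intro n z g γ
    simp only [hE]
    rw [← ENNReal.ofReal_mul (Real.exp_pos _).le, ← Real.exp_add, ← mul_add,
      Finset.sum_range_succ']
    simp only [consSeq_succ, comps_consSeq, consSeq_zero, comps_zero]
    rw [add_comm]
  have hEle : ∀ n, ∀ z ∈ L, ∫⁻ γ, E n z γ ∂(prodMeas τ) ≤ ρ ^ n := by
    intro n
    induction n with
    | zero => intro z _; simp [hE]
    | succ n ih =>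
      intro z hz
      rw [lintegral_prodMeas τ (hEm _ _)]
      simp only [hEstep]
      calc ∫⁻ g : Rat, ∫⁻ γ, ENNReal.ofReal (Real.exp (s * θ g z)) * E n (g z) γ ∂(prodMeas τ)
            ∂(τ : Measure Rat)
          ≤ ∫⁻ g : Rat, ENNReal.ofReal (Real.exp (s * θ g z)) * ρ ^ n ∂(τ : Measure Rat) := by
            refine lintegral_mono_ae ?_
            filter_upwards [hL.ae_eval_mem hz] with g hg
            rw [lintegral_const_mul _ (hEm n _)]
            gcongr
            exact ih _ hg
        _ = (∫⁻ g : Rat, ENNReal.ofReal (Real.exp (s * θ g z)) ∂(τ : Measure Rat)) * ρ ^ n :=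
            lintegral_mul_const _ (ENNReal.measurable_ofReal.comp
              (Real.measurable_exp.comp ((hθz z hz).const_mul s)))
        _ ≤ ρ * ρ ^ n := by
            gcongr
            exact lintegral_exp_le (hθz z hz) (hθK z hz) (hθint z hz) hs.le hsK
        _ = ρ ^ (n + 1) := (pow_succ' ρ n).symm
  -- Finite expectation of the series makes it converge almost surely, so its terms tend to `0`.
  have hsum : ∫⁻ γ, ∑' n, E n x γ ∂(prodMeas τ) ≠ ⊤ := by
    rw [lintegral_tsum fun n => (hEm n x).aemeasurable]
    refine ne_top_of_le_ne_top ?_ (ENNReal.tsum_le_tsum fun n => hEle n x hx)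
    rw [ENNReal.tsum_geometric]
    exact ENNReal.inv_ne_top.2 (tsub_pos_iff_lt.2 hρ1).ne'
  filter_upwards [ae_lt_top (Measurable.tsum fun n => hEm n x) hsum, ae_mem_X τ] with γ hγ hγX
  have hlim := ENNReal.tendsto_atTop_zero_of_tsum_ne_top hγ.ne
  have hlim2 : Tendsto (fun n => Real.exp (s * ∑ k ∈ Finset.range n, θ (γ k) (comps γ k x)))
      atTop (𝓝 0) := by
    have h1 := (ENNReal.tendsto_toReal ENNReal.zero_ne_top).comp hlim
    refine h1.congr fun n => ?_
    simp only [Function.comp, hE]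
    exact ENNReal.toReal_ofReal (Real.exp_pos _).le
  rw [Real.tendsto_exp_comp_nhds_zero] at hlim2
  have hlim3 := (tendsto_const_mul_atBot_of_pos hs).1 hlim2
  have hmemL : ∀ k, comps γ k x ∈ L := by
    intro k
    induction k with
    | zero => exact hx
    | succ k ih => exact hL.mapsTo _ (hγX k) _ ih
  have htel : ∀ n, ∑ k ∈ Finset.range n, θ (γ k) (comps γ k x) =
      ∑ k ∈ Finset.range n, ψ (γ k) (comps γ k x) + (h' (comps γ n x) - h' x) := by
    intro n
    have h1 := Finset.sum_range_sub (fun n => h' (comps γ n x)) n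
    rw [comps_zero] at h1
    rw [← h1, ← Finset.sum_add_distrib]
    refine Finset.sum_congr rfl fun k _ => ?_
    rw [hθL _ _ (hmemL k), comps_succ]
    ring
  refine tendsto_atBot_mono (fun n => ?_) (tendsto_atBot_add_const_right _ (2 * B) hlim3)
  rw [htel]
  have h2 := abs_le.1 (hh'B (comps γ n x))
  have h3 := abs_le.1 (hh'B x)
  linarith

end IsFinMin

/-! ### Dynamics near a finite minimal set -/

/-- The positive element `a` serves as the bound when `s` is empty. -/
theorem exists_pos_forall_le {ι α : Type*} [LinearOrder α] [Zero α] (s : Finset ι) (f : ι → α)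
    (hf : ∀ i ∈ s, 0 < f i) {a : α} (ha : 0 < a) : ∃ δ, 0 < δ ∧ ∀ i ∈ s, δ ≤ f i := by
  classical
  induction s using Finset.induction_on with
  | empty => exact ⟨a, ha, by simp⟩
  | insert i s _ ih =>
    obtain ⟨δ, hδ, h⟩ := ih fun j hj => hf j (Finset.mem_insert_of_mem hj)
    refine ⟨min δ (f i), lt_min hδ (hf i (Finset.mem_insert_self i s)), fun j hj => ?_⟩
    rcases Finset.mem_insert.1 hj with rfl | hj
    · exact min_le_right _ _
    · exact (min_le_left _ _).trans (h j hj)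

namespace IsFinMin

variable {τ : ProbabilityMeasure Rat} {L : Finset CHat}

theorem comps_mem (hL : IsFinMin τ L) {γ : ℕ → Rat} (hγ : γ ∈ X τ) {x : CHat} (hx : x ∈ L)
    (n : ℕ) : comps γ n x ∈ L := by
  induction n with
  | zero => exact hx
  | succ n ih => exact hL.mapsTo _ (hγ n) _ ih

/-- The support is split according to the pair `(x, g x)`, which takes finitely many values. -/
theorem exists_uniform_expansion (hL : IsFinMin τ L) (hc : IsCompact (supp τ)) {η : ℝ}
    (hη : 0 < η) : ∃ δ > 0, ∀ g ∈ supp τ, ∀ x ∈ L, ∀ y, dist y x < δ →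
      |dist (g y) (g x) - sphNorm g x * dist y x| ≤ η * dist y x := by
  have h1 : ∀ p : CHat × CHat, ∃ δ > 0, ∀ g ∈ supp τ ∩ {g : Rat | g p.1 = p.2}, ∀ y,
      dist y p.1 < δ → |dist (g y) (g p.1) - sphNorm g p.1 * dist y p.1| ≤ η * dist y p.1 :=
    fun p => exists_sphNorm_expansion (isCompact_fiber hc p.1 p.2) (fun g hg => hg.2) hη
  choose δ hδ h using h1
  obtain ⟨δ₀, hδ₀, hle⟩ := exists_pos_forall_le (L ×ˢ L) δ (fun p _ => hδ p) one_pos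
  refine ⟨δ₀, hδ₀, fun g hg x hx y hy => h (x, g x) g ⟨hg, rfl⟩ y (hy.trans_le (hle (x, g x) ?_))⟩
  exact Finset.mk_mem_product hx (hL.mapsTo g hg x hx)

theorem sum_weight_integral_add (hL : IsFinMin τ L) {f : Rat → CHat → ℝ}
    (hf : ∀ x ∈ L, Integrable (fun g => f g x) (τ : Measure Rat)) (a : ℝ) :
    ∑ x ∈ L, weight τ L x * ∫ g, (f g x + a) ∂(τ : Measure Rat) =
      ∑ x ∈ L, weight τ L x * ∫ g, f g x ∂(τ : Measure Rat) + a := by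
  have : ∀ x ∈ L, weight τ L x * ∫ g, (f g x + a) ∂(τ : Measure Rat) =
      weight τ L x * ∫ g, f g x ∂(τ : Measure Rat) + weight τ L x * a := by
    intro x hx
    rw [integral_add (hf x hx) (integrable_const a)]
    simp [mul_add]
  rw [Finset.sum_congr rfl this, Finset.sum_add_distrib, ← Finset.sum_mul, hL.sum_weight, one_mul]

theorem exists_contraction (hL : IsFinMin τ L) (hc : IsCompact (supp τ)) (hχ : χ τ L < 0) :
    ∃ ψ : Rat → CHat → ℝ, (∀ x ∈ L, ∀ᵐ γ ∂(prodMeas τ),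
      Tendsto (fun n => ∑ k ∈ Finset.range n, ψ (γ k) (comps γ k x)) atTop atBot) ∧
      ∃ δ > 0, ∀ g ∈ supp τ, ∀ x ∈ L, ∀ y, dist y x < δ →
        dist (g y) (g x) ≤ Real.exp (ψ g x) * dist y x := by
  obtain ⟨M, hM⟩ := hL.exists_sum_integral_neg_of_χ_neg hc hχ
  set m := ∑ x ∈ L, weight τ L x * ∫ g, logTrunc τ M g x ∂(τ : Measure Rat) with hm
  -- Adding `ε` to the truncated logarithm leaves the mean `m / 2 < 0`.
  set ε : ℝ := -m / 2 with hε
  have hεpos : 0 < ε := by rw [hε]; linarith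
  obtain ⟨C, hC⟩ := hL.exists_logTrunc_le hc M
  refine ⟨fun g x => logTrunc τ M g x + ε, fun x hx => ?_, ?_⟩
  · refine hL.ae_tendsto_atBot (C := C + ε)
      (fun x hx => (hL.measurable_logTrunc hc M hx).add_const ε) (fun x hx g => ?_) ?_ hx
    · exact (abs_add_le _ _).trans (add_le_add (hC x hx g) (abs_of_pos hεpos).le)
    · rw [hL.sum_weight_integral_add fun x hx => hL.integrable_logTrunc hc M hx, ← hm, hε]
      linarith
  -- The truncated derivative is at least `exp (-M)`, so an error `ε * exp (-M)` fits into the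
  -- factor `1 + ε ≤ exp ε`. Without truncation, critical points would leave no room for it.
  · obtain ⟨δ, hδ, h⟩ := hL.exists_uniform_expansion hc
      (η := ε * Real.exp (-M)) (mul_pos hεpos (Real.exp_pos _))
    refine ⟨δ, hδ, fun g hg x hx y hy => ?_⟩
    have h1 := (abs_le.1 (h g hg x hx y hy)).2
    have h2 : sphNorm g x + ε * Real.exp (-M) ≤ Real.exp (logTrunc τ M g x + ε) := by
      rw [Real.exp_add, logTrunc, Real.exp_log (lt_max_of_lt_right (Real.exp_pos _)),
        supNorm_of_mem hg]
      set k := max (sphNorm g x) (Real.exp (-(M : ℝ))) with hk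
      have hk1 : sphNorm g x ≤ k := le_max_left _ _
      have hk2 : Real.exp (-(M : ℝ)) ≤ k := le_max_right _ _
      have hk0 : 0 < k := lt_max_of_lt_right (Real.exp_pos _)
      have he := Real.add_one_le_exp ε
      nlinarith
    have := mul_le_mul_of_nonneg_right h2 (dist_nonneg (x := y) (y := x))
    linarith

theorem exists_le_sphNorm (hL : IsFinMin τ L) (hc : IsCompact (supp τ))
    (hD : ∀ g ∈ supp τ, ∀ x ∈ L, D g x ≠ 0) : ∃ c > 0, ∀ g ∈ supp τ, ∀ x ∈ L, c ≤ sphNorm g x := by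
  have h1 : ∀ p : CHat × CHat, ∃ c > 0, p.1 ∈ L → ∀ g ∈ supp τ ∩ {g : Rat | g p.1 = p.2},
      c ≤ sphNorm g p.1 := by
    rintro ⟨x, b⟩
    rcases (supp τ ∩ {g : Rat | g x = b}).eq_empty_or_nonempty with he | hne
    · exact ⟨1, one_pos, fun _ g hg => by simp only [he] at hg; exact absurd hg (by simp)⟩
    · obtain ⟨g₀, hg₀, hmin⟩ := (isCompact_fiber hc x b).exists_isMinOn hne
        (continuousOn_sphNorm_fiber hc x b)
      by_cases hx : x ∈ L
      · refine ⟨sphNorm g₀ x, ?_, fun _ g hg => hmin hg⟩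
        rw [sphNorm_eq]
        have := norm_pos_iff.2 (hD g₀ hg₀.1 x hx)
        have := dens_pos x
        have := dens_pos (g₀ x)
        positivity
      · exact ⟨1, one_pos, fun h => absurd h hx⟩
  choose c hc0 h using h1
  obtain ⟨c₀, hc₀, hle⟩ := exists_pos_forall_le (L ×ˢ L) c (fun p _ => hc0 p) one_pos
  exact ⟨c₀, hc₀, fun g hg x hx => (hle (x, g x)
    (Finset.mk_mem_product hx (hL.mapsTo g hg x hx))).trans (h (x, g x) hx g ⟨hg, rfl⟩)⟩

theorem exists_repulsion (hL : IsFinMin τ L) (hc : IsCompact (supp τ)) (hχ : 0 < χ τ L)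
    (hD : ∀ g ∈ supp τ, ∀ x ∈ L, D g x ≠ 0) :
    ∃ ψ : Rat → CHat → ℝ, (∀ x ∈ L, ∀ᵐ γ ∂(prodMeas τ),
      Tendsto (fun n => ∑ k ∈ Finset.range n, ψ (γ k) (comps γ k x)) atTop atBot) ∧
      ∃ δ > 0, ∀ g ∈ supp τ, ∀ x ∈ L, ∀ y, dist y x < δ →
        dist y x ≤ Real.exp (ψ g x) * dist (g y) (g x) := by
  obtain ⟨c, hc0, hcle⟩ := hL.exists_le_sphNorm hc hD
  -- The truncation level lies below the least derivative norm `c`, so on the support nothing is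
  -- truncated.
  obtain ⟨M, hMc⟩ := exists_nat_ge (-Real.log c)
  have hexpM : Real.exp (-(M : ℝ)) ≤ c := by
    rw [← Real.exp_log hc0]
    exact Real.exp_le_exp.2 (by linarith)
  have hM := hL.sum_integral_pos_of_χ_pos hc hχ M
  set m := ∑ x ∈ L, weight τ L x * ∫ g, logTrunc τ M g x ∂(τ : Measure Rat) with hm
  set ε : ℝ := m / 2 with hε
  have hεpos : 0 < ε := by rw [hε]; linarith
  obtain ⟨C, hC⟩ := hL.exists_logTrunc_le hc M
  refine ⟨fun g x => -logTrunc τ M g x + ε, fun x hx => ?_, ?_⟩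
  · refine hL.ae_tendsto_atBot (C := C + ε)
      (ψ := fun g x => -logTrunc τ M g x + ε)
      (fun x hx => (hL.measurable_logTrunc hc M hx).neg.add_const ε) (fun x hx g => ?_) ?_ hx
    · refine (abs_add_le _ _).trans (add_le_add ?_ (abs_of_pos hεpos).le)
      exact (abs_neg _).trans_le (hC x hx g)
    · rw [hL.sum_weight_integral_add (f := fun g x => -logTrunc τ M g x)
        fun x hx => (hL.integrable_logTrunc hc M hx).neg]
      simp only [integral_neg, mul_neg, Finset.sum_neg_distrib]
      rw [← hm, hε]
      linarith
  · have he1 : Real.exp (-ε) < 1 := Real.exp_lt_one_iff.2 (by linarith)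
    -- As `c ≤ sphNorm g x`, this error costs at most the factor `exp (-ε)` in the expansion rate.
    obtain ⟨δ, hδ, h⟩ := hL.exists_uniform_expansion hc
      (η := c * (1 - Real.exp (-ε))) (mul_pos hc0 (by linarith))
    refine ⟨δ, hδ, fun g hg x hx y hy => ?_⟩
    have h1 := (abs_le.1 (h g hg x hx y hy)).1
    have hcs := hcle g hg x hx
    have hs0 : 0 < sphNorm g x := hc0.trans_le hcs
    have h2 : Real.exp (-logTrunc τ M g x + ε) = (sphNorm g x * Real.exp (-ε))⁻¹ := by
      rw [Real.exp_add, logTrunc, supNorm_of_mem hg, max_eq_left (hexpM.trans hcs), Real.exp_neg,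
        Real.exp_log hs0, Real.exp_neg, mul_inv, inv_inv]
    rw [h2, inv_mul_eq_div, le_div_iff₀ (by positivity)]
    have h3 : c * (1 - Real.exp (-ε)) * dist y x ≤
        sphNorm g x * (1 - Real.exp (-ε)) * dist y x := by
      have : 0 ≤ 1 - Real.exp (-ε) := by linarith
      gcongr
    linarith

/-- The bound `R` on all partial products keeps the orbit within `δ` of that of `x`, so the one-step
estimate can be iterated. -/
theorem dist_comps_le {ψ : Rat → CHat → ℝ} {δ : ℝ} (hL : IsFinMin τ L)
    (h : ∀ g ∈ supp τ, ∀ x ∈ L, ∀ y, dist y x < δ →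
      dist (g y) (g x) ≤ Real.exp (ψ g x) * dist y x) {γ : ℕ → Rat} (hγ : γ ∈ X τ) {x y : CHat}
    (hx : x ∈ L) {R : ℝ}
    (hR : ∀ n, Real.exp (∑ k ∈ Finset.range n, ψ (γ k) (comps γ k x)) ≤ R)
    (hy : R * dist y x < δ) (n : ℕ) : dist (comps γ n y) (comps γ n x) ≤
      Real.exp (∑ k ∈ Finset.range n, ψ (γ k) (comps γ k x)) * dist y x := by
  induction n with
  | zero => simp
  | succ n ih =>
    have h1 : dist (comps γ n y) (comps γ n x) < δ :=
      (ih.trans (mul_le_mul_of_nonneg_right (hR n) dist_nonneg)).trans_lt hy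
    have h2 := h (γ n) (hγ n) _ (hL.comps_mem hγ hx n) _ h1
    rw [comps_succ, comps_succ, Finset.sum_range_succ, Real.exp_add, mul_comm (Real.exp _),
      mul_assoc]
    exact h2.trans (mul_le_mul_of_nonneg_left ih (Real.exp_pos _).le)

/-- All orbits from the ball approach that of `x` uniformly, which handles late times; the finitely
many early iterates are continuous. -/
theorem mem_FatouSeq_of_contraction {ψ : Rat → CHat → ℝ} {δ : ℝ} (hL : IsFinMin τ L)
    (h : ∀ g ∈ supp τ, ∀ x ∈ L, ∀ y, dist y x < δ →
      dist (g y) (g x) ≤ Real.exp (ψ g x) * dist y x) {γ : ℕ → Rat} (hγ : γ ∈ X τ) {x y : CHat}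
    (hx : x ∈ L) {R r : ℝ}
    (hR : ∀ n, Real.exp (∑ k ∈ Finset.range n, ψ (γ k) (comps γ k x)) ≤ R)
    (hlim : Tendsto (fun n => ∑ k ∈ Finset.range n, ψ (γ k) (comps γ k x)) atTop atBot)
    (hr : R * r < δ) (hy : dist y x < r) : y ∈ FatouSeq γ := by
  have hR0 : 0 ≤ R := (Real.exp_pos _).le.trans (hR 0)
  have hball : ∀ u, dist u x < r → ∀ n, dist (comps γ n u) (comps γ n x) ≤
      Real.exp (∑ k ∈ Finset.range n, ψ (γ k) (comps γ k x)) * r := fun u hu n =>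
    (hL.dist_comps_le h hγ hx hR ((mul_le_mul_of_nonneg_left hu.le hR0).trans_lt hr) n).trans
      (mul_le_mul_of_nonneg_left hu.le (Real.exp_pos _).le)
  have hev : ∀ {u}, dist u x < r → ∀ᶠ w in 𝓝 u, dist w x < r := fun {u} hu =>
    (isOpen_lt (continuous_id.dist continuous_const) continuous_const).mem_nhds hu
  rw [mem_FatouSeq_iff]
  filter_upwards [hev hy] with u hu
  rw [Metric.equicontinuousAt_iff_right]
  intro ε hε
  have hlim2 : Tendsto (fun n => Real.exp (∑ k ∈ Finset.range n, ψ (γ k) (comps γ k x)) * r)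
      atTop (𝓝 0) := by
    simpa using (Real.tendsto_exp_atBot.comp hlim).mul_const r
  obtain ⟨N, hN⟩ := eventually_atTop.1 (hlim2.eventually (gt_mem_nhds (half_pos hε)))
  have hfin : ∀ᶠ w in 𝓝 u, ∀ n ∈ Finset.range N, dist (comps γ n u) (comps γ n w) < ε := by
    rw [Filter.eventually_all_finset]
    intro n _
    have hcont := continuous_const.dist (continuous_comps_right γ n) (f := fun _ => comps γ n u)
    have := hcont.tendsto u
    rw [dist_self] at this
    exact this.eventually (gt_mem_nhds hε)
  filter_upwards [hfin, hev hu] with w hw hwx n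
  by_cases hn : n < N
  · exact hw n (Finset.mem_range.2 hn)
  · have h1 := hball u hu n
    have h2 := hball w hwx n
    have h3 := hN n (not_lt.1 hn)
    have h4 := dist_triangle_right (comps γ n u) (comps γ n w) (comps γ n x)
    linarith

/-- Sums tending to `-∞` are bounded above. For `R` large the bound `R` holds with probability above
`1 - ε`, and on that event the fixed radius `δ / (2 * exp R)` is safe. -/
theorem exists_prodMeas_JuliaSeq_le (hL : IsFinMin τ L) (hc : IsCompact (supp τ))
    (hχ : χ τ L < 0) {ε : ENNReal} (hε : 0 < ε) : ∃ r > 0, ∀ x ∈ L, ∀ y, dist y x < r →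
      prodMeas τ {γ | y ∈ JuliaSeq γ} ≤ ε := by
  obtain ⟨ψ, hψ, δ, hδ, h⟩ := hL.exists_contraction hc hχ
  have key : ∀ x, ∃ r > 0, x ∈ L → ∀ y, dist y x < r →
      prodMeas τ {γ | y ∈ JuliaSeq γ} ≤ ε := by
    intro x
    by_cases hx : x ∈ L
    swap
    · exact ⟨1, one_pos, fun h => absurd h hx⟩
    set B : ℕ → Set (ℕ → Rat) := fun R => {γ | γ ∈ X τ ∧
      Tendsto (fun n => ∑ k ∈ Finset.range n, ψ (γ k) (comps γ k x)) atTop atBot ∧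
      ∀ n, ∑ k ∈ Finset.range n, ψ (γ k) (comps γ k x) ≤ R} with hB
    have hmono : Monotone B := by
      rintro R R' hRR' γ ⟨h1, h2, h3⟩
      refine ⟨h1, h2, fun n => (h3 n).trans ?_⟩
      exact_mod_cast hRR'
    have hfull : prodMeas τ (⋃ R, B R) = 1 := by
      rw [← measure_univ (μ := prodMeas τ)]
      refine measure_congr (eventuallyEq_univ.2 ?_)
      filter_upwards [hψ x hx, ae_mem_X τ] with γ hγ hγX
      obtain ⟨C, hC⟩ := bddAbove_range_of_tendsto_atTop_atBot hγ
      obtain ⟨R, hR⟩ := exists_nat_ge C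
      exact Set.mem_iUnion.2 ⟨R, hγX, hγ, fun n => (hC ⟨n, rfl⟩).trans hR⟩
    have hlt : 1 - ε < ⨆ R, prodMeas τ (B R) := by
      rw [← hmono.measure_iUnion, hfull]
      exact ENNReal.sub_lt_self ENNReal.one_ne_top one_ne_zero hε.ne'
    obtain ⟨R, hR⟩ := lt_iSup_iff.1 hlt
    have he := Real.exp_pos (R : ℝ)
    refine ⟨δ / (2 * Real.exp R), by positivity, fun _ y hy => ?_⟩
    have hsub : B R ⊆ {γ | y ∈ JuliaSeq γ}ᶜ := by
      rintro γ ⟨hγX, hγ, hγR⟩ hJ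
      refine hJ (hL.mem_FatouSeq_of_contraction h hγX hx (R := Real.exp R)
        (fun n => Real.exp_le_exp.2 (hγR n)) hγ ?_ hy)
      have : Real.exp R * (δ / (2 * Real.exp R)) = δ / 2 := by field_simp
      linarith
    have hm : MeasurableSet {γ : ℕ → Rat | y ∈ JuliaSeq γ} :=
      measurableSet_section measurableSet_JuliaSeq y
    have h1 := hR.trans_le (measure_mono hsub)
    rw [prob_compl_eq_one_sub hm] at h1
    by_contra! hlt
    exact absurd (tsub_le_tsub_left hlt.le 1) (not_le.2 h1)
  choose r hr hrr using key
  obtain ⟨r₀, hr₀, hle⟩ := exists_pos_forall_le L r (fun x _ => hr x) one_pos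
  exact ⟨r₀, hr₀, fun x hx y hy => hrr x hx y (hy.trans_le (hle x hx))⟩

/-- Once two orbits stay within `δ`, repulsion bounds their initial distance by `δ` times a factor
tending to `0`, so they coincide. The null set does not depend on `y`, so the result applies to
random points. -/
theorem ae_not_tendsto_of_repulsion (hL : IsFinMin τ L) (hc : IsCompact (supp τ)) (hχ : 0 < χ τ L)
    (hD : ∀ g ∈ supp τ, ∀ x ∈ L, D g x ≠ 0) : ∀ᵐ γ ∂(prodMeas τ), ∀ x ∈ L, ∀ y,
      (∀ n, comps γ n y ∉ L) →
      ¬ Tendsto (fun n => dist (comps γ n y) (comps γ n x)) atTop (𝓝 0) := by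
  obtain ⟨ψ, hψ, δ, hδ, h⟩ := hL.exists_repulsion hc hχ hD
  have hψ' : ∀ᵐ γ ∂(prodMeas τ), ∀ x ∈ L,
      Tendsto (fun n => ∑ k ∈ Finset.range n, ψ (γ k) (comps γ k x)) atTop atBot :=
    (Filter.eventually_all_finset L).2 hψ
  -- The restart time `N` depends on `γ`, so the divergence is needed for all shifts at once.
  filter_upwards [ae_shift hψ', ae_mem_X τ] with γ hγ hγX x hx y hy hlim
  obtain ⟨N, hN⟩ := eventually_atTop.1 (hlim.eventually (gt_mem_nhds hδ))
  set γ' := shift N γ with hγ'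
  set x' := comps γ N x with hx'
  set y' := comps γ N y with hy'
  have hx'L : x' ∈ L := hL.comps_mem hγX hx N
  have hγ'X : γ' ∈ X τ := shift_mem_X hγX N
  have hd : ∀ n, dist (comps γ' n y') (comps γ' n x') < δ := fun n => by
    rw [← comps_add, ← comps_add]
    exact hN _ (by omega)
  have hle : ∀ n, dist y' x' ≤ Real.exp (∑ k ∈ Finset.range n, ψ (γ' k) (comps γ' k x')) *
      dist (comps γ' n y') (comps γ' n x') := by
    intro n
    induction n with
    | zero => simp
    | succ n ih =>
      have h2 := h (γ' n) (hγ'X n) _ (hL.comps_mem hγ'X hx'L n) _ (hd n)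
      rw [comps_succ, comps_succ, Finset.sum_range_succ, Real.exp_add, mul_assoc]
      exact ih.trans (mul_le_mul_of_nonneg_left h2 (Real.exp_pos _).le)
  have hlim2 : Tendsto (fun n =>
      Real.exp (∑ k ∈ Finset.range n, ψ (γ' k) (comps γ' k x')) * δ) atTop (𝓝 0) := by
    simpa using (Real.tendsto_exp_atBot.comp (hγ N x' hx'L)).mul_const δ
  have h0 : dist y' x' ≤ 0 := ge_of_tendsto' hlim2 fun n =>
    (hle n).trans (mul_le_mul_of_nonneg_left (hd n).le (Real.exp_pos _).le)
  have : y' = x' := dist_le_zero.1 h0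
  exact hy N (by rw [← hy', this]; exact hx'L)

end IsFinMin

/-! ### Convergence to the kernel Julia set -/

variable {τ : ProbabilityMeasure Rat}

theorem G_invariant_of_supp {L : Set CHat} (h : ∀ g ∈ supp τ, ∀ x ∈ L, g x ∈ L) :
    ∀ g ∈ G τ, g '' L ⊆ L := by
  rintro g hg _ ⟨x, hx, rfl⟩
  induction hg with
  | of g hg => exact h g hg x hx
  | comp g k hg _ ih => exact h g hg _ ih

theorem supp_invariant_of_G {L : Set CHat} (h : ∀ g ∈ G τ, g '' L ⊆ L) :
    ∀ g ∈ supp τ, ∀ x ∈ L, g x ∈ L := fun g hg x hx => h g (Gen.of g hg) ⟨x, hx, rfl⟩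

theorem minimal_of_mem_Min {L : Set CHat} (hL : L ∈ Min (G τ) (Jker (G τ))) :
    Minimal (fun L => IsCompact L ∧ L.Nonempty ∧ L ⊆ Jker (G τ) ∧ ∀ g ∈ G τ, g '' L ⊆ L) L := hL

theorem finite_Min (hJ : (Jker (G τ)).Finite) : (Min (G τ) (Jker (G τ))).Finite :=
  hJ.finite_subsets.subset fun _ hL => (minimal_of_mem_Min hL).prop.2.2.1

theorem exists_isFinMin (hJ : (Jker (G τ)).Finite) {L : Set CHat}
    (hL : L ∈ Min (G τ) (Jker (G τ))) : ∃ K : Finset CHat, (K : Set CHat) = L ∧ IsFinMin τ K := by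
  have hm := minimal_of_mem_Min hL
  obtain ⟨-, hne, hsub, hinv⟩ := hm.prop
  obtain ⟨K, hK⟩ := (hJ.subset hsub).exists_finset_coe
  refine ⟨K, hK, ?_, ?_, ?_⟩
  · rw [← Finset.coe_nonempty, hK]; exact hne
  · intro g hg x hx
    rw [← Finset.mem_coe, hK] at hx ⊢
    exact supp_invariant_of_G hinv g hg x hx
  · intro K' hK' hne' hinv'
    have hsub' : (K' : Set CHat) ⊆ L := by rw [← hK]; exact Finset.coe_subset.2 hK'
    have hle : L ⊆ K' := hm.le_of_le ⟨K'.finite_toSet.isCompact, Finset.coe_nonempty.2 hne',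
      hsub'.trans hsub, G_invariant_of_supp fun g hg x hx =>
        Finset.mem_coe.2 (hinv' g hg x (Finset.mem_coe.1 hx))⟩ hsub'
    rw [← hK] at hle
    exact Finset.Subset.antisymm hK' (Finset.coe_subset.1 hle)

/-- The semigroup orbit of `x` is a finite invariant set, hence contains a minimal one. -/
theorem exists_mem_Min (hJ : (Jker (G τ)).Finite) {x : CHat} (hx : x ∈ Jker (G τ)) :
    ∃ g ∈ G τ, ∃ L ∈ Min (G τ) (Jker (G τ)), g x ∈ L := by
  set s : Set (Set CHat) :=
    {L | IsCompact L ∧ L.Nonempty ∧ L ⊆ Jker (G τ) ∧ ∀ g ∈ G τ, g '' L ⊆ L} with hs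
  have hfin : s.Finite := hJ.finite_subsets.subset fun _ hL => hL.2.2.1
  set O : Set CHat := (fun g : CHat → CHat => g x) '' G τ with hO
  have hOsub : O ⊆ Jker (G τ) := by
    rintro _ ⟨g, hg, rfl⟩
    exact mem_Jker_of_mem hg hx
  have hOs : O ∈ s := by
    refine ⟨(hJ.subset hOsub).isCompact, ?_, hOsub, ?_⟩
    · obtain ⟨g, hg⟩ := (ae_mem_supp τ).exists
      exact ⟨g x, g, Gen.of g hg, rfl⟩
    · rintro k hk _ ⟨_, ⟨g, hg, rfl⟩, rfl⟩
      exact ⟨k ∘ g, G_comp hk hg, rfl⟩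
  obtain ⟨L, hLO, hL⟩ := hfin.exists_le_minimal hOs
  obtain ⟨y, hy⟩ := hL.prop.2.1
  obtain ⟨g, hg, rfl⟩ := hLO hy
  exact ⟨g, hg, L, hL, hy⟩

/-- Off the kernel some semigroup element leads into the Fatou set, with locally uniform
probability; compactness makes this uniform away from the kernel. -/
theorem ae_hits_Fatou (τ : ProbabilityMeasure Rat) {ε : ℝ} (hε : 0 < ε) (y : CHat) :
    ∀ᵐ γ ∂(prodMeas τ),
      (∃ᶠ n in atTop, comps γ n y ∈ {u | ∀ x ∈ Jker (G τ), ε ≤ dist u x}) →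
      ∃ n, comps γ n y ∈ Fatou (G τ) := by
  set K : Set CHat := {u | ∀ x ∈ Jker (G τ), ε ≤ dist u x} with hK
  have hKcl : IsClosed K := by
    have : K = ⋂ x ∈ Jker (G τ), {u | ε ≤ dist u x} := by ext; simp [hK]
    rw [this]
    exact isClosed_biInter fun x _ =>
      isClosed_le continuous_const (continuous_id.dist continuous_const)
  have h1 : ∀ u ∈ K, ∃ W ∈ 𝓝 u, ∃ p > 0, ∃ n, ∀ y' ∈ W,
      p ≤ prodMeas τ {γ | comps γ n y' ∈ Fatou (G τ)} := by
    intro u hu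
    have hnot : u ∉ Jker (G τ) := fun hmem => by
      have := hu u hmem
      rw [dist_self] at this
      linarith
    simp only [Jker, Set.mem_iInter, Set.mem_preimage, not_forall] at hnot
    obtain ⟨g, hg, hgu⟩ := hnot
    exact exists_nhds_prodMeas_comps hg (isOpen_Fatou _) (not_not.1 hgu)
  choose! W hW p hp n hn using h1
  obtain ⟨t, htK, hcov⟩ := hKcl.isCompact.elim_nhds_subcover W hW
  obtain ⟨p₀, hp₀, hle⟩ := exists_pos_forall_le t p (fun u hu => hp u (htK u hu)) one_pos
  refine ae_hits_of_frequently (isOpen_Fatou _).measurableSet hKcl.measurableSet hp₀ ?_ y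
  intro u hu
  obtain ⟨v, hv, huv⟩ := Set.mem_iUnion₂.1 (hcov hu)
  exact ⟨n v, (hle v hv).trans (hn v (htK v hv) u huv)⟩

theorem ae_hits_Min (hJ : (Jker (G τ)).Finite) : ∀ᵐ γ ∂(prodMeas τ), ∀ x ∈ Jker (G τ),
    ∃ n, ∃ L ∈ Min (G τ) (Jker (G τ)), comps γ n x ∈ L := by
  set A : Set CHat := ⋃ L ∈ Min (G τ) (Jker (G τ)), L with hA
  have hAsub : A ⊆ Jker (G τ) := Set.iUnion₂_subset fun L hL =>
    (minimal_of_mem_Min hL).prop.2.2.1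
  have hAm : MeasurableSet A := (hJ.subset hAsub).measurableSet
  -- The set `A` is finite, so an open set meeting the kernel exactly in `A` replaces it; orbits of
  -- kernel points never leave the kernel.
  have hO : IsOpen (Jker (G τ) \ A)ᶜ := (hJ.subset Set.sdiff_subset).isClosed.isOpen_compl
  have h1 : ∀ x ∈ Jker (G τ), ∃ p > 0, ∃ n, p ≤ prodMeas τ {γ | comps γ n x ∈ A} := by
    intro x hx
    obtain ⟨g, hg, L, hL, hgL⟩ := exists_mem_Min hJ hx
    have hgA : g x ∈ A := Set.mem_iUnion₂.2 ⟨L, hL, hgL⟩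
    obtain ⟨W, hW, p, hp, n, hn⟩ := exists_nhds_prodMeas_comps hg hO (fun h => h.2 hgA)
    refine ⟨p, hp, n, (hn x (mem_of_mem_nhds hW)).trans (measure_mono_ae ?_)⟩
    filter_upwards [ae_mem_X τ] with γ hγ hmem
    by_contra hnA
    exact hmem ⟨comps_mem_of_invariant (Jker_invariant τ) hγ hx n, hnA⟩
  choose! p hp n hn using h1
  obtain ⟨p₀, hp₀, hle⟩ := exists_pos_forall_le hJ.toFinset p
    (fun u hu => hp u (hJ.mem_toFinset.1 hu)) one_pos
  have key : ∀ x, ∀ᵐ γ ∂(prodMeas τ), (∃ᶠ n in atTop, comps γ n x ∈ Jker (G τ)) →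
      ∃ n, comps γ n x ∈ A :=
    ae_hits_of_frequently hAm hJ.measurableSet hp₀ fun u hu =>
      ⟨n u, (hle u (hJ.mem_toFinset.2 hu)).trans (hn u hu)⟩
  have hall : ∀ᵐ γ ∂(prodMeas τ), ∀ x ∈ hJ.toFinset,
      (∃ᶠ n in atTop, comps γ n x ∈ Jker (G τ)) → ∃ n, comps γ n x ∈ A :=
    (Filter.eventually_all_finset _).2 fun x _ => key x
  filter_upwards [hall, ae_mem_X τ] with γ hγ hγX x hx
  obtain ⟨n, hn⟩ := hγ x (hJ.mem_toFinset.2 hx) (Eventually.frequently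
    (Eventually.of_forall fun n => comps_mem_of_invariant (Jker_invariant τ) hγX hx n))
  obtain ⟨L, hL, hmem⟩ := Set.mem_iUnion₂.1 hn
  exact ⟨n, L, hL, hmem⟩

/-- An orbit that converges to a finite invariant set is asymptotic to an orbit in that set. -/
theorem exists_shadowing (hc : IsCompact (supp τ)) {Y : Set CHat} (hY : Y.Finite)
    (hinv : ∀ g ∈ supp τ, ∀ x ∈ Y, g x ∈ Y) {γ : ℕ → Rat} (hγ : γ ∈ X τ) {y : CHat}
    (h : ∀ ε > 0, ∀ᶠ n in atTop, ∃ x ∈ Y, dist (comps γ n y) x < ε) :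
    ∃ N, ∃ x ∈ Y, Tendsto (fun k => dist (comps (shift N γ) k (comps γ N y))
      (comps (shift N γ) k x)) atTop (𝓝 0) := by
  classical
  -- Points of `Y` are `σ`-separated and the maps move `δ`-close points by less than `σ / 2`, so the
  -- point of `Y` near the orbit at the next time must be the image of the present one.
  obtain ⟨σ, hσ, hsep⟩ : ∃ σ > 0, ∀ x ∈ Y, ∀ x' ∈ Y, dist x x' < σ → x = x' := by
    obtain ⟨σ, hσ, hle⟩ := exists_pos_forall_le (hY.toFinset ×ˢ hY.toFinset)
      (fun p => if p.1 = p.2 then 1 else dist p.1 p.2) (fun p _ => by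
        split_ifs with hp
        · exact one_pos
        · exact dist_pos.2 hp) one_pos
    refine ⟨σ, hσ, fun x hx x' hx' hlt => ?_⟩
    by_contra hne
    have := hle (x, x') (Finset.mk_mem_product (hY.mem_toFinset.2 hx) (hY.mem_toFinset.2 hx'))
    simp only [hne, if_false] at this
    linarith
  obtain ⟨δ, hδ, hδle⟩ : ∃ δ > 0, ∀ g ∈ supp τ, ∀ x ∈ Y, ∀ u, dist u x < δ →
      dist (g u) (g x) < σ / 2 := by
    have h1 : ∀ x : CHat, ∃ δ > 0, ∀ g ∈ supp τ, ∀ u, dist u x < δ → dist (g u) (g x) < σ / 2 :=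
      fun x => exists_uniform_dist hc x (half_pos hσ)
    choose δ hδ hd using h1
    obtain ⟨δ₀, hδ₀, hle⟩ := exists_pos_forall_le hY.toFinset δ (fun x _ => hδ x) one_pos
    exact ⟨δ₀, hδ₀, fun g hg x hx u hu =>
      hd x g hg u (hu.trans_le (hle x (hY.mem_toFinset.2 hx)))⟩
  obtain ⟨N, hN⟩ := eventually_atTop.1 (h (min δ (σ / 2)) (lt_min hδ (half_pos hσ)))
  obtain ⟨x, hx, hxN⟩ := hN N le_rfl
  set γ' := shift N γ with hγ'
  have hγ'X : γ' ∈ X τ := shift_mem_X hγ N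
  have hmem : ∀ k, comps γ' k x ∈ Y :=
    comps_mem_of_invariant (G_invariant_of_supp hinv) hγ'X hx
  have hσ2 : ∀ k, dist (comps γ' k (comps γ N y)) (comps γ' k x) < min δ (σ / 2) := by
    intro k
    induction k with
    | zero => exact hxN
    | succ k ih =>
      have h1 : dist (comps γ' (k + 1) (comps γ N y)) (comps γ' (k + 1) x) < σ / 2 :=
        hδle _ (hγ'X k) _ (hmem k) _ (ih.trans_le (min_le_left _ _))
      obtain ⟨x', hx', hd⟩ := hN (N + (k + 1)) (by omega)
      rw [comps_add] at hd
      have h2 : x' = comps γ' (k + 1) x := by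
        refine hsep _ hx' _ (hmem (k + 1)) ?_
        have := dist_triangle_left x' (comps γ' (k + 1) x) (comps γ' (k + 1) (comps γ N y))
        have h3 := hd.trans_le (min_le_right _ _)
        linarith
      rwa [h2] at hd
  refine ⟨N, x, hx, ?_⟩
  rw [Metric.tendsto_atTop]
  intro ε hε
  obtain ⟨M, hM⟩ := eventually_atTop.1 (h (min ε (σ / 2)) (lt_min hε (half_pos hσ)))
  refine ⟨M, fun k hk => ?_⟩
  obtain ⟨x', hx', hd⟩ := hM (N + k) (by omega)
  rw [comps_add] at hd
  have h2 : x' = comps γ' k x := by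
    refine hsep _ hx' _ (hmem k) ?_
    have := dist_triangle_left x' (comps γ' k x) (comps γ' k (comps γ N y))
    have h3 := hd.trans_le (min_le_right _ _)
    have h4 := (hσ2 k).trans_le (min_le_right _ _)
    linarith
  rw [h2] at hd
  rw [Real.dist_eq, sub_zero, abs_of_nonneg dist_nonneg]
  exact hd.trans_le (min_le_left _ _)

theorem shift_shift (m n : ℕ) (γ : ℕ → Rat) : shift n (shift m γ) = shift (m + n) γ := by
  funext k
  simp only [shift]
  congr 1
  omega

/-! ### The random Julia sets -/

theorem Hplus_subset_Jker : (⋃ L ∈ Hplus τ, L) ⊆ Jker (G τ) :=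
  Set.iUnion₂_subset fun _ hL => (minimal_of_mem_Min hL.1).prop.2.2.1

theorem consSeq_mem_X {g : Rat} {γ : ℕ → Rat} (h : consSeq g γ ∈ X τ) : γ ∈ X τ :=
  fun n => h (n + 1)

/-- Almost surely on this event the orbit approaches a minimal set of negative exponent, hence
visits points whose probability of lying in the random Julia set is at most `ε`. The event is
inherited along the orbit, so `prodMeas_le_of_hits` carries this bound back to `y`. -/
theorem prodMeas_JuliaSeq_avoiding_Hplus (hc : IsCompact (supp τ)) (hJ : (Jker (G τ)).Finite)
    (hχ : ∀ L ∈ Min (G τ) (Jker (G τ)), χ τ L ≠ 0)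
    (hD : ∀ L ∈ Min (G τ) (Jker (G τ)), 0 < χ τ L → ∀ g ∈ supp τ, ∀ x ∈ L, D g x ≠ 0)
    (y : CHat) : prodMeas τ {γ | γ ∈ X τ ∧ y ∈ JuliaSeq γ ∧
      ∀ n, comps γ n y ∉ ⋃ L ∈ Hplus τ, L} = 0 := by
  set Q : Set (CHat × (ℕ → Rat)) := {q | q.2 ∈ X τ ∧ q.1 ∈ JuliaSeq q.2 ∧
      ∀ n, comps q.2 n q.1 ∉ ⋃ L ∈ Hplus τ, L} with hQdef
  have hHm : MeasurableSet (⋃ L ∈ Hplus τ, L) := (hJ.subset Hplus_subset_Jker).measurableSet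
  have hQm : MeasurableSet Q := by
    have e : Q = (Prod.snd ⁻¹' X τ) ∩ ({q : CHat × (ℕ → Rat) | q.1 ∈ JuliaSeq q.2} ∩
        ⋂ n, ((fun q : CHat × (ℕ → Rat) => comps q.2 n q.1) ⁻¹' ⋃ L ∈ Hplus τ, L)ᶜ) := by
      ext q
      simp only [hQdef, Set.mem_ofPred_eq, Set.mem_inter_iff, Set.mem_preimage, Set.mem_iInter,
        Set.mem_compl_iff]
    rw [e]
    exact (measurable_snd (measurableSet_X τ)).inter (measurableSet_JuliaSeq.inter
      (.iInter fun n => (measurable_comps n hHm).compl))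
  have hQ : ∀ y g γ, (y, consSeq g γ) ∈ Q → (g y, γ) ∈ Q := by
    rintro y g γ ⟨h1, h2, h3⟩
    refine ⟨consSeq_mem_X h1, fun hF => h2 (mem_FatouSeq_consSeq hF), fun n => ?_⟩
    have := h3 (n + 1)
    rwa [comps_consSeq] at this
  have hle : ∀ ε : ENNReal, 0 < ε → prodMeas τ {γ | (y, γ) ∈ Q} ≤ ε := by
    intro ε hε
    have hKm : MeasurableSet {u | prodMeas τ {γ | u ∈ JuliaSeq γ} ≤ ε} :=
      measurableSet_le (measurable_measure_prodMk_left measurableSet_JuliaSeq) measurable_const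
    refine prodMeas_le_of_hits hQm hQ hKm
      (fun u hu => (measure_mono fun γ h => h.2.1).trans hu) (fun y => ?_) y
    have hF : ∀ᵐ γ ∂(prodMeas τ), ∀ k : ℕ, (∃ᶠ n in atTop, comps γ n y ∈
        {u | ∀ x ∈ Jker (G τ), 1 / ((k : ℝ) + 1) ≤ dist u x}) →
        ∃ n, comps γ n y ∈ Fatou (G τ) :=
      ae_all_iff.2 fun k => ae_hits_Fatou τ (by positivity) y
    have hrep : ∀ᵐ γ ∂(prodMeas τ), ∀ L ∈ (finite_Min hJ).toFinset, 0 < χ τ L → ∀ x ∈ L, ∀ y,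
        (∀ n, comps γ n y ∉ L) →
        ¬ Tendsto (fun n => dist (comps γ n y) (comps γ n x)) atTop (𝓝 0) := by
      refine (Filter.eventually_all_finset _).2 fun L hL => ?_
      have hL' := (finite_Min hJ).mem_toFinset.1 hL
      by_cases hpos : 0 < χ τ L
      · obtain ⟨K, rfl, hK⟩ := exists_isFinMin hJ hL'
        filter_upwards [hK.ae_not_tendsto_of_repulsion hc hpos fun g hg x hx =>
          hD K hL' hpos g hg x (Finset.mem_coe.2 hx)] with γ hγ _ x hx y hy
        exact hγ x (Finset.mem_coe.1 hx) y fun n hn => hy n (Finset.mem_coe.2 hn)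
      · exact Eventually.of_forall fun γ h => absurd h hpos
    -- The first two facts are applied after the random times `N` and `N + n`, hence for all shifts.
    filter_upwards [ae_shift (ae_hits_Min hJ), ae_shift hrep, hF] with γ hγM hγR hγF hq
    obtain ⟨hγX, hyJ, hyH⟩ := hq
    have hnF : ∀ n, comps γ n y ∉ Fatou (G τ) := fun n hn =>
      hyJ (mem_FatouSeq_of_comps_mem_Fatou hγX hn)
    have hconv : ∀ ε > 0, ∀ᶠ n in atTop, ∃ x ∈ Jker (G τ), dist (comps γ n y) x < ε := by
      intro ε hε
      obtain ⟨k, hk⟩ := exists_nat_one_div_lt hε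
      have h1 : ¬ ∃ᶠ n in atTop, comps γ n y ∈
          {u | ∀ x ∈ Jker (G τ), 1 / ((k : ℝ) + 1) ≤ dist u x} := fun h => by
        obtain ⟨n, hn⟩ := hγF k h
        exact hnF n hn
      filter_upwards [not_frequently.1 h1] with n hn
      push Not at hn
      obtain ⟨x, hx, hd⟩ := hn
      exact ⟨x, hx, hd.trans hk⟩
    obtain ⟨N, x, hx, hlim⟩ := exists_shadowing hc hJ
      (supp_invariant_of_G (Jker_invariant τ)) hγX hconv
    obtain ⟨n, L, hL, hmem⟩ := hγM N x hx
    set γ' := shift (N + n) γ with hγ'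
    set x' := comps (shift N γ) n x with hx'
    set y' := comps γ (N + n) y with hy'
    have hγ'X : γ' ∈ X τ := shift_mem_X hγX _
    have hlim' : Tendsto (fun k => dist (comps γ' k y') (comps γ' k x')) atTop (𝓝 0) := by
      refine (hlim.comp (tendsto_add_atTop_nat n)).congr fun k => ?_
      simp only [Function.comp]
      rw [add_comm k n, comps_add, comps_add _ n k x, shift_shift, ← comps_add]
    have hyn : ∀ k, comps γ' k y' = comps γ (N + n + k) y := fun k => (comps_add _ _ _ _).symm
    -- A negative exponent yields the visit sought; a positive one would force the orbit onto a set
    -- of `H₊`, which the event excludes.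
    rcases lt_or_gt_of_ne (hχ L hL) with hneg | hpos
    · obtain ⟨K, rfl, hK⟩ := exists_isFinMin hJ hL
      obtain ⟨r, hr, hrJ⟩ := hK.exists_prodMeas_JuliaSeq_le hc hneg hε
      obtain ⟨k, hk⟩ := (hlim'.eventually (gt_mem_nhds hr)).exists
      refine ⟨N + n + k, ?_⟩
      rw [← hyn k]
      exact hrJ _ (hK.comps_mem hγ'X (Finset.mem_coe.1 hmem) k) _ hk
    · refine absurd hlim' (hγR (N + n) L ((finite_Min hJ).mem_toFinset.2 hL) hpos x' hmem y'
        fun k hk => ?_)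
      rw [hyn k] at hk
      exact hyH _ (Set.mem_iUnion₂.2 ⟨L, ⟨hL, hpos⟩, hk⟩)
  refine le_antisymm (le_of_forall_pos_le_add fun ε hε => ?_) bot_le
  rw [zero_add]
  exact hle ε hε

/-! ### Countability of the exceptional set and almost sure Fatou membership -/

theorem exists_frequently_of_le_measure {α : Type*} [MeasurableSpace α] {μ : Measure α}
    [IsFiniteMeasure μ] {A : ℕ → Set α} (hA : ∀ j, MeasurableSet (A j)) {c : ENNReal}
    (hc : 0 < c) (h : ∀ j, c ≤ μ (A j)) : ∃ x, ∃ᶠ j in atTop, x ∈ A j := by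
  set B : ℕ → Set α := fun N => ⋃ j ≥ N, A j with hB
  have hBm : ∀ N, MeasurableSet (B N) := fun N =>
    MeasurableSet.iUnion fun j => MeasurableSet.iUnion fun _ => hA j
  have hanti : Antitone B := fun M N hMN =>
    Set.iUnion₂_subset fun j hj => Set.subset_iUnion₂_of_subset j (hMN.trans hj) subset_rfl
  have hlim := tendsto_measure_iInter_atTop (μ := μ) (fun N => (hBm N).nullMeasurableSet) hanti
    ⟨0, measure_ne_top _ _⟩
  have hle : c ≤ μ (⋂ N, B N) := ge_of_tendsto hlim (Eventually.of_forall fun N =>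
    (h N).trans (measure_mono (Set.subset_iUnion₂_of_subset N le_rfl subset_rfl)))
  obtain ⟨x, hx⟩ := nonempty_of_measure_ne_zero (hc.trans_le hle).ne'
  refine ⟨x, frequently_atTop.2 fun N => ?_⟩
  obtain ⟨j, hj, hxj⟩ := Set.mem_iUnion₂.1 (Set.mem_iInter.1 hx N)
  exact ⟨j, hj, hxj⟩

theorem measurableSet_comps_eq (n : ℕ) (y a : CHat) :
    MeasurableSet {γ : ℕ → Rat | comps γ n y = a} :=
  measurable_comps_left n y (measurableSet_singleton a)

/-- If infinitely many `y` had probability at least `1 / k`, some single `γ` would send infinitely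
many of them to `a`, contradicting finiteness of fibres. -/
theorem countable_setOf_prodMeas_comps_eq_ne_zero (τ : ProbabilityMeasure Rat) (n : ℕ) (a : CHat) :
    {y | prodMeas τ {γ | comps γ n y = a} ≠ 0}.Countable := by
  have hfin : ∀ k : ℕ, {y | ((k : ENNReal))⁻¹ ≤ prodMeas τ {γ | comps γ n y = a}}.Finite := by
    intro k
    by_contra hinf
    have hinf : Set.Infinite _ := hinf
    set u := hinf.natEmbedding with hu
    obtain ⟨γ, hγ⟩ := exists_frequently_of_le_measure (μ := prodMeas τ)
      (A := fun j => {γ | comps γ n (u j) = a}) (fun j => measurableSet_comps_eq n _ a)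
      (ENNReal.inv_pos.2 (ENNReal.natCast_ne_top k)) (fun j => (u j).2)
    refine Nat.frequently_atTop_iff_infinite.1 hγ ?_
    refine ((finite_fiber_comps γ n a).preimage (f := fun j => ((u j : _) : CHat)) ?_)
    exact (Subtype.val_injective.comp u.injective).injOn
  refine (Set.countable_iUnion fun k => (hfin k).countable).mono fun y hy => ?_
  obtain ⟨k, hk⟩ := ENNReal.exists_inv_nat_lt hy
  exact Set.mem_iUnion.2 ⟨k, hk.le⟩

theorem countable_compl_Omega (hJ : (Jker (G τ)).Finite) : (Omega τ)ᶜ.Countable := by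
  have hH : (⋃ L ∈ Hplus τ, L).Finite := hJ.subset Hplus_subset_Jker
  refine (Set.countable_iUnion fun n : ℕ => hH.countable.biUnion fun a _ =>
    countable_setOf_prodMeas_comps_eq_ne_zero τ n a).mono fun y hy => ?_
  by_contra hcon
  simp only [Set.mem_iUnion, not_exists] at hcon
  apply hy
  have hnull : prodMeas τ (⋃ n : ℕ, ⋃ a ∈ (⋃ L ∈ Hplus τ, L), {γ | comps γ n y = a}) = 0 := by
    refine measure_iUnion_null fun n => (measure_biUnion_null_iff hH.countable).2 fun a ha => ?_
    by_contra h0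
    obtain ⟨L, hL, haL⟩ := Set.mem_iUnion₂.1 ha
    exact hcon n a ⟨L, ⟨hL, haL⟩⟩ h0
  refine measure_mono_null ?_ hnull
  rintro γ ⟨-, n, -, hmem⟩
  exact Set.mem_iUnion.2 ⟨n, Set.mem_iUnion₂.2 ⟨_, hmem, rfl⟩⟩

theorem prodMeas_JuliaSeq_eq_zero (hc : IsCompact (supp τ)) (hJ : (Jker (G τ)).Finite)
    (hχ : ∀ L ∈ Min (G τ) (Jker (G τ)), χ τ L ≠ 0)
    (hD : ∀ L ∈ Min (G τ) (Jker (G τ)), 0 < χ τ L → ∀ g ∈ supp τ, ∀ x ∈ L, D g x ≠ 0)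
    {z : CHat} (hz : z ∈ Omega τ) : prodMeas τ {γ | γ ∈ X τ ∧ z ∈ JuliaSeq γ} = 0 := by
  refine measure_mono_null ?_
    (measure_union_null (prodMeas_JuliaSeq_avoiding_Hplus hc hJ hχ hD z) hz)
  rintro γ ⟨hγ, hzJ⟩
  by_cases h : ∀ n, comps γ n z ∉ ⋃ L ∈ Hplus τ, L
  · exact Or.inl ⟨hγ, hzJ, h⟩
  · push Not at h
    obtain ⟨n, hn⟩ := h
    -- The set `Omega` counts hits from time `1` on; by invariance a hit at time `n`, possibly `0`,
    -- is followed by one at time `n + 1`.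
    refine Or.inr ⟨hγ, n + 1, by omega, ?_⟩
    obtain ⟨L, hL, hnL⟩ := Set.mem_iUnion₂.1 hn
    refine Set.mem_iUnion₂.2 ⟨L, hL, ?_⟩
    rw [comps_succ]
    exact supp_invariant_of_G (minimal_of_mem_Min hL.1).prop.2.2.2 _ (hγ n) _ hnL

theorem ae_mem_FatouSeq (hc : IsCompact (supp τ)) (hJ : (Jker (G τ)).Finite)
    (hχ : ∀ L ∈ Min (G τ) (Jker (G τ)), χ τ L ≠ 0)
    (hD : ∀ L ∈ Min (G τ) (Jker (G τ)), 0 < χ τ L → ∀ g ∈ supp τ, ∀ x ∈ L, D g x ≠ 0)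
    {z : CHat} (hz : z ∈ Omega τ) : ∀ᵐ γ ∂(prodMeas τ), z ∈ FatouSeq γ := by
  have h : ∀ᵐ γ ∂(prodMeas τ), ¬ (γ ∈ X τ ∧ z ∈ JuliaSeq γ) :=
    measure_eq_zero_iff_ae_notMem.1 (prodMeas_JuliaSeq_eq_zero hc hJ hχ hD hz)
  filter_upwards [h, ae_mem_X τ] with γ h1 h2
  by_contra h3
  exact h1 ⟨h2, h3⟩

/-! ### Area of the random Julia sets -/

theorem continuous_ofC : Continuous ofC := OnePoint.continuous_coe

instance : SFinite Leb₂ := by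
  unfold Leb₂
  infer_instance

theorem Leb₂_countable {s : Set CHat} (hs : s.Countable) : Leb₂ s = 0 := by
  rw [Leb₂, Measure.map_apply continuous_ofC.measurable hs.measurableSet]
  exact (withDensity_absolutelyContinuous _ _) ((hs.preimage ofC_injective).measure_zero volume)

/-- Fubini: for area-almost every `z` the sequences with `z` in their Julia set are null, since the
complement of `Omega` is countable. -/
theorem ae_Leb₂_JuliaSeq_eq_zero (hc : IsCompact (supp τ)) (hJ : (Jker (G τ)).Finite)
    (hχ : ∀ L ∈ Min (G τ) (Jker (G τ)), χ τ L ≠ 0)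
    (hD : ∀ L ∈ Min (G τ) (Jker (G τ)), 0 < χ τ L → ∀ g ∈ supp τ, ∀ x ∈ L, D g x ≠ 0) :
    ∀ᵐ γ ∂(prodMeas τ), Leb₂ (JuliaSeq γ) = 0 := by
  have h : (Leb₂.prod (prodMeas τ)) {p | p.1 ∈ JuliaSeq p.2} = 0 := by
    rw [Measure.measure_prod_null measurableSet_JuliaSeq]
    have h1 : ∀ᵐ z ∂Leb₂, z ∈ Omega τ := Leb₂_countable (countable_compl_Omega hJ)
    filter_upwards [h1] with z hz
    exact ae_mem_FatouSeq hc hJ hχ hD hz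
  have h2 : ((prodMeas τ).prod Leb₂) {q | q.2 ∈ JuliaSeq q.1} = 0 := by
    have hm : MeasurableSet {q : (ℕ → Rat) × CHat | q.2 ∈ JuliaSeq q.1} :=
      measurable_swap measurableSet_JuliaSeq
    rw [← Measure.prod_swap, Measure.map_apply measurable_swap hm]
    exact h
  exact Measure.measure_ae_null_of_prod_null h2

/-! ### The pointwise Julia set of the transition operator -/

theorem integrable_comps (τ : ProbabilityMeasure Rat) (φ : C(CHat, ℂ)) (n : ℕ) (z : CHat) :
    Integrable (fun γ => φ (comps γ n z)) (prodMeas τ) :=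
  Integrable.of_bound (φ.continuous.measurable.comp (measurable_comps_left n z)).aestronglyMeasurable
    ‖φ‖ (Eventually.of_forall fun _ => φ.norm_coe_le_norm _)

theorem transOp_iterate_apply (τ : ProbabilityMeasure Rat) (φ : C(CHat, ℂ)) (n : ℕ) (z : CHat) :
    ((transOp τ)^[n] φ) z = ∫ γ, φ (comps γ n z) ∂(prodMeas τ) := by
  induction n generalizing z with
  | zero => simp [comps_zero]
  | succ n ih =>
    have h1 : ((transOp τ)^[n + 1] φ) z = ∫ g : Rat, ((transOp τ)^[n] φ) (g z) ∂(τ : Measure Rat) := by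
      rw [Function.iterate_succ_apply']
      rfl
    have hi := integrable_comps τ φ (n + 1) z
    rw [← prodMeas_eq_map_consSeq] at hi
    have hi2 := hi.comp_measurable measurable_consSeq
    rw [h1]
    conv_rhs => rw [← prodMeas_eq_map_consSeq]
    rw [integral_map measurable_consSeq.aemeasurable hi.aestronglyMeasurable]
    have hp := integral_prod _ hi2
    simp only [Function.comp] at hp
    rw [hp]
    simp only [comps_consSeq, ih]

theorem dualOp_iterate_apply (τ : ProbabilityMeasure Rat) (μ : C(CHat, ℂ) →L[ℂ] ℂ) (n : ℕ)
    (φ : C(CHat, ℂ)) : (dualOp τ)^[n] μ φ = μ ((transOp τ)^[n] φ) := by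
  induction n generalizing φ with
  | zero => rfl
  | succ n ih =>
    rw [Function.iterate_succ_apply', Function.iterate_succ_apply]
    exact ih _

theorem dualOp_iterate_Φ (τ : ProbabilityMeasure Rat) (n : ℕ) (z : CHat) (φ : C(CHat, ℂ)) :
    (dualOp τ)^[n] (Φ z) φ = ∫ γ, φ (comps γ n z) ∂(prodMeas τ) := by
  rw [dualOp_iterate_apply, ← transOp_iterate_apply]
  rfl

theorem eventually_norm_dualOp_iterate_sub_lt {y : CHat}
    (hy : ∀ᵐ γ ∂(prodMeas τ), y ∈ FatouSeq γ) (φ : C(CHat, ℂ)) {ε : ℝ} (hε : 0 < ε) :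
    ∀ᶠ z in 𝓝 y, ∀ n, ‖(dualOp τ)^[n] (Φ z) φ - (dualOp τ)^[n] (Φ y) φ‖ < ε := by
  -- The supremum over `n` is taken inside the integral: for almost every `γ` it tends to `0` as `z
  -- → y` by equicontinuity, and dominated convergence then gives a bound uniform in `n`.
  set F : CHat → (ℕ → Rat) → ENNReal := fun z γ =>
    ⨆ n, ‖φ (comps γ n z) - φ (comps γ n y)‖ₑ with hF
  have hm : ∀ n z, Measurable fun γ => φ (comps γ n z) := fun n z =>
    φ.continuous.measurable.comp (measurable_comps_left n z)
  have hlim : Tendsto (fun z => ∫⁻ γ, F z γ ∂(prodMeas τ)) (𝓝 y) (𝓝 (∫⁻ _, 0 ∂(prodMeas τ))) := by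
    refine tendsto_lintegral_filter_of_dominated_convergence
      (fun _ => ‖φ‖ₑ + ‖φ‖ₑ) (Eventually.of_forall fun z => ?_)
      (Eventually.of_forall fun z => Eventually.of_forall fun γ => ?_) ?_ ?_
    · exact Measurable.iSup fun n => ((hm n z).sub (hm n y)).enorm
    · refine iSup_le fun n => (enorm_sub_le).trans (add_le_add ?_ ?_) <;>
      · rw [enorm_le_iff_norm_le]
        exact φ.norm_coe_le_norm _
    · simp
    · filter_upwards [hy] with γ hγ
      have he : EquicontinuousAt (comps γ) y := (mem_FatouSeq_iff.1 hγ).self_of_nhds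
      rw [ENNReal.tendsto_nhds_zero]
      intro e he0
      have huc := CompactSpace.uniformContinuous_of_continuous φ.continuous
      obtain ⟨δ, hδ, hφ⟩ := EMetric.uniformContinuous_iff.1 huc e he0
      filter_upwards [he _ (edist_mem_uniformity hδ)] with z hz
      refine iSup_le fun n => ?_
      rw [← edist_eq_enorm_sub, edist_comm]
      exact (hφ (hz n)).le
  rw [lintegral_zero] at hlim
  filter_upwards [(ENNReal.tendsto_nhds_zero.1 hlim) (ENNReal.ofReal (ε / 2))
    (ENNReal.ofReal_pos.2 (half_pos hε))] with z hz n
  rw [dualOp_iterate_Φ, dualOp_iterate_Φ, ← integral_sub (integrable_comps τ φ n z)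
    (integrable_comps τ φ n y)]
  have h1 : ‖∫ γ, (φ (comps γ n z) - φ (comps γ n y)) ∂(prodMeas τ)‖ₑ ≤ ENNReal.ofReal (ε / 2) :=
    (enorm_integral_le_lintegral_enorm _).trans
      ((lintegral_mono fun γ => le_iSup (fun n => ‖φ (comps γ n z) - φ (comps γ n y)‖ₑ) n).trans hz)
  rw [← ofReal_norm, ENNReal.ofReal_le_ofReal_iff (half_pos hε).le] at h1
  linarith

/-- The weights sum to `1`, so the first `N` terms contribute at most `ε`, and the tail of the
weights is `(1 / 2) ^ N`. -/
theorem d₀_le (φ : ℕ → C(CHat, ℂ)) (μ ν : C(CHat, ℂ) →L[ℂ] ℂ) {ε : ℝ} (hε : 0 ≤ ε) (N : ℕ)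
    (h : ∀ j < N, ‖μ (φ j) - ν (φ j)‖ ≤ ε) : d₀ φ μ ν ≤ ε + (1 / 2 : ℝ) ^ N := by
  set a : ℕ → ℝ := fun j => (1 / 2 : ℝ) ^ (j + 1) *
    (‖μ (φ j) - ν (φ j)‖ / (1 + ‖μ (φ j) - ν (φ j)‖)) with ha
  have hgeo : HasSum (fun j : ℕ => (1 / 2 : ℝ) ^ (j + 1)) 1 := by
    have := hasSum_geometric_two.mul_right (1 / 2 : ℝ)
    simpa [pow_succ] using this
  have hfrac : ∀ t : ℝ, 0 ≤ t → t / (1 + t) ≤ 1 := fun t ht => by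
    rw [div_le_one (by positivity)]
    linarith
  have hfrac' : ∀ t : ℝ, 0 ≤ t → t / (1 + t) ≤ t := fun t ht =>
    div_le_self ht (by linarith)
  have ha1 : ∀ j, a j ≤ (1 / 2 : ℝ) ^ (j + 1) := fun j =>
    mul_le_of_le_one_right (by positivity) (hfrac _ (norm_nonneg _))
  have hsum : Summable a := Summable.of_nonneg_of_le (fun j => by positivity) ha1 hgeo.summable
  have hsplit : d₀ φ μ ν = ∑ j ∈ Finset.range N, a j + ∑' j, a (j + N) :=
    (hsum.sum_add_tsum_nat_add N).symm
  rw [hsplit]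
  refine add_le_add ?_ ?_
  · calc ∑ j ∈ Finset.range N, a j ≤ ∑ j ∈ Finset.range N, (1 / 2 : ℝ) ^ (j + 1) * ε :=
          Finset.sum_le_sum fun j hj => mul_le_mul_of_nonneg_left
            ((hfrac' _ (norm_nonneg _)).trans (h j (Finset.mem_range.1 hj))) (by positivity)
      _ = (∑ j ∈ Finset.range N, (1 / 2 : ℝ) ^ (j + 1)) * ε := (Finset.sum_mul _ _ _).symm
      _ ≤ 1 * ε := mul_le_mul_of_nonneg_right
          (sum_le_hasSum _ (fun j _ => by positivity) hgeo) hε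
      _ = ε := one_mul ε
  · have hgeoN : HasSum (fun j : ℕ => (1 / 2 : ℝ) ^ (j + N + 1)) ((1 / 2 : ℝ) ^ N) := by
      have := hgeo.mul_right ((1 / 2 : ℝ) ^ N)
      rw [one_mul] at this
      simpa only [← pow_add, add_right_comm] using this
    exact (((summable_nat_add_iff N).2 hsum).tsum_le_tsum (fun j => ha1 (j + N))
      hgeoN.summable).trans hgeoN.tsum_eq.le

theorem mem_Fpt0_of_ae_mem_FatouSeq {y : CHat} (hy : ∀ᵐ γ ∂(prodMeas τ), y ∈ FatouSeq γ) :
    y ∈ Fpt0 τ := by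
  intro φ _ ε hε
  obtain ⟨N, hN⟩ := exists_pow_lt_of_lt_one (half_pos hε) (by norm_num : (1 / 2 : ℝ) < 1)
  have h : ∀ᶠ z in 𝓝 y, ∀ j ∈ Finset.range N, ∀ n,
      ‖(dualOp τ)^[n] (Φ z) (φ j) - (dualOp τ)^[n] (Φ y) (φ j)‖ < ε / 2 :=
    (Filter.eventually_all_finset _).2 fun j _ =>
      eventually_norm_dualOp_iterate_sub_lt hy (φ j) (half_pos hε)
  obtain ⟨δ, hδ, hball⟩ := Metric.eventually_nhds_iff.1 h
  refine ⟨δ, hδ, fun z hz n => ?_⟩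
  have := d₀_le φ _ _ (half_pos hε).le N fun j hj => (hball hz j (Finset.mem_range.2 hj) n).le
  linarith

theorem Jpt0_subset_compl_Omega (hc : IsCompact (supp τ)) (hJ : (Jker (G τ)).Finite)
    (hχ : ∀ L ∈ Min (G τ) (Jker (G τ)), χ τ L ≠ 0)
    (hD : ∀ L ∈ Min (G τ) (Jker (G τ)), 0 < χ τ L → ∀ g ∈ supp τ, ∀ x ∈ L, D g x ≠ 0) :
    Jpt0 τ ⊆ (Omega τ)ᶜ := fun _ hy hΩ =>
  hy (mem_Fpt0_of_ae_mem_FatouSeq (ae_mem_FatouSeq hc hJ hχ hD hΩ))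

end

end RandomRat

theorem theoremt (τ : MeasureTheory.ProbabilityMeasure RandomRat.Rat)
    (hc : IsCompact (RandomRat.supp τ))
    (hJ : (RandomRat.Jker (RandomRat.G τ)).Finite)
    (hχ : ∀ L ∈ RandomRat.Min (RandomRat.G τ) (RandomRat.Jker (RandomRat.G τ)),
      RandomRat.χ τ L ≠ 0)
    (hD : ∀ L ∈ RandomRat.Min (RandomRat.G τ) (RandomRat.Jker (RandomRat.G τ)),
      0 < RandomRat.χ τ L → ∀ g ∈ RandomRat.supp τ, ∀ x ∈ L, RandomRat.D g x ≠ 0) :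
    (RandomRat.Omega τ)ᶜ.Countable ∧
    (∀ z ∈ RandomRat.Omega τ,
      RandomRat.prodMeas τ {γ | γ ∈ RandomRat.X τ ∧ z ∈ RandomRat.JuliaSeq γ} = 0) ∧
    (∀ᵐ γ ∂(RandomRat.prodMeas τ), RandomRat.Leb₂ (RandomRat.JuliaSeq γ) = 0) ∧
    RandomRat.Jpt0 τ ⊆ (RandomRat.Omega τ)ᶜ ∧
    (RandomRat.Jpt0 τ).Countable := by
  have ha := RandomRat.countable_compl_Omega hJ
  have hd := RandomRat.Jpt0_subset_compl_Omega hc hJ hχ hD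
  exact ⟨ha, fun z hz => RandomRat.prodMeas_JuliaSeq_eq_zero hc hJ hχ hD hz,
    RandomRat.ae_Leb₂_JuliaSeq_eq_zero hc hJ hχ hD, hd, ha.mono hd⟩
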